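/- Let $n\ge 1$, let $G_1=(V_1,E_1)$ and $G_2=(V_2,E_2)$ be (simple) graphs on $n$ vertices each, with $V_1$ and $V_2$ disjoint, and let $G_3=(V_1\cup V_2,E_3)$ be a bipartite graph with parts $V_1$ and $V_2$. Write $\Delta(G)$ for the maximum degree of $G$, $K_m$ for the complete graph and $\overline{K_m}$ for the edgeless graph on $m$ vertices, $\cup$ for disjoint union, and $mH$ for the disjoint union of $m$ copies of $H$. Suppose that $$\Delta(G_1)\le n-2,\qquad \Delta(G_2)\le n-2,\qquad \Delta(G_3)\le n-1,\qquad |E_1|+|E_2|+|E_3|\le 2n-3,$$ and that the unordered pair $\{G_1,G_2\}$ is not, up to isomorphism, one of the following seven pairs: $$\{2K_2,\;K_1\cup K_3\},\quad \{\overline{K_2}\cup K_3,\;K_2\cup K_3\},\quad \{3K_2,\;\overline{K_2}\cup K_4\},\quad \{\overline{K_3}\cup K_3,\;2K_3\},$$ $$\{2K_2\cup K_3,\;\overline{K_3}\cup K_4\},\quad \{\overline{K_4}\cup K_4,\;K_2\cup 2K_3\},\quad \{\overline{K_5}\cup K_4,\;3K_3\}.$$ Then the triple $(G_1,G_2,G_3)$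 packs: there is a bijection $f:V_1\to V_2$ such that $uv\in E_1$ implies $f(u)f(v)\notin E_2$, and $vf(v)\notin E_3$ for every $v\in V_1$. -/

import Mathlib

open SimpleGraph

/-- A bijection `f : V₁ ≃ V₂` is a list packing of the triple `(G₁, G₂, G₃)`, where `G₃` is a graph
on the disjoint union of `V₁` and `V₂`: no edge of `G₁` is sent to an edge of `G₂`, and no vertex
`v` of `V₁` is sent to one of its `G₃`-neighbours. -/
def IsListPacking {V₁ V₂ : Type*} (G₁ : SimpleGraph V₁) (G₂ : SimpleGraph V₂)
    (G₃ : SimpleGraph (V₁ ⊕ V₂)) (f : V₁ ≃ V₂) : Prop :=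
  (∀ u v : V₁, G₁.Adj u v → ¬ G₂.Adj (f u) (f v)) ∧
    ∀ v : V₁, ¬ G₃.Adj (Sum.inl v) (Sum.inr (f v))

/-- The triple `(G₁, G₂, G₃)` packs if it has a list packing. -/
def ListPacks {V₁ V₂ : Type*} (G₁ : SimpleGraph V₁) (G₂ : SimpleGraph V₂)
    (G₃ : SimpleGraph (V₁ ⊕ V₂)) : Prop :=
  ∃ f : V₁ ≃ V₂, IsListPacking G₁ G₂ G₃ f

/-- The complete graph on `k` vertices. -/
abbrev clique (k : ℕ) : SimpleGraph (Fin k) := ⊤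

/-- The graph with `k` vertices and no edges. -/
abbrev coclique (k : ℕ) : SimpleGraph (Fin k) := ⊥

/-- `G` and `H` are isomorphic to `A` and `B` respectively, or to `B` and `A` respectively, that is,
the unordered pair `{G, H}` is the unordered pair `{A, B}` up to isomorphism. -/
def SamePair {V W α β : Type*} (G : SimpleGraph V) (H : SimpleGraph W)
    (A : SimpleGraph α) (B : SimpleGraph β) : Prop :=
  (Nonempty (G ≃g A) ∧ Nonempty (H ≃g B)) ∨ (Nonempty (G ≃g B) ∧ Nonempty (H ≃g A))

/-- The seven exceptional pairs of Bollobás and Eldridge (`⊕g` is the disjoint union of graphs). -/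
def IsBollobasEldridgePair {V W : Type*} (G : SimpleGraph V) (H : SimpleGraph W) : Prop :=
  SamePair G H (clique 2 ⊕g clique 2) (coclique 1 ⊕g clique 3) ∨
  SamePair G H (coclique 2 ⊕g clique 3) (clique 2 ⊕g clique 3) ∨
  SamePair G H (clique 2 ⊕g clique 2 ⊕g clique 2) (coclique 2 ⊕g clique 4) ∨
  SamePair G H (coclique 3 ⊕g clique 3) (clique 3 ⊕g clique 3) ∨
  SamePair G H (clique 2 ⊕g clique 2 ⊕g clique 3) (coclique 3 ⊕g clique 4) ∨
  SamePair G H (coclique 4 ⊕g clique 4) (clique 2 ⊕g clique 3 ⊕g clique 3) ∨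
  SamePair G H (coclique 5 ⊕g clique 4) (clique 3 ⊕g clique 3 ⊕g clique 3)

/-! Induct on n, for the list version itself: `G₃` becomes a relation `L` of forbidden pairs.
Placing a vertex s on a vertex t obliges the neighbours of s to avoid the neighbours of t, and these
obligations are again forbidden pairs. So after a partial placement what remains is a smaller list
packing problem (`Pk.of_rest`). A placement costs at most the products of the outer degrees of s and
t and saves all deleted edges and pairs. If it saves two units net for each placed vertex, the bound
2n - 3 survives. It then remains to check that no vertex is adjacent to all others, that no vertex
is forbidden everywhere, and that the remaining pair is not exceptional (`Crit.step`). Exceptional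
pairs have exactly 2n - 3 edges, so they can only appear when the saving is exact and no forbidden
pair remains. This is what makes them manageable.

The recursion stops at two direct criteria. A random bijection has fewer than one expected conflict
when 2 e(G) e(H) / (n(n - 1)) + e(L) / n < 1 (`Pk.of_count`). If one graph has no edge, Hall's
theorem suffices (`exists_equiv_avoiding`).

For a minimal bad triple the cases are as follows. A vertex z of degree n - 2 has a single
non-neighbour w. A discharging argument in the other, sparse graph finds a leaf b and its neighbour
c of small degree with b allowed on z and c on w, and placing both removes almost half of the edges
(`Crit.pack_full`). A vertex with only one allowed image is handled by a placement elsewhere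
(`Red.pack_row_full`). An isolated vertex creates no obligations, so every placement saving two
units succeeds or leaves an exceptional pair; the structure of those pairs leads back to an
exceptional pair or to a contradiction (`Red2.pack_isolated`).

Without isolated vertices one graph, say G, has at most n - 2 edges, hence many leaves. Leaves
dispose of a nonempty `L` and of spare edges (`Red.pack_of_list`). Otherwise `L` is empty and the
count is exact. Then G is a perfect matching (`Red.pack_matching`), or H has a leaf
(`Red.pack_of_leaf`), or H has minimum degree two and a vertex of G with two leaves goes on a vertex
of H of degree two and its two neighbours (`Red.pack_of_no_leaf`).

Throughout, exceptional pairs are described by degree counts together with transitivity of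
adjacency, so that checking them is arithmetic; `Cluster.nonempty_iso` turns this description into
isomorphisms. -/

open Finset

universe u v

set_option linter.unusedSectionVars false

/-! ### Degrees, edge counts and partial placements -/

section Basics
open Classical

/-- The neighbours of a vertex, as a finset. -/
noncomputable def nbs {α : Type*} [Fintype α] (G : SimpleGraph α) (x : α) : Finset α :=
  univ.filter (G.Adj x)

/-- The degree of a vertex. -/
noncomputable def dg {α : Type*} [Fintype α] (G : SimpleGraph α) (x : α) : ℕ := (nbs G x).card

/-- The number of edges. -/
noncomputable def ed {α : Type*} [Fintype α] (G : SimpleGraph α) : ℕ := G.edgeFinset.card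

/-- The pairs of a relation, as a finset. -/
noncomputable def prs {α β : Type*} [Fintype α] [Fintype β] (L : α → β → Prop) : Finset (α × β) :=
  univ.filter fun p : α × β => L p.1 p.2

/-- The number of pairs in a relation. -/
noncomputable def eL {α β : Type*} [Fintype α] [Fintype β] (L : α → β → Prop) : ℕ := (prs L).card

/-- The elements related to `x`. -/
noncomputable def row {α β : Type*} [Fintype β] (L : α → β → Prop) (x : α) : Finset β :=
  univ.filter fun y => L x y

/-- The number of elements related to `x`. -/
noncomputable def dL {α β : Type*} [Fintype β] (L : α → β → Prop) (x : α) : ℕ := (row L x).card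

/-- A packing of `G` and `H` that avoids the relation `L`. -/
def Pk {α β : Type*} (G : SimpleGraph α) (H : SimpleGraph β) (L : α → β → Prop) : Prop :=
  ∃ f : α ≃ β, (∀ u v, G.Adj u v → ¬ H.Adj (f u) (f v)) ∧ ∀ v, ¬ L v (f v)

variable {α β : Type*} [Fintype α] [Fintype β] {G : SimpleGraph α} {H : SimpleGraph β}
  {L : α → β → Prop}

@[simp] lemma mem_nbs {x y : α} : y ∈ nbs G x ↔ G.Adj x y := by simp [nbs]

@[simp] lemma mem_prs {p : α × β} : p ∈ prs L ↔ L p.1 p.2 := by simp [prs]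

@[simp] lemma mem_row {x : α} {y : β} : y ∈ row L x ↔ L x y := by simp [row]

lemma dg_eq_degree (x : α) [Fintype (G.neighborSet x)] : dg G x = G.degree x := by
  rw [dg, ← G.card_neighborFinset_eq_degree]; congr 1; ext; simp

lemma sum_dg : ∑ x, dg G x = 2 * ed G := by
  simp_rw [dg_eq_degree]; exact G.sum_degrees_eq_twice_card_edges

lemma Pk.symm (h : Pk G H L) : Pk H G (flip L) := by
  obtain ⟨f, h1, h2⟩ := h
  refine ⟨f.symm, fun u v h h' => h1 _ _ h' (by simpa using h), fun v hv => h2 (f.symm v) ?_⟩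
  simpa [flip] using hv

lemma eL_eq_sum : eL L = ∑ x, dL L x := by
  unfold eL dL
  rw [Finset.card_eq_sum_card_fiberwise (f := Prod.fst) (t := univ) (by simp)]
  refine sum_congr rfl fun x _ => ?_
  refine card_bij' (fun p _ => p.2) (fun y _ => (x, y)) ?_ ?_ ?_ ?_
  · rintro ⟨a, b⟩ h
    obtain ⟨h1, rfl⟩ := by simpa using h
    simpa using h1
  · intro y h; simpa using h
  · rintro ⟨a, b⟩ h
    obtain ⟨h1, rfl⟩ := by simpa using h
    rfl
  · intro y h; rfl

lemma eL_flip : eL (flip L) = eL L := by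
  unfold eL
  exact card_bij' (fun p _ => p.swap) (fun y _ => y.swap) (fun p h => by simpa [flip] using h)
    (fun p h => by simpa [flip] using h) (by simp) (by simp)

lemma dL_le_eL (x : α) : dL L x ≤ eL L := by
  rw [eL_eq_sum]; exact single_le_sum (f := fun x => dL L x) (by simp) (mem_univ x)

lemma dR_le_eL (y : β) : dL (flip L) y ≤ eL L := by
  rw [← eL_flip]; exact dL_le_eL y

lemma dL_add_le_eL {x x' : α} (h : x ≠ x') : dL L x + dL L x' ≤ eL L := by
  rw [eL_eq_sum, ← sum_pair h (f := fun x => dL L x)]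
  exact sum_le_sum_of_subset (subset_univ _)

lemma dL_pos {x : α} : 0 < dL L x ↔ ∃ y, L x y := by
  simp [dL, Finset.card_pos, Finset.Nonempty]

lemma eL_pos : 0 < eL L ↔ ∃ x y, L x y := by
  simp [eL, Finset.card_pos, Finset.Nonempty]

lemma dg_pos {x : α} : 0 < dg G x ↔ ∃ y, G.Adj x y := by
  simp [dg, Finset.card_pos, Finset.Nonempty]

lemma dg_eq_zero {x : α} : dg G x = 0 ↔ ∀ y, ¬ G.Adj x y := by
  simp [dg, Finset.card_eq_zero, Finset.ext_iff]

lemma dg_eq_one {x : α} : dg G x = 1 ↔ ∃ y, ∀ z, G.Adj x z ↔ z = y := by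
  simp [dg, Finset.card_eq_one, Finset.ext_iff]

/-- A finset smaller than the type misses some element. -/
lemma exists_notMem_of_card_lt {γ : Type*} [Fintype γ] (s : Finset γ) (h : s.card < Fintype.card γ) :
    ∃ x, x ∉ s := by
  by_contra! hc
  have : s = univ := by ext; simp [hc]
  simp [this] at h

lemma insert_nbs_card (x : α) : (insert x (nbs G x)).card = dg G x + 1 := by
  rw [card_insert_of_notMem (by simp)]; rfl

lemma dg_le_iff (x : α) : dg G x + 2 ≤ Fintype.card α ↔ ∃ y, y ≠ x ∧ ¬ G.Adj x y := by
  constructor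
  · intro h
    obtain ⟨y, hy⟩ := exists_notMem_of_card_lt (insert x (nbs G x)) (by rw [insert_nbs_card]; omega)
    exact ⟨y, by simpa using hy⟩
  · rintro ⟨y, hy, hxy⟩
    have := card_le_univ (insert y (insert x (nbs G x)))
    rw [card_insert_of_notMem (by simp [hy, hxy]), insert_nbs_card] at this; omega

lemma dL_lt_iff (x : α) : dL L x + 1 ≤ Fintype.card β ↔ ∃ y, ¬ L x y := by
  constructor
  · intro h
    obtain ⟨y, hy⟩ := exists_notMem_of_card_lt (univ.filter fun y => L x y)
      (by change dL L x < _; omega)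
    exact ⟨y, by simpa using hy⟩
  · rintro ⟨y, hy⟩
    have := card_le_univ (insert y (row L x))
    rw [card_insert_of_notMem (by simp [hy])] at this
    exact this

lemma dg_le_ed (x : α) : dg G x ≤ ed G := by
  rw [dg_eq_degree]; exact G.degree_le_card_edgeFinset x

lemma ed_pos : 0 < ed G ↔ ∃ x y, G.Adj x y := by
  constructor
  · intro h
    obtain ⟨e, he⟩ := card_pos.1 h
    induction e with | _ x y => exact ⟨x, y, by simpa using he⟩
  · rintro ⟨x, y, h⟩
    exact card_pos.2 ⟨s(x, y), by simpa using h⟩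

/-- The graph with the vertices of `P` deleted. -/
abbrev del (G : SimpleGraph α) (P : Finset α) : SimpleGraph {x // x ∉ P} := G.comap Subtype.val

lemma card_compl_subtype (P : Finset α) : Fintype.card {x // x ∉ P} + P.card = Fintype.card α := by
  have := Fintype.card_subtype_compl (fun x => x ∈ P)
  have h2 := card_le_univ P
  simp only [Fintype.card_coe] at this; omega

lemma dg_del (P : Finset α) (x : {x // x ∉ P}) : dg (del G P) x = (nbs G x \ P).card := by
  unfold dg
  refine card_bij (fun y _ => y.1) ?_ ?_ ?_
  · rintro ⟨y, hy⟩ h; simpa [hy] using h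
  · intro a _ b _ h; exact Subtype.ext h
  · intro y hy
    simp at hy
    exact ⟨⟨y, hy.2⟩, by simpa using hy.1, rfl⟩

lemma dg_del_add (P : Finset α) (x : {x // x ∉ P}) :
    dg (del G P) x + (nbs G x ∩ P).card = dg G x := by
  rw [dg_del, dg, card_sdiff_add_card_inter]

/-- Everything is doubled because the degree sum over `P` counts edges inside `P` twice; the last
sum corrects for this. -/
lemma ed_del (P : Finset α) :
    2 * ed (del G P) + 2 * ∑ s ∈ P, dg G s = 2 * ed G + ∑ s ∈ P, (nbs G s ∩ P).card := by
  have h1 : 2 * ed (del G P) = ∑ x ∈ univ.filter (· ∉ P), (nbs G x \ P).card := by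
    rw [← sum_dg]
    simp_rw [dg_del]
    exact (Finset.sum_subtype (univ.filter (· ∉ P)) (by simp) (fun x => (nbs G x \ P).card)).symm
  have h2 : ∑ x ∈ univ.filter (· ∉ P), (nbs G x \ P).card + ∑ x ∈ univ.filter (· ∉ P), (nbs G x ∩ P).card
      = ∑ x ∈ univ.filter (· ∉ P), dg G x := by
    rw [← sum_add_distrib]
    exact sum_congr rfl fun x _ => card_sdiff_add_card_inter _ _
  have h3 : ∑ x ∈ univ.filter (· ∉ P), dg G x + ∑ x ∈ P, dg G x = 2 * ed G := by
    rw [← sum_dg, add_comm, ← sum_add_sum_compl P]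
    congr 2; ext; simp
  have h4 : ∑ x ∈ univ.filter (· ∉ P), (nbs G x ∩ P).card = ∑ s ∈ P, (nbs G s \ P).card := by
    have e1 : ∀ x, (nbs G x ∩ P).card = ∑ s ∈ P, if G.Adj x s then 1 else 0 := by
      intro x; rw [← card_filter]; congr 1; ext; simp [and_comm]
    have e2 : ∀ s, (nbs G s \ P).card = ∑ x ∈ univ.filter (· ∉ P), if G.Adj x s then 1 else 0 := by
      intro x; rw [← card_filter]; congr 1; ext; simp [and_comm, G.adj_comm]
    simp_rw [e1, e2]; exact sum_comm
  have h5 : ∑ s ∈ P, (nbs G s \ P).card + ∑ s ∈ P, (nbs G s ∩ P).card = ∑ s ∈ P, dg G s := by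
    rw [← sum_add_distrib]
    exact sum_congr rfl fun x _ => card_sdiff_add_card_inter _ _
  omega

/-- The relation left over after the vertices of `P` have been placed by `π`. -/
def rest (G : SimpleGraph α) (H : SimpleGraph β) (L : α → β → Prop) (P : Finset α) (Q : Finset β)
    (π : α → β) (x : {x // x ∉ P}) (y : {y // y ∉ Q}) : Prop :=
  L x y ∨ ∃ s ∈ P, G.Adj x s ∧ H.Adj y (π s)

/-- Conflicts inside `P` are excluded by hypothesis, those outside by the packing of the rest, and
those between the two are exactly the pairs added by `rest`. -/
lemma Pk.of_rest (hc : Fintype.card α = Fintype.card β) {P : Finset α} {Q : Finset β} {π : α → β}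
    (hi : Set.InjOn π P) (hQ : P.image π = Q)
    (hadj : ∀ s ∈ P, ∀ t ∈ P, G.Adj s t → ¬ H.Adj (π s) (π t)) (hl : ∀ s ∈ P, ¬ L s (π s))
    (h : Pk (del G P) (del H Q) (rest G H L P Q π)) : Pk G H L := by
  obtain ⟨f, h1, h2⟩ := h
  let g : α → β := fun x => if hx : x ∈ P then π x else f ⟨x, hx⟩
  have gP : ∀ x ∈ P, g x = π x := fun x hx => by simp [g, hx]
  have gN : ∀ x (hx : x ∉ P), g x = f ⟨x, hx⟩ := fun x hx => by simp [g, hx]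
  have hmem : ∀ x ∈ P, π x ∈ Q := fun x hx => hQ ▸ mem_image_of_mem π hx
  have ginj : Function.Injective g := by
    intro x y hxy
    by_cases hx : x ∈ P <;> by_cases hy : y ∈ P
    · rw [gP x hx, gP y hy] at hxy; exact hi hx hy hxy
    · rw [gP x hx, gN y hy] at hxy
      exact absurd (hxy ▸ hmem x hx) (f ⟨y, hy⟩).2
    · rw [gN x hx, gP y hy] at hxy
      exact absurd (hxy ▸ hmem y hy) (f ⟨x, hx⟩).2
    · rw [gN x hx, gN y hy] at hxy
      have := f.injective (Subtype.ext hxy)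
      simpa using this
  have gbij : Function.Bijective g := (Fintype.bijective_iff_injective_and_card g).2 ⟨ginj, hc⟩
  refine ⟨Equiv.ofBijective g gbij, fun x y hxy => ?_, fun x => ?_⟩
  · simp only [Equiv.ofBijective_apply]
    by_cases hx : x ∈ P <;> by_cases hy : y ∈ P
    · rw [gP x hx, gP y hy]; exact hadj x hx y hy hxy
    · rw [gP x hx, gN y hy]; intro h'
      exact h2 ⟨y, hy⟩ (Or.inr ⟨x, hx, hxy.symm, h'.symm⟩)
    · rw [gN x hx, gP y hy]; intro h'
      exact h2 ⟨x, hx⟩ (Or.inr ⟨y, hy, hxy, h'⟩)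
    · rw [gN x hx, gN y hy]; intro h'
      exact h1 ⟨x, hx⟩ ⟨y, hy⟩ hxy h'
  · simp only [Equiv.ofBijective_apply]
    by_cases hx : x ∈ P
    · rw [gP x hx]; exact hl x hx
    · rw [gN x hx]; intro h'
      exact h2 ⟨x, hx⟩ (Or.inl h')

/-- The number of pairs of `L` that avoid `P` and `Q`. -/
noncomputable def eLout (L : α → β → Prop) (P : Finset α) (Q : Finset β) : ℕ :=
  eL fun x y => L x y ∧ x ∉ P ∧ y ∉ Q

/-- A new forbidden pair is caused by some placed `s` and lies in the product of the outer
neighbourhoods of `s` and `π s`. -/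
lemma eL_rest_le (P : Finset α) (Q : Finset β) (π : α → β) :
    eL (rest G H L P Q π) ≤
      eLout L P Q + ∑ s ∈ P, (nbs G s \ P).card * (nbs H (π s) \ Q).card := by
  have : eL (rest G H L P Q π) ≤ ((prs fun x y => L x y ∧ x ∉ P ∧ y ∉ Q) ∪
      P.biUnion fun s => (nbs G s \ P) ×ˢ (nbs H (π s) \ Q)).card := by
    refine card_le_card_of_injOn (fun p => (p.1.1, p.2.1)) ?_ ?_
    · rintro ⟨⟨x, hx⟩, ⟨y, hy⟩⟩ h
      have h : rest G H L P Q π ⟨x, hx⟩ ⟨y, hy⟩ := by simpa using h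
      simp only [coe_union, Set.mem_union, mem_coe, mem_prs, mem_biUnion,
        mem_product, mem_sdiff, mem_nbs]
      rcases h with h | ⟨s, hs, h1, h2⟩
      · exact Or.inl ⟨h, hx, hy⟩
      · exact Or.inr ⟨s, hs, ⟨h1.symm, hx⟩, h2.symm, hy⟩
    · rintro ⟨⟨x, hx⟩, ⟨y, hy⟩⟩ _ ⟨⟨x', hx'⟩, ⟨y', hy'⟩⟩ _ h
      simpa using h
  refine this.trans ((card_union_le _ _).trans ?_)
  refine Nat.add_le_add (le_of_eq rfl) (card_biUnion_le.trans (le_of_eq ?_))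
  simp [card_product]

lemma eLout_le (P : Finset α) (Q : Finset β) : eLout L P Q ≤ eL L := by
  unfold eLout eL
  exact card_le_card fun p hp => by simp at hp ⊢; exact hp.1

lemma eLout_add_le {P : Finset α} {Q : Finset β} {w : β} (hw : w ∈ Q) :
    eLout L P Q + dL (flip L) w ≤ eL L := by
  have h : dL (flip L) w = ((row (flip L) w).image fun x => (x, w)).card :=
    (card_image_of_injective _ fun a b h => by simpa using h).symm
  rw [h, eLout, eL, eL, ← card_union_of_disjoint]
  · apply card_le_card
    intro p hp
    simp only [mem_union, mem_image, mem_prs, mem_row] at hp ⊢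
    rcases hp with hp | ⟨x, hx, rfl⟩
    · exact hp.1
    · exact hx
  · rw [Finset.disjoint_left]; intro p hp hp'
    simp only [mem_image, mem_prs, mem_row] at hp hp'
    obtain ⟨x, hx, rfl⟩ := hp'
    exact hp.2.2 hw

/-- The row of `x` and the column of `w` meet only in `(x, w)`, which is not in `L`, so both are
lost in full. -/
lemma eLout_single {x : α} {w : β} (hl : ¬ L x w) :
    eLout L {x} {w} + dL L x + dL (flip L) w ≤ eL L := by
  have h : dL (flip L) w = ((row (flip L) w).image fun x => (x, w)).card :=
    (card_image_of_injective _ fun a b h => by simpa using h).symm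
  have h' : dL L x = ((row L x).image fun y => (x, y)).card :=
    (card_image_of_injective _ fun a b h => by simpa using h).symm
  rw [h, h', eLout, eL, eL, ← card_union_of_disjoint, ← card_union_of_disjoint]
  · apply card_le_card
    intro p hp
    simp only [mem_union, mem_image, mem_prs, mem_row] at hp ⊢
    rcases hp with (hp | ⟨y, hy, rfl⟩) | ⟨y, hy, rfl⟩
    · exact hp.1
    · exact hy
    · exact hy
  · rw [Finset.disjoint_left]; intro p hp hp'
    simp only [mem_union, mem_image, mem_prs, mem_row] at hp hp'
    obtain ⟨y, hy, rfl⟩ := hp'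
    rcases hp with hp | ⟨z, hz, hp⟩
    · exact hp.2.2 (by simp)
    · simp only [Prod.mk.injEq] at hp
      obtain ⟨rfl, rfl⟩ := hp; exact hl hz
  · rw [Finset.disjoint_left]; intro p hp hp'
    simp only [mem_image, mem_prs, mem_row] at hp hp'
    obtain ⟨y, hy, rfl⟩ := hp'
    exact hp.2.1 (by simp)

end Basics

/-! ### Two direct criteria: expected conflicts and Hall's theorem -/

section Counting
open Classical
variable {α β : Type*} [Fintype α] [Fintype β] {G : SimpleGraph α} {H : SimpleGraph β}
  {L : α → β → Prop}

lemma exists_perm_pair {a b a' b' : β} (h : a ≠ b) (h' : a' ≠ b') :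
    ∃ π : Equiv.Perm β, π a = a' ∧ π b = b' := by
  refine ⟨(Equiv.swap a a').trans (Equiv.swap (Equiv.swap a a' b) b'), ?_, by simp⟩
  simp only [Equiv.trans_apply, Equiv.swap_apply_left]
  refine Equiv.swap_apply_of_ne_of_ne ?_ h'
  intro hh
  have : Equiv.swap a a' a = Equiv.swap a a' b := by rw [← hh]; simp
  exact h ((Equiv.swap a a').injective this)

lemma card_equiv_one (v : α) (b : β) :
    Fintype.card β * (univ.filter fun f : α ≃ β => f v = b).card = Fintype.card (α ≃ β) := by
  -- Composing with a transposition shows that all values at `v` are equally likely.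
  have h : ∀ b', (univ.filter fun f : α ≃ β => f v = b').card =
      (univ.filter fun f : α ≃ β => f v = b).card := by
    intro b'
    refine card_bij' (fun f _ => f.trans (Equiv.swap b b')) (fun f _ => f.trans (Equiv.swap b b'))
      ?_ ?_ ?_ ?_
    · intro f hf; simp at hf; simp [hf]
    · intro f hf; simp at hf; simp [hf]
    · intro f _; ext; simp
    · intro f _; ext; simp
  have h2 := card_eq_sum_card_fiberwise (s := univ) (f := fun f : α ≃ β => f v) (t := univ)
    (by simp)
  rw [card_univ] at h2
  rw [h2]
  simp [h]

lemma card_equiv_two {u v : α} (huv : u ≠ v) {a b : β} (hab : a ≠ b) :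
    (univ.offDiag (α := β)).card * (univ.filter fun f : α ≃ β => f u = a ∧ f v = b).card =
      Fintype.card (α ≃ β) := by
  have h : ∀ p ∈ univ.offDiag (α := β), (univ.filter fun f : α ≃ β => (f u, f v) = p).card =
      (univ.filter fun f : α ≃ β => f u = a ∧ f v = b).card := by
    rintro ⟨a', b'⟩ hp
    simp at hp
    obtain ⟨π, h1, h2⟩ := exists_perm_pair hab hp
    refine card_bij' (fun f _ => f.trans π.symm) (fun f _ => f.trans π) ?_ ?_ ?_ ?_ <;>
      intro f hf <;> simp at hf
    · simp [hf, ← h1, ← h2]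
    · simp [hf, h1, h2]
    · ext; simp
    · ext; simp
  have h2 := card_eq_sum_card_fiberwise (s := univ) (f := fun f : α ≃ β => (f u, f v))
    (t := univ.offDiag) (fun f _ => by simpa using huv)
  rw [card_univ] at h2
  rw [h2, sum_congr rfl h, sum_const, smul_eq_mul]

lemma eL_adj : eL G.Adj = 2 * ed G := by
  rw [eL_eq_sum, ← sum_dg]; rfl

/-- If the expected number of conflicts of a random bijection is less than one, then some bijection
has none. -/
lemma Pk.of_count (hc : Fintype.card α = Fintype.card β)
    (h : 2 * (ed G * ed H) + (Fintype.card α - 1) * eL L <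
      Fintype.card α * (Fintype.card α - 1)) : Pk G H L := by
  by_contra hn
  obtain ⟨e⟩ : Nonempty (α ≃ β) := ⟨Fintype.equivOfCardEq hc⟩
  set F := Fintype.card (α ≃ β)
  have hF : 0 < F := Fintype.card_pos_iff.2 ⟨e⟩
  set n := Fintype.card α with hn'
  have hA : n * (n - 1) * ∑ f : α ≃ β, ((prs G.Adj).filter fun p => H.Adj (f p.1) (f p.2)).card
      = 4 * (ed G * ed H) * F := by
    simp_rw [card_filter]
    rw [sum_comm]
    have : ∀ p ∈ prs G.Adj, n * (n - 1) * ∑ f : α ≃ β, (if H.Adj (f p.1) (f p.2) then 1 else 0)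
        = 2 * ed H * F := by
      rintro ⟨u, v⟩ hp
      simp only [mem_prs] at hp
      rw [← card_filter, card_eq_sum_card_fiberwise (f := fun f : α ≃ β => (f u, f v))
        (t := prs H.Adj) (fun f hf => by simpa using hf), mul_sum, ← eL_adj, eL,
        card_eq_sum_ones, sum_mul]
      refine sum_congr rfl ?_
      rintro ⟨a, b⟩ hq
      simp only [mem_prs] at hq
      have := card_equiv_two hp.ne hq.ne
      rw [offDiag_card, card_univ, ← hc, ← Nat.mul_sub_one] at this
      rw [one_mul, show F = _ from this.symm]; congr 2
      ext f; simp; rintro rfl rfl; exact hq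
    rw [mul_sum, sum_congr rfl this, sum_const, smul_eq_mul]
    change eL G.Adj * _ = _
    rw [eL_adj]; ring
  have hB : n * ∑ f : α ≃ β, (univ.filter fun v => L v (f v)).card = eL L * F := by
    simp_rw [card_filter]
    rw [sum_comm, mul_sum, eL_eq_sum, sum_mul]
    refine sum_congr rfl fun v _ => ?_
    rw [← card_filter, card_eq_sum_card_fiberwise (f := fun f : α ≃ β => f v)
        (t := row L v) (fun f hf => by simpa using hf), mul_sum, dL, card_eq_sum_ones, sum_mul]
    refine sum_congr rfl fun b hb => ?_
    simp only [mem_row] at hb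
    rw [one_mul, show F = _ from (card_equiv_one v b).symm, ← hc]
    congr 2
    ext f; simp; rintro rfl; exact hb
  -- An edge conflict is counted twice, once for each orientation, so a list conflict also gets
  -- weight two.
  have hW : ∀ f : α ≃ β, 2 ≤ ((prs G.Adj).filter fun p => H.Adj (f p.1) (f p.2)).card +
      2 * (univ.filter fun v => L v (f v)).card := by
    intro f
    by_contra! hlt
    apply hn
    refine ⟨f, fun u v huv h' => ?_, fun v hv => ?_⟩
    · have : ({(u, v), (v, u)} : Finset (α × α)) ⊆
          (prs G.Adj).filter fun p => H.Adj (f p.1) (f p.2) := by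
        intro p hp
        simp at hp
        rcases hp with rfl | rfl <;> simp [huv, h', huv.symm, h'.symm]
      have := card_le_card this
      rw [card_pair (by simp [huv.ne])] at this
      omega
    · have : 0 < (univ.filter fun v => L v (f v)).card := card_pos.2 ⟨v, by simp [hv]⟩
      omega
  have hS := sum_le_sum (s := univ) fun f (_ : f ∈ univ) => hW f
  rw [sum_const, smul_eq_mul, card_univ, sum_add_distrib, ← mul_sum] at hS
  change F * 2 ≤ _ at hS
  have := Nat.mul_le_mul_left (n * (n - 1)) hS
  rw [mul_add, hA, show n * (n - 1) * (2 * ∑ f : α ≃ β, (univ.filter fun v => L v (f v)).card) =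
    2 * (n - 1) * (n * ∑ f : α ≃ β, (univ.filter fun v => L v (f v)).card) by ring, hB] at this
  have h2 : n * (n - 1) * (F * 2) ≤ (2 * (ed G * ed H) + (n - 1) * eL L) * (F * 2) := by
    calc _ ≤ _ := this
      _ = _ := by ring
  exact absurd (Nat.le_of_mul_le_mul_right h2 (by omega)) (by omega)

/-- Few forbidden pairs leave a perfect matching. -/
lemma exists_equiv_avoiding (hc : Fintype.card α = Fintype.card β)
    (h1 : ∀ x, ∃ y, ¬ L x y) (h2 : ∀ y, ∃ x, ¬ L x y) (he : eL L + 3 ≤ 2 * Fintype.card α) :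
    ∃ f : α ≃ β, ∀ v, ¬ L v (f v) := by
  have key : ∀ s : Finset α, s.card ≤ (s.biUnion fun x => univ.filter fun y => ¬ L x y).card := by
    intro s
    by_contra! hlt
    set T := s.biUnion fun x => univ.filter fun y => ¬ L x y
    have hT : s.card * Tᶜ.card ≤ eL L := by
      rw [← card_product]
      refine card_le_card fun p hp => ?_
      simp [T] at hp
      simpa using hp.2 _ hp.1
    have hTc : T.card + Tᶜ.card = Fintype.card β := by simp
    have hs := card_le_univ s
    have hs0 : 0 < s.card := by omega
    obtain ⟨x, hx⟩ := card_pos.1 hs0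
    obtain ⟨y, hy⟩ := h1 x
    have hT0 : 0 < T.card := card_pos.2 ⟨y, by simp [T]; exact ⟨x, hx, hy⟩⟩
    have hsn : s.card ≠ Fintype.card α := by
      intro hh
      have hsu : s = univ := (card_eq_iff_eq_univ s).1 hh
      have : T = univ := by
        ext y; obtain ⟨x, hx⟩ := h2 y
        simp [T, hsu]; exact ⟨x, hx⟩
      rw [this, card_univ] at hlt; omega
    -- A Hall violator gives a rectangle `s × Tᶜ` inside `L` with both sides at least two and side
    -- sum at least n + 1, hence with at least 2n - 2 pairs.
    obtain ⟨p, hp⟩ : ∃ p, s.card = p + 2 := ⟨s.card - 2, by omega⟩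
    obtain ⟨q, hq⟩ : ∃ q, Tᶜ.card = q + 2 := ⟨Tᶜ.card - 2, by omega⟩
    have hpq : Fintype.card α ≤ p + q + 3 := by omega
    rw [hp, hq] at hT
    have : (p + 2) * (q + 2) = p * q + 2 * p + 2 * q + 4 := by ring
    have := Nat.zero_le (p * q)
    omega
  obtain ⟨f, hf, hf'⟩ := (Finset.all_card_le_biUnion_card_iff_exists_injective _).1 key
  refine ⟨Equiv.ofBijective f ((Fintype.bijective_iff_injective_and_card f).2 ⟨hf, hc⟩), fun v => ?_⟩
  simpa using hf' v

end Counting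

/-! ### Exceptional pairs, minimal counterexamples and the induction step -/

section Critical
open Classical

/-- Adjacency is transitive: every component is complete. -/
def Cluster {α : Type*} (G : SimpleGraph α) : Prop :=
  ∀ x y z, G.Adj x y → G.Adj y z → x ≠ z → G.Adj x z

/-- The number of vertices of degree `j`. -/
noncomputable def cnt {α : Type*} [Fintype α] (G : SimpleGraph α) (j : ℕ) : ℕ :=
  (univ.filter fun x => dg G x = j).card

/-- A disjoint union of complete graphs with prescribed numbers of vertices of degrees 0 to 3. -/
structure Prof {α : Type*} [Fintype α] (G : SimpleGraph α) (a b c d : ℕ) : Prop where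
  cluster : Cluster G
  c0 : cnt G 0 = a
  c1 : cnt G 1 = b
  c2 : cnt G 2 = c
  c3 : cnt G 3 = d
  card : Fintype.card α = a + b + c + d

/-- The seven exceptional pairs, in a fixed order. -/
def BE0 {α β : Type*} [Fintype α] [Fintype β] (G : SimpleGraph α) (H : SimpleGraph β) : Prop :=
  (Prof G 0 4 0 0 ∧ Prof H 1 0 3 0) ∨ (Prof G 0 2 3 0 ∧ Prof H 2 0 3 0) ∨
  (Prof G 0 6 0 0 ∧ Prof H 2 0 0 4) ∨ (Prof G 0 0 6 0 ∧ Prof H 3 0 3 0) ∨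
  (Prof G 0 4 3 0 ∧ Prof H 3 0 0 4) ∨ (Prof G 0 2 6 0 ∧ Prof H 4 0 0 4) ∨
  (Prof G 0 0 9 0 ∧ Prof H 5 0 0 4)

/-- The seven exceptional pairs. -/
def BE {α β : Type*} [Fintype α] [Fintype β] (G : SimpleGraph α) (H : SimpleGraph β) : Prop :=
  BE0 G H ∨ BE0 H G

variable {α : Type u} {β : Type v} [Fintype α] [Fintype β] {G : SimpleGraph α} {H : SimpleGraph β}
  {L : α → β → Prop}

lemma BE.symm (h : BE G H) : BE H G := Or.symm h

lemma Prof.dg_lt {a b c d : ℕ} (h : Prof G a b c d) (x : α) : dg G x < 4 := by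
  have h1 : (univ.filter fun x => dg G x < 4).card = ∑ j ∈ range 4, cnt G j := by
    rw [card_eq_sum_card_fiberwise (f := dg G) (t := range 4) (fun x hx => by simpa using hx)]
    refine sum_congr rfl fun j hj => ?_
    rw [filter_filter, cnt]; congr 1; ext x; simp at hj ⊢; omega
  simp only [sum_range_succ, range_zero, sum_empty, h.c0, h.c1, h.c2, h.c3, zero_add,
    ← h.card] at h1
  have := (card_eq_iff_eq_univ _).1 h1
  have hx := mem_univ x
  rw [← this] at hx
  simpa using hx

lemma Prof.two_ed {a b c d : ℕ} (h : Prof G a b c d) : 2 * ed G = b + 2 * c + 3 * d := by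
  have h1 := sum_fiberwise_of_maps_to (s := univ) (t := range 4) (g := dg G)
    (fun x _ => by simpa using h.dg_lt x) (dg G)
  have h2 : ∀ j, ∑ x ∈ univ.filter (fun x => dg G x = j), dg G x = j * cnt G j := by
    intro j
    rw [sum_congr rfl (fun x hx => (mem_filter.1 hx).2), sum_const, smul_eq_mul, cnt, mul_comm]
  simp only [h2, sum_range_succ, range_zero, sum_empty, h.c0, h.c1, h.c2, h.c3] at h1
  rw [← sum_dg]; omega

lemma cnt_pos {j : ℕ} : 0 < cnt G j ↔ ∃ x, dg G x = j := by
  simp [cnt, Finset.card_pos, Finset.Nonempty]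

/-- Exceptional pairs attain the edge bound with equality; an induction step with any slack cannot
produce one. -/
lemma BE.ed_add (h : BE G H) (hc : Fintype.card α = Fintype.card β) :
    ed G + ed H + 3 = 2 * Fintype.card α := by
  rcases h with h | h <;>
  rcases h with ⟨h1, h2⟩ | ⟨h1, h2⟩ | ⟨h1, h2⟩ | ⟨h1, h2⟩ | ⟨h1, h2⟩ | ⟨h1, h2⟩ | ⟨h1, h2⟩ <;>
  have e1 := h1.two_ed <;> have e2 := h2.two_ed <;> have e3 := h1.card <;> have e4 := h2.card <;>
  omega

/-- No graph in the list has both a `K₁` and a `K₂` component. -/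
lemma BE.no_mix (h : BE G H) {x y : α} (hx : dg G x = 0) (hy : dg G y = 1) : False := by
  have e1 := cnt_pos.2 ⟨x, hx⟩
  have e2 := cnt_pos.2 ⟨y, hy⟩
  rcases h with h | h <;>
  rcases h with ⟨h1, h2⟩ | ⟨h1, h2⟩ | ⟨h1, h2⟩ | ⟨h1, h2⟩ | ⟨h1, h2⟩ | ⟨h1, h2⟩ | ⟨h1, h2⟩ <;>
  have := h1.c0 <;> have := h1.c1 <;> have := h2.c0 <;> have := h2.c1 <;> omega

lemma BE.cluster (h : BE G H) : Cluster G := by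
  rcases h with h | h <;>
  rcases h with ⟨h1, h2⟩ | ⟨h1, h2⟩ | ⟨h1, h2⟩ | ⟨h1, h2⟩ | ⟨h1, h2⟩ | ⟨h1, h2⟩ | ⟨h1, h2⟩ <;>
  first | exact h1.cluster | exact h2.cluster

lemma BE.card_ge (h : BE G H) : 4 ≤ Fintype.card α := by
  rcases h with h | h <;>
  rcases h with ⟨h1, h2⟩ | ⟨h1, h2⟩ | ⟨h1, h2⟩ | ⟨h1, h2⟩ | ⟨h1, h2⟩ | ⟨h1, h2⟩ | ⟨h1, h2⟩ <;>
  have e3 := h1.card <;> have e4 := h2.card <;> omega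

/-- The hypotheses on degrees and sizes: every vertex has a non-neighbour in its own graph and a
vertex it may be placed on, and there are few edges. -/
structure Adm (G : SimpleGraph α) (H : SimpleGraph β) (L : α → β → Prop) : Prop where
  hc : Fintype.card α = Fintype.card β
  hG : ∀ x, ∃ y, y ≠ x ∧ ¬ G.Adj x y
  hH : ∀ x, ∃ y, y ≠ x ∧ ¬ H.Adj x y
  hL : ∀ x, ∃ y, ¬ L x y
  hR : ∀ y, ∃ x, ¬ L x y
  he : ed G + ed H + eL L + 3 ≤ 2 * Fintype.card α

/-- Admissible nonexceptional triples with fewer than `n` vertices on each side pack. -/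
def PackBelow (n : ℕ) : Prop :=
  ∀ (α : Type u) (β : Type v) [Fintype α] [Fintype β] (G : SimpleGraph α) (H : SimpleGraph β)
    (L : α → β → Prop), Fintype.card α < n → Adm G H L → ¬ BE G H → Pk G H L

/-- An admissible nonexceptional triple such that all smaller ones pack. -/
structure Crit (G : SimpleGraph α) (H : SimpleGraph β) (L : α → β → Prop) : Prop
    extends Adm G H L where
  ih : PackBelow.{u, v} (Fintype.card α)
  nbe : ¬ BE G H

lemma Adm.symm (h : Adm G H L) : Adm H G (flip L) :=
  ⟨h.hc.symm, h.hH, h.hG, h.hR, h.hL, by rw [eL_flip]; have := h.he; have := h.hc; omega⟩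

lemma PackBelow.symm {n : ℕ} (h : PackBelow.{u, v} n) : PackBelow.{v, u} n :=
  fun α β _ _ G H L hn ha hb =>
    (h β α H G (flip L) (ha.hc ▸ hn) ha.symm fun hb' => hb hb'.symm).symm

lemma Crit.symm (h : Crit G H L) : Crit H G (flip L) where
  toAdm := h.toAdm.symm
  ih := h.hc ▸ h.ih.symm
  nbe := fun hb => h.nbe hb.symm

/-- Place the vertices of `P` by `π` and pack the rest by induction. -/
lemma Crit.step (C : Crit G H L) {P : Finset α} {Q : Finset β} {π : α → β} (hP : 0 < P.card)
    (hi : Set.InjOn π P) (hQ : P.image π = Q)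
    (hadj : ∀ s ∈ P, ∀ t ∈ P, G.Adj s t → ¬ H.Adj (π s) (π t)) (hl : ∀ s ∈ P, ¬ L s (π s))
    (hG : ∀ x ∉ P, ∃ y ∉ P, y ≠ x ∧ ¬ G.Adj x y) (hH : ∀ x ∉ Q, ∃ y ∉ Q, y ≠ x ∧ ¬ H.Adj x y)
    (hL : ∀ x ∉ P, ∃ y ∉ Q, ¬ L x y ∧ ∀ s ∈ P, G.Adj x s → ¬ H.Adj y (π s))
    (hR : ∀ y ∉ Q, ∃ x ∉ P, ¬ L x y ∧ ∀ s ∈ P, G.Adj x s → ¬ H.Adj y (π s))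
    (he : ed (del G P) + ed (del H Q) + eL (rest G H L P Q π) + 3 + 2 * P.card ≤
      2 * Fintype.card α)
    (hB : ¬ BE (del G P) (del H Q)) : Pk G H L := by
  refine Pk.of_rest C.hc hi hQ hadj hl ?_
  have hPQ : P.card = Q.card := by rw [← hQ, card_image_of_injOn hi]
  have cP := card_compl_subtype P
  have cQ := card_compl_subtype Q
  have := C.hc
  refine C.ih _ _ _ _ _ (by omega) ⟨by omega, ?_, ?_, ?_, ?_, by omega⟩ hB
  · rintro ⟨x, hx⟩
    obtain ⟨y, h1, h2, h3⟩ := hG x hx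
    exact ⟨⟨y, h1⟩, by simpa using h2, h3⟩
  · rintro ⟨x, hx⟩
    obtain ⟨y, h1, h2, h3⟩ := hH x hx
    exact ⟨⟨y, h1⟩, by simpa using h2, h3⟩
  · rintro ⟨x, hx⟩
    obtain ⟨y, h1, h2, h3⟩ := hL x hx
    refine ⟨⟨y, h1⟩, ?_⟩
    rintro (h | ⟨s, hs, h, h'⟩)
    exacts [h2 h, h3 s hs h h']
  · rintro ⟨x, hx⟩
    obtain ⟨y, h1, h2, h3⟩ := hR x hx
    refine ⟨⟨y, h1⟩, ?_⟩
    rintro (h | ⟨s, hs, h, h'⟩)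
    exacts [h2 h, h3 s hs h h']

lemma ed_del_single (v : α) : ed (del G {v}) + dg G v = ed G := by
  have := ed_del (G := G) {v}
  simp only [sum_singleton] at this
  have h : (nbs G v ∩ {v}).card = 0 := by simp
  omega

lemma nbs_sdiff_single (v : α) : (nbs G v \ {v}).card = dg G v := by
  rw [dg, sdiff_singleton_eq_erase, erase_eq_of_notMem (by simp)]

lemma nbs_inter_pair_adj {a b : α} (h : G.Adj a b) : (nbs G a ∩ {a, b}).card = 1 := by
  rw [card_eq_one]; refine ⟨b, ?_⟩; ext x; simp; rintro rfl; exact h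

lemma nbs_inter_pair_nadj {a b : α} (h : ¬ G.Adj a b) : (nbs G a ∩ {a, b}).card = 0 := by
  rw [card_eq_zero]; ext x; simp; rintro h1 rfl; exact h h1

lemma nbs_sdiff_pair_adj {a b : α} (h : G.Adj a b) : (nbs G a \ {a, b}).card + 1 = dg G a := by
  rw [← nbs_inter_pair_adj h, card_sdiff_add_card_inter]; rfl

lemma nbs_sdiff_pair_nadj {a b : α} (h : ¬ G.Adj a b) : (nbs G a \ {a, b}).card = dg G a := by
  have := card_sdiff_add_card_inter (nbs G a) {a, b}
  rw [nbs_inter_pair_nadj h] at this; exact this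

lemma ed_del_pair_adj {a b : α} (h : G.Adj a b) :
    ed (del G {a, b}) + dg G a + dg G b = ed G + 1 := by
  have := ed_del (G := G) {a, b}
  rw [sum_pair h.ne, sum_pair h.ne, nbs_inter_pair_adj h, pair_comm, nbs_inter_pair_adj h.symm]
    at this
  rw [pair_comm]; omega

lemma ed_del_pair_nadj {a b : α} (hab : a ≠ b) (h : ¬ G.Adj a b) :
    ed (del G {a, b}) + dg G a + dg G b = ed G := by
  have := ed_del (G := G) {a, b}
  rw [sum_pair hab, sum_pair hab, nbs_inter_pair_nadj h, pair_comm,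
    nbs_inter_pair_nadj fun h' => h h'.symm] at this
  rw [pair_comm]; omega

/-- In `he` the product is the number of new forbidden pairs, and the right side collects what is
deleted: the edges at `v` and `w`, the row of `v` and the column of `w`. An exceptional remainder
has to be excluded only under the information in `hB`, which comes from exactness. -/
lemma Crit.step1 (C : Crit G H L) {v : α} {w : β} (hvw : ¬ L v w)
    (hG : ∀ x, x ≠ v → ∃ y, y ≠ v ∧ y ≠ x ∧ ¬ G.Adj x y)
    (hH : ∀ x, x ≠ w → ∃ y, y ≠ w ∧ y ≠ x ∧ ¬ H.Adj x y)
    (hL : ∀ x, x ≠ v → ∃ y, y ≠ w ∧ ¬ L x y ∧ (G.Adj x v → ¬ H.Adj y w))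
    (hR : ∀ y, y ≠ w → ∃ x, x ≠ v ∧ ¬ L x y ∧ (G.Adj x v → ¬ H.Adj y w))
    (he : ed G + ed H + eL L + dg G v * dg H w + 5 ≤
      2 * Fintype.card α + dg G v + dg H w + dL L v + dL (flip L) w)
    (hB : BE (del G {v}) (del H {w}) →
      (∀ x, x ≠ v → ∀ y, y ≠ w → ¬ L x y ∧ ¬ (G.Adj x v ∧ H.Adj y w)) →
      ed G + ed H + 5 = 2 * Fintype.card α + dg G v + dg H w → False) : Pk G H L := by
  have e1 := ed_del_single (G := G) v
  have e2 := ed_del_single (G := H) w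
  have e3 := eL_rest_le (G := G) (H := H) (L := L) {v} {w} (fun _ => w)
  have e4 := eLout_single hvw
  rw [sum_singleton, nbs_sdiff_single, nbs_sdiff_single] at e3
  have he' : ed (del G {v}) + ed (del H {w}) + eL (rest G H L {v} {w} fun _ => w) + 3 + 2 ≤
      2 * Fintype.card α := by omega
  refine C.step (P := {v}) (Q := {w}) (π := fun _ => w) (by simp) (by simp) (by simp) (by simp)
    (by simpa using hvw) ?_ ?_ ?_ ?_ (by simpa using he') ?_
  · intro x hx; simpa using hG x (by simpa using hx)
  · intro x hx; simpa using hH x (by simpa using hx)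
  · intro x hx; simpa using hL x (by simpa using hx)
  · intro x hx; simpa using hR x (by simpa using hx)
  · intro hb
    have cP := card_compl_subtype {v}
    have cQ := card_compl_subtype {w}
    have := C.hc
    simp only [card_singleton] at cP cQ
    have h5 := hb.ed_add (by omega)
    -- The exceptional pair uses up the whole bound, so no old or new forbidden pair is left.
    have h6 : ¬ 0 < eL (rest G H L {v} {w} fun _ => w) := by omega
    refine hB hb (fun x hx y hy => ?_) (by omega)
    rw [eL_pos] at h6
    push Not at h6
    have := h6 ⟨x, by simpa using hx⟩ ⟨y, by simpa using hy⟩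
    simp only [rest, not_or] at this
    refine ⟨this.1, fun h => this.2 ⟨v, by simp, h.1, h.2⟩⟩

/-- No credit is taken here for deleted pairs of `L`. The bound of six on n in `hB` holds because
exceptional pairs have at least four vertices. -/
lemma Crit.step2 (C : Crit G H L) {a b : α} {a' b' : β} (hab : a ≠ b) (hab' : a' ≠ b')
    (ha : ¬ L a a') (hb : ¬ L b b') (hadj : G.Adj a b → ¬ H.Adj a' b')
    (hG : ∀ x, x ≠ a → x ≠ b → ∃ y, y ≠ a ∧ y ≠ b ∧ y ≠ x ∧ ¬ G.Adj x y)
    (hH : ∀ x, x ≠ a' → x ≠ b' → ∃ y, y ≠ a' ∧ y ≠ b' ∧ y ≠ x ∧ ¬ H.Adj x y)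
    (hL : ∀ x, x ≠ a → x ≠ b → ∃ y, y ≠ a' ∧ y ≠ b' ∧ ¬ L x y ∧
      (G.Adj x a → ¬ H.Adj y a') ∧ (G.Adj x b → ¬ H.Adj y b'))
    (hR : ∀ y, y ≠ a' → y ≠ b' → ∃ x, x ≠ a ∧ x ≠ b ∧ ¬ L x y ∧
      (G.Adj x a → ¬ H.Adj y a') ∧ (G.Adj x b → ¬ H.Adj y b'))
    (he : ed (del G {a, b}) + ed (del H {a', b'}) + eL L +
      (nbs G a \ {a, b}).card * (nbs H a' \ {a', b'}).card +
      (nbs G b \ {a, b}).card * (nbs H b' \ {a', b'}).card + 7 ≤ 2 * Fintype.card α)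
    (hB : BE (del G {a, b}) (del H {a', b'}) →
      (∀ x, x ≠ a → x ≠ b → ∀ y, y ≠ a' → y ≠ b' →
        ¬ (G.Adj x a ∧ H.Adj y a') ∧ ¬ (G.Adj x b ∧ H.Adj y b')) →
      ed (del G {a, b}) + ed (del H {a', b'}) + 7 = 2 * Fintype.card α →
      6 ≤ Fintype.card α → False) :
    Pk G H L := by
  set π : α → β := fun x => if x = a then a' else b' with hπ
  have pa : π a = a' := by simp [hπ]
  have pb : π b = b' := by simp [hπ, hab.symm]
  have hPc : ({a, b} : Finset α).card = 2 := card_pair hab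
  have hQc : ({a', b'} : Finset β).card = 2 := card_pair hab'
  have e3 := eL_rest_le (G := G) (H := H) (L := L) {a, b} {a', b'} π
  have e4 := eLout_le (L := L) {a, b} {a', b'}
  rw [sum_pair hab, pa, pb] at e3
  refine C.step (P := {a, b}) (Q := {a', b'}) (π := π) (by omega) ?_ ?_ ?_ ?_ ?_ ?_ ?_ ?_
    (by omega) ?_
  · intro x hx y hy hxy
    simp only [coe_insert, coe_singleton, Set.mem_insert_iff, Set.mem_singleton_iff] at hx hy
    rcases hx with rfl | rfl <;> rcases hy with rfl | rfl <;> simp_all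
  · simp [image_insert, pa, pb]
  · intro s hs t ht hst
    simp only [mem_insert, mem_singleton] at hs ht
    rcases hs with rfl | rfl <;> rcases ht with rfl | rfl
    · exact absurd hst G.irrefl
    · rw [pa, pb]; exact hadj hst
    · rw [pa, pb]; exact fun h => hadj hst.symm h.symm
    · exact absurd hst G.irrefl
  · intro s hs
    simp only [mem_insert, mem_singleton] at hs
    rcases hs with rfl | rfl
    · rwa [pa]
    · rwa [pb]
  · intro x hx
    simp only [mem_insert, mem_singleton, not_or] at hx
    obtain ⟨y, h1, h2, h3⟩ := hG x hx.1 hx.2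
    exact ⟨y, by simp [h1, h2], h3⟩
  · intro x hx
    simp only [mem_insert, mem_singleton, not_or] at hx
    obtain ⟨y, h1, h2, h3⟩ := hH x hx.1 hx.2
    exact ⟨y, by simp [h1, h2], h3⟩
  · intro x hx
    simp only [mem_insert, mem_singleton, not_or] at hx
    obtain ⟨y, h1, h2, h3, h4, h5⟩ := hL x hx.1 hx.2
    refine ⟨y, by simp [h1, h2], h3, ?_⟩
    intro s hs
    simp only [mem_insert, mem_singleton] at hs
    rcases hs with rfl | rfl
    · rwa [pa]
    · rwa [pb]
  · intro x hx
    simp only [mem_insert, mem_singleton, not_or] at hx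
    obtain ⟨y, h1, h2, h3, h4, h5⟩ := hR x hx.1 hx.2
    refine ⟨y, by simp [h1, h2], h3, ?_⟩
    intro s hs
    simp only [mem_insert, mem_singleton] at hs
    rcases hs with rfl | rfl
    · rwa [pa]
    · rwa [pb]
  · intro hbe
    have cP := card_compl_subtype {a, b}
    have cQ := card_compl_subtype {a', b'}
    have := C.hc
    have h5 := hbe.ed_add (by omega)
    have h7 := hbe.card_ge
    have h6 : ¬ 0 < eL (rest G H L {a, b} {a', b'} π) := by omega
    refine hB hbe (fun x hxa hxb y hya hyb => ?_) (by omega) (by omega)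
    rw [eL_pos] at h6
    push Not at h6
    have := h6 ⟨x, by simp [hxa, hxb]⟩ ⟨y, by simp [hya, hyb]⟩
    simp only [rest, not_or] at this
    refine ⟨fun h => this.2 ⟨a, by simp, h.1, by simpa [pa] using h.2⟩,
      fun h => this.2 ⟨b, by simp, h.1, by simpa [pb] using h.2⟩⟩

end Critical

/-! ### A discharging argument for leaves with a neighbour of small degree -/

section Discharging
open Classical
variable {α : Type u} {β : Type v} [Fintype α] [Fintype β] {G : SimpleGraph α} {H : SimpleGraph β}
  {L : α → β → Prop}

/-- In a sparse graph some leaf outside `Z` has a neighbour of small degree outside `W`. -/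
lemma exists_good_leaf (Z W : Finset α) (hiso : ∀ x, dg G x = 0 → x ∈ Z) {q : ℕ} (hq : 0 < q)
    (h : ed G + Z.card + W.card + q ≤ Fintype.card α) :
    ∃ b c, dg G b = 1 ∧ G.Adj b c ∧ b ∉ Z ∧ c ∉ W ∧ dg G c * q ≤ Fintype.card α := by
  by_contra! hc
  set n := Fintype.card α
  -- The total of `φ` is at least 2q. Membership in `Z` or `W` costs two, enough to cancel the
  -- surplus of a leaf or of a star with all its leaves.
  obtain ⟨φ, φd⟩ : ∃ φ : α → ℤ, ∀ x, φ x =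
      2 - dg G x - 2 * (if x ∈ Z then 1 else 0) - 2 * (if x ∈ W then 1 else 0) :=
    ⟨_, fun _ => rfl⟩
  -- The total stays positive: it is at least 2q(n + 1) - 2qn. The charge -2q on each vertex lets a
  -- vertex of large degree with many leaves pay for its star.
  obtain ⟨ω, ωd⟩ : ∃ ω : α → ℤ, ∀ x, ω x = (n + 1) * φ x - 2 * q := ⟨_, fun _ => rfl⟩
  have hφ : ∑ x, φ x = 2 * n - 2 * ed G - 2 * Z.card - 2 * W.card := by
    have := sum_dg (G := G)
    simp only [φd, sum_sub_distrib, ← mul_sum, sum_const, card_univ, sum_boole]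
    rw [← Nat.cast_sum, this]
    simp [n]; ring
  have hω : 0 < ∑ x, ω x := by
    simp only [ωd, sum_sub_distrib, ← mul_sum, hφ, sum_const, card_univ, nsmul_eq_mul]
    have h1 : ((ed G : ℤ) + Z.card + W.card + q ≤ n) := by exact_mod_cast h
    have h2 : (0 : ℤ) < q := by exact_mod_cast hq
    have h3 : (0 : ℤ) ≤ n := by positivity
    change 0 < _ - 2 * ((n : ℤ) * _)
    nlinarith
  -- Each leaf `b` sends its whole weight to its only neighbour; the aim is that no vertex ends up
  -- positive.
  obtain ⟨ψ, ψd⟩ : ∃ ψ : α → α → ℤ, ∀ x b, ψ x b = if G.Adj x b ∧ dg G b = 1 then ω b else 0 :=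
    ⟨_, fun _ _ => rfl⟩
  have h1 : ∑ x, ω x = ∑ x, ((if dg G x = 1 then 0 else ω x) + ∑ b, ψ x b) := by
    rw [sum_add_distrib, sum_comm (f := ψ), ← sum_add_distrib]
    refine sum_congr rfl fun b _ => ?_
    by_cases hb : dg G b = 1
    · have : ∑ x, ψ x b = dg G b * ω b := by
        simp only [ψd, hb, and_true]
        rw [← sum_filter, sum_const, nsmul_eq_mul]
        congr 2
        rw [← hb, dg]; congr 1; ext; simp [G.adj_comm]
      simp [this, hb]
    · simp [ψd, hb]
  have hφ1 : ∀ b, dg G b = 1 → φ b ≤ 1 := by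
    intro b hb; simp only [φd, hb]; split_ifs <;> simp
  have hqn : (q : ℤ) ≤ n := by exact_mod_cast (by omega : q ≤ n)
  have hq0 : (0 : ℤ) < q := by exact_mod_cast hq
  have hn0 : (0 : ℤ) ≤ n := by positivity
  -- a vertex that is not a leaf, together with its leaves
  have h2 : ∀ x, dg G x ≠ 1 → ω x + ∑ b, ψ x b ≤ 0 := by
    intro x hx
    obtain ⟨B, Bd⟩ : ∃ B, B = univ.filter fun b => G.Adj x b ∧ dg G b = 1 := ⟨_, rfl⟩
    have hB : ∑ b, ψ x b = (n + 1) * ∑ b ∈ B, φ b - 2 * q * B.card := by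
      simp only [ψd, ωd]
      rw [← sum_filter, ← Bd, sum_sub_distrib, mul_sum, sum_const, nsmul_eq_mul]; ring
    have hBd : B.card ≤ dg G x := card_le_card fun b hb => by
      simp only [Bd, mem_filter] at hb; simpa using hb.2.1
    have hBd' : (B.card : ℤ) ≤ dg G x := by exact_mod_cast hBd
    have hB0 : (0 : ℤ) ≤ B.card := by positivity
    have hS : ∑ b ∈ B, φ b ≤ B.card := by
      rw [card_eq_sum_ones]; push_cast
      refine sum_le_sum fun b hb => hφ1 b ?_
      simp only [Bd, mem_filter] at hb; exact hb.2.2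
    have hnn : (0 : ℤ) ≤ 2 * q * (1 + B.card) := mul_nonneg (by linarith) (by linarith)
    have goal : ∀ s : ℤ, φ x + ∑ b ∈ B, φ b ≤ s → (n + 1) * s ≤ 2 * q * (1 + B.card) →
        ω x + ∑ b, ψ x b ≤ 0 := by
      intro s hs hs'
      rw [hB]
      simp only [ωd]
      nlinarith
    by_cases hW : x ∈ W
    · have : φ x ≤ - dg G x := by simp only [φd, if_pos hW]; split_ifs <;> simp
      exact goal 0 (by linarith) (by rw [mul_zero]; exact hnn)
    by_cases hg : ∃ b ∈ B, b ∉ Z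
    · obtain ⟨b, hb, hbZ⟩ := hg
      simp only [Bd, mem_filter] at hb
      have hlt := hc b x hb.2.2 hb.2.1.symm hbZ hW
      have hlt' : (n : ℤ) + 1 ≤ dg G x * q := by exact_mod_cast hlt
      have hφx : φ x ≤ 2 - dg G x := by simp only [φd]; split_ifs <;> simp
      -- The `φ`-weight of `x` with its leaves is at most 2, 1 or 0 when none, one or more of its
      -- neighbours are not leaves. The degree of `x` times q is at least n + 1, so the share -2q of
      -- each vertex outweighs it.
      by_cases e1 : (B.card : ℤ) = dg G x
      · refine goal 2 (by linarith) ?_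
        rw [e1]; nlinarith
      by_cases e2 : (B.card : ℤ) + 1 = dg G x
      · refine goal 1 (by linarith) ?_
        rw [← e2] at hlt'; nlinarith
      · exact goal 0 (by omega) (by rw [mul_zero]; exact hnn)
    · push Not at hg
      have hneg : ∑ b ∈ B, φ b ≤ 0 := by
        refine sum_nonpos fun b hb => ?_
        have hbZ := hg b hb
        simp only [Bd, mem_filter] at hb
        simp only [φd, hb.2.2, if_pos hbZ]; split_ifs <;> simp
      have : φ x ≤ 0 := by
        by_cases h0 : dg G x = 0
        · simp only [φd, h0, if_pos (hiso x h0)]; split_ifs; simp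
        · have : (2 : ℤ) ≤ dg G x := by exact_mod_cast (by omega : 2 ≤ dg G x)
          simp only [φd]; split_ifs <;> linarith
      exact goal 0 (by linarith) (by rw [mul_zero]; exact hnn)
  -- components with two vertices
  have h3 : ∑ x ∈ univ.filter (fun x => dg G x = 1), ∑ b, ψ x b ≤ 0 := by
    obtain ⟨χ, χd⟩ : ∃ χ : α → α → ℤ, ∀ x b, χ x b =
        if dg G x = 1 ∧ dg G b = 1 ∧ G.Adj x b then ω b else 0 := ⟨_, fun _ _ => rfl⟩
    have e1 : ∑ x ∈ univ.filter (fun x => dg G x = 1), ∑ b, ψ x b = ∑ x, ∑ b, χ x b := by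
      rw [sum_filter]
      refine sum_congr rfl fun x _ => ?_
      split_ifs with hx
      · refine sum_congr rfl fun b _ => ?_
        simp [ψd, χd, hx, and_comm]
      · simp [χd, hx]
    have e2 : ∑ x, ∑ b, χ x b = ∑ x, ∑ b, χ b x := sum_comm
    have e3 : ∑ x, ∑ b, χ x b + ∑ x, ∑ b, χ b x ≤ 0 := by
      rw [← sum_add_distrib]
      refine sum_nonpos fun x _ => ?_
      rw [← sum_add_distrib]
      refine sum_nonpos fun b _ => ?_
      by_cases hh : dg G x = 1 ∧ dg G b = 1 ∧ G.Adj x b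
      · obtain ⟨hx, hb, hxb⟩ := hh
        -- A positive sum would put both ends outside `Z` and `W`; then `b` is a good leaf, as its
        -- neighbour has degree one and q ≤ n.
        have : φ x + φ b ≤ 0 := by
          by_contra! hpos
          have k1 := hc b x hb hxb.symm
          rw [hx, one_mul] at k1
          simp only [φd, hx, hb] at hpos
          split_ifs at hpos with i1 i2 i3 i4 <;> try (norm_num at hpos; done)
          have := k1 ‹_› ‹_›
          omega
        simp only [χd, hx, hb, hxb, hxb.symm, and_self, if_true, ωd]
        nlinarith
      · have hh' : ¬ (dg G b = 1 ∧ dg G x = 1 ∧ G.Adj b x) := fun k => hh ⟨k.2.1, k.1, k.2.2.symm⟩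
        simp [χd, hh, hh']
    linarith
  have h4 : ∑ x, ((if dg G x = 1 then 0 else ω x) + ∑ b, ψ x b) ≤ 0 := by
    rw [← sum_filter_add_sum_filter_not univ (fun x => dg G x = 1)]
    have e1 : ∑ x ∈ univ.filter (fun x => dg G x = 1), ((if dg G x = 1 then 0 else ω x) + ∑ b, ψ x b)
        = ∑ x ∈ univ.filter (fun x => dg G x = 1), ∑ b, ψ x b :=
      sum_congr rfl fun x hx => by simp [(mem_filter.1 hx).2]
    have e2 : ∑ x ∈ univ.filter (fun x => ¬ dg G x = 1),
        ((if dg G x = 1 then 0 else ω x) + ∑ b, ψ x b) ≤ 0 :=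
      sum_nonpos fun x hx => by
        have := (mem_filter.1 hx).2
        rw [if_neg this]; exact h2 x this
    linarith
  linarith

end Discharging

/-! ### Sparse graphs, cliques with isolated vertices, placing a pair -/

section Helpers
open Classical
variable {α : Type u} {β : Type v} [Fintype α] [Fintype β] {G : SimpleGraph α} {H : SimpleGraph β}
  {L : α → β → Prop}

/-- A vertex of small degree has a non-neighbour outside a small set. -/
lemma exists_nadj_notMem (x : α) (S : Finset α) (h : dg G x + 1 + S.card < Fintype.card α) :
    ∃ y ∉ S, y ≠ x ∧ ¬ G.Adj x y := by
  obtain ⟨y, hy⟩ := exists_notMem_of_card_lt (S ∪ insert x (nbs G x)) (by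
    refine (card_union_le _ _).trans_lt ?_
    rw [insert_nbs_card]; omega)
  simp only [mem_union, mem_insert, mem_nbs, not_or] at hy
  exact ⟨y, hy.1, hy.2⟩

lemma exists_not_notMem (x : α) (S : Finset β) (h : dL L x + S.card < Fintype.card β) :
    ∃ y ∉ S, ¬ L x y := by
  obtain ⟨y, hy⟩ := exists_notMem_of_card_lt (S ∪ row L x) (by
    refine (card_union_le _ _).trans_lt ?_
    rw [← dL]; omega)
  simp only [mem_union, mem_row, not_or] at hy
  exact ⟨y, hy.1, hy.2⟩

lemma le_dg_of_adj {x : α} {S : Finset α} (h : ∀ y ∉ S, y ≠ x → G.Adj x y) :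
    Fintype.card α ≤ dg G x + 1 + S.card := by
  by_contra! hlt
  obtain ⟨y, h1, h2, h3⟩ := exists_nadj_notMem x S hlt
  exact h3 (h y h1 h2)

lemma dg_del_le_ed (P : Finset α) {x : α} (hx : x ∉ P) : (nbs G x \ P).card ≤ ed (del G P) := by
  rw [← dg_del P ⟨x, hx⟩]; exact dg_le_ed _

/-- A vertex adjacent to everything outside `S` forces many edges outside `S`. -/
lemma le_ed_del_of_adj {x : α} {S : Finset α} (hx : x ∉ S) (h : ∀ y ∉ S, y ≠ x → G.Adj x y) :
    Fintype.card α ≤ ed (del G S) + 1 + S.card := by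
  have h1 := dg_del_le_ed (G := G) S hx
  have h2 : univ ⊆ (nbs G x \ S) ∪ insert x S := by
    intro y _
    simp only [mem_union, mem_sdiff, mem_nbs, mem_insert]
    by_cases e1 : y = x
    · simp [e1]
    by_cases e2 : y ∈ S
    · simp [e2]
    · exact Or.inl ⟨h y e2 e1, e2⟩
  have h3 := (card_le_card h2).trans (card_union_le _ _)
  have h4 := card_insert_le x S
  rw [card_univ] at h3
  omega

lemma card_mul_le_sum_dg {k : ℕ} (h : ∀ x, k ≤ dg G x) : Fintype.card α * k ≤ 2 * ed G := by
  rw [← sum_dg, ← smul_eq_mul, ← card_univ, ← sum_const]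
  exact sum_le_sum fun x _ => h x

lemma sum_dg_le_card_mul {k : ℕ} (h : ∀ x, dg G x ≤ k) : 2 * ed G ≤ Fintype.card α * k := by
  rw [← sum_dg, ← smul_eq_mul, ← card_univ, ← sum_const]
  exact sum_le_sum fun x _ => h x

lemma dg_eq_one_unique {x y z : α} (h : dg G x = 1) (hy : G.Adj x y) (hz : G.Adj x z) : y = z := by
  obtain ⟨w, hw⟩ := dg_eq_one.1 h
  rw [(hw y).1 hy, (hw z).1 hz]

lemma cluster_of_dg_le_one (h : ∀ x, dg G x ≤ 1) : Cluster G := by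
  intro x y z hxy hyz hxz
  have h1 : dg G y = 1 := le_antisymm (h y) (dg_pos.2 ⟨z, hyz⟩)
  exact absurd (dg_eq_one_unique h1 hxy.symm hyz) hxz

lemma prof_of_dg_eq_one (h : ∀ x, dg G x = 1) : Prof G 0 (Fintype.card α) 0 0 :=
  ⟨cluster_of_dg_le_one fun x => (h x).le, by simp [cnt, h], by simp [cnt, h], by simp [cnt, h],
    by simp [cnt, h], by simp⟩

lemma adj_iff_of_clique {S : Finset α} (h0 : ∀ x ∉ S, dg G x = 0)
    (h1 : ∀ x ∈ S, dg G x + 1 = S.card) (x y : α) : G.Adj x y ↔ x ∈ S ∧ y ∈ S ∧ x ≠ y := by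
  have hS : ∀ x y, G.Adj x y → x ∈ S := by
    intro x y hxy; by_contra hx
    exact dg_eq_zero.1 (h0 x hx) y hxy
  constructor
  · exact fun h => ⟨hS x y h, hS y x h.symm, h.ne⟩
  · rintro ⟨hx, hy, hxy⟩
    have hsub : nbs G x ⊆ S.erase x := by
      intro z hz; simp at hz; simp [hS z x hz.symm, hz.ne.symm]
    have : nbs G x = S.erase x := eq_of_subset_of_card_le hsub (by
      rw [card_erase_of_mem hx, ← dg]; have := h1 x hx; omega)
    have : y ∈ nbs G x := by rw [this]; simp [hxy.symm, hy]
    simpa using this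

lemma cluster_of_clique {S : Finset α} (h0 : ∀ x ∉ S, dg G x = 0)
    (h1 : ∀ x ∈ S, dg G x + 1 = S.card) : Cluster G := by
  have := adj_iff_of_clique h0 h1
  intro x y z hxy hyz hxz
  rw [this] at *
  exact ⟨hxy.1, hyz.2.1, hxz⟩

lemma cnt_of_clique {S : Finset α} (h0 : ∀ x ∉ S, dg G x = 0) {k : ℕ}
    (h1 : ∀ x ∈ S, dg G x = k) (hk : 0 < k) :
    cnt G 0 + S.card = Fintype.card α ∧ cnt G k = S.card ∧
      ∀ j, j ≠ 0 → j ≠ k → cnt G j = 0 := by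
  refine ⟨?_, ?_, ?_⟩
  · have : univ.filter (fun x => dg G x = 0) = Sᶜ := by
      ext x; simp
      constructor
      · intro h hx; have := h1 x hx; omega
      · exact h0 x
    rw [cnt, this, add_comm, card_add_card_compl]
  · rw [cnt]; congr 1; ext x; simp
    constructor
    · intro h; by_contra hx; have := h0 x hx; omega
    · exact h1 x
  · intro j hj hjk
    rw [cnt, card_eq_zero]; ext x; simp
    by_cases hx : x ∈ S
    · rw [h1 x hx]; exact hjk.symm
    · rw [h0 x hx]; exact hj.symm

/-- For finishing without induction: only the size of the new relation matters, as the remainder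
will be packed by counting. -/
lemma Pk.of_pair (hc : Fintype.card α = Fintype.card β) {a b : α} {a' b' : β} (hab : a ≠ b)
    (hab' : a' ≠ b') (ha : ¬ L a a') (hb : ¬ L b b') (hadj : G.Adj a b → ¬ H.Adj a' b')
    (h : ∀ L' : {x // x ∉ ({a, b} : Finset α)} → {y // y ∉ ({a', b'} : Finset β)} → Prop,
      eL L' ≤ eLout L {a, b} {a', b'} + ((nbs G a \ {a, b}).card * (nbs H a' \ {a', b'}).card +
      (nbs G b \ {a, b}).card * (nbs H b' \ {a', b'}).card) →
      Pk (del G {a, b}) (del H {a', b'}) L') : Pk G H L := by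
  set π : α → β := fun x => if x = a then a' else b' with hπ
  have pa : π a = a' := by simp [hπ]
  have pb : π b = b' := by simp [hπ, hab.symm]
  have e3 := eL_rest_le (G := G) (H := H) (L := L) {a, b} {a', b'} π
  rw [sum_pair hab, pa, pb] at e3
  refine Pk.of_rest hc (P := {a, b}) (Q := {a', b'}) (π := π) ?_ ?_ ?_ ?_ (h _ e3)
  · intro x hx y hy hxy
    simp only [coe_insert, coe_singleton, Set.mem_insert_iff, Set.mem_singleton_iff] at hx hy
    rcases hx with rfl | rfl <;> rcases hy with rfl | rfl <;> simp_all
  · simp [image_insert, pa, pb]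
  · intro s hs t ht hst
    simp only [mem_insert, mem_singleton] at hs ht
    rcases hs with rfl | rfl <;> rcases ht with rfl | rfl
    · exact absurd hst G.irrefl
    · rw [pa, pb]; exact hadj hst
    · rw [pa, pb]; exact fun h => hadj hst.symm h.symm
    · exact absurd hst G.irrefl
  · intro s hs
    simp only [mem_insert, mem_singleton] at hs
    rcases hs with rfl | rfl
    · rwa [pa]
    · rwa [pb]

end Helpers

/-! ### A vertex of degree n - 2 -/

section FullVertex
open Classical
variable {α : Type u} {β : Type v} [Fintype α] [Fintype β] {G : SimpleGraph α} {H : SimpleGraph β}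
  {L : α → β → Prop}

/-- From 4ab ≤ (a + b)² the edges contribute at most m(a + b)/2, which is less than (m - 1)(a + b)
once m ≥ 3. -/
lemma count_arith {m a b l : ℕ} (hm : 3 ≤ m) (h : 1 ≤ a + b) (hs : a + b + l ≤ m) :
    2 * (a * b) + (m - 1) * l < m * (m - 1) := by
  obtain ⟨k, rfl⟩ : ∃ k, m = k + 1 := ⟨m - 1, by omega⟩
  simp only [Nat.add_sub_cancel]
  have h1 : k * (a + b + l) ≤ k * (k + 1) := Nat.mul_le_mul_left k hs
  have h2 : (a + b) * (a + b) ≤ (k + 1) * (a + b) := Nat.mul_le_mul_right _ (by omega)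
  have h3 : 4 * (a * b) ≤ (a + b) * (a + b) := by nlinarith [sq_nonneg ((a : ℤ) - b)]
  have h4 : 2 * (a + b) ≤ k * (a + b) := Nat.mul_le_mul_right _ (by omega)
  nlinarith

lemma count_arith_lt {m a b l : ℕ} (hm : 2 ≤ m) (hs : a + b + l + 1 ≤ m) :
    2 * (a * b) + (m - 1) * l < m * (m - 1) := by
  obtain ⟨k, rfl⟩ : ∃ k, m = k + 1 := ⟨m - 1, by omega⟩
  simp only [Nat.add_sub_cancel]
  have h1 : k * (a + b + l) ≤ k * k := Nat.mul_le_mul_left k (by omega)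
  have h2 : (a + b) * (a + b) ≤ k * (a + b) := Nat.mul_le_mul_right _ (by omega)
  have h3 : 4 * (a * b) ≤ (a + b) * (a + b) := by nlinarith [sq_nonneg ((a : ℤ) - b)]
  nlinarith

/-- Sizes at most the number of vertices of the remaining triple. -/
lemma Pk.of_card_le (hc : Fintype.card α = Fintype.card β) (hm : 3 ≤ Fintype.card α)
    (h : 1 ≤ ed G + ed H) (hs : ed G + ed H + eL L ≤ Fintype.card α) : Pk G H L :=
  Pk.of_count hc (count_arith hm h hs)

lemma Pk.of_card_lt (hc : Fintype.card α = Fintype.card β) (hm : 2 ≤ Fintype.card α)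
    (hs : ed G + ed H + eL L + 1 ≤ Fintype.card α) : Pk G H L :=
  Pk.of_count hc (count_arith_lt hm hs)

lemma Pk.of_single (hc : Fintype.card α = Fintype.card β) {a : α} {a' : β} (ha : ¬ L a a')
    (h : ∀ L' : {x // x ∉ ({a} : Finset α)} → {y // y ∉ ({a'} : Finset β)} → Prop,
      eL L' ≤ eLout L {a} {a'} + dg G a * dg H a' →
      Pk (del G {a}) (del H {a'}) L') : Pk G H L := by
  have e3 := eL_rest_le (G := G) (H := H) (L := L) {a} {a'} fun _ => a'
  rw [sum_singleton, nbs_sdiff_single, nbs_sdiff_single] at e3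
  refine Pk.of_rest hc (P := {a}) (Q := {a'}) (π := fun _ => a') (by simp) (by simp) ?_ ?_ (h _ e3)
  · intro s hs t ht hst
    simp only [mem_singleton] at hs ht
    subst hs ht; exact absurd hst G.irrefl
  · simpa using ha

lemma Adm.dg_add_two (C : Adm G H L) (x : α) : dg G x + 2 ≤ Fintype.card α :=
  (dg_le_iff x).2 (C.hG x)

lemma Adm.three_le (C : Adm G H L) (eg : 0 < ed G) : 3 ≤ Fintype.card α := by
  obtain ⟨x, y, h⟩ := ed_pos.1 eg
  have h1 := dg_pos.2 ⟨y, h⟩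
  have := C.dg_add_two x
  omega

lemma Adm.pack_of_card_three (C : Adm G H L) (eg : 0 < ed G) (eh : 0 < ed H)
    (h : Fintype.card α = 3) : Pk G H L := by
  have h1 := sum_dg_le_card_mul (G := G) (k := 1) fun x => by have := C.dg_add_two x; omega
  have h2 := sum_dg_le_card_mul (G := H) (k := 1) fun x => by
    have := C.symm.dg_add_two x; have := C.hc; omega
  have := C.hc
  have := C.he
  have e1 : ed G = 1 := by omega
  have e2 : ed H = 1 := by omega
  refine Pk.of_count C.hc ?_
  rw [e1, e2, h]; omega

/-- Placing `v` on `z` removes n - 2 edges and forbids nothing, leaving total size at most n - 1 on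
n - 1 vertices. -/
lemma Adm.pack_full_isolated (C : Adm G H L) (eg : 0 < ed G) (hn : 4 ≤ Fintype.card α)
    {z : β} (hz : dg H z + 2 = Fintype.card α) {v : α} (hv : dg G v = 0) (hvz : ¬ L v z) :
    Pk G H L := by
  refine Pk.of_single C.hc hvz fun L' hL' => ?_
  have e1 := ed_del_single (G := G) v
  have e2 := ed_del_single (G := H) z
  have e3 := eLout_le (L := L) {v} {z}
  have c1 := card_compl_subtype {v}
  have c2 := card_compl_subtype {z}
  simp only [card_singleton] at c1 c2
  have := C.hc
  have := C.he
  rw [hv, zero_mul] at hL'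
  exact Pk.of_card_le (by omega) (by omega) (by omega) (by omega)

/-- A vertex with only one non-neighbour, an isolated one. -/
lemma Crit.pack_full_zero (C : Crit G H L) (hn : 4 ≤ Fintype.card α)
    {z w : β} (hz : dg H z + 2 = Fintype.card α) (hwz : w ≠ z) (hw : ¬ H.Adj z w)
    (hw0 : dg H w = 0) (hiso : ∀ v, dg G v = 0 → L v z)
    {b c : α} (hb : dg G b = 1) (hbc : G.Adj b c) (hbz : ¬ L b z) (hcw : ¬ L c w) :
    Pk G H L := by
  have he := C.he
  have hc := C.hc
  refine Pk.of_pair C.hc hbc.ne hwz.symm hbz hcw (fun _ => hw) fun L' hL' => ?_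
  have e1 := ed_del_pair_adj hbc
  have e2 := ed_del_pair_nadj hwz.symm hw
  have e3 := eLout_add_le (L := L) (P := {b, c}) (Q := {z, w}) (w := z) (by simp)
  have c1 := card_compl_subtype {b, c}
  have c2 := card_compl_subtype {z, w}
  rw [card_pair hbc.ne] at c1
  rw [card_pair hwz.symm] at c2
  have n1 := nbs_sdiff_pair_adj hbc
  have n2 : (nbs H w \ {z, w}).card = 0 := by
    rw [pair_comm, nbs_sdiff_pair_nadj (fun h => hw h.symm), hw0]
  have n3 : (nbs G b \ {b, c}).card = 0 := by omega
  rw [n2, n3, zero_mul, mul_zero, add_zero, add_zero] at hL'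
  have dc : 1 ≤ dg G c := dg_pos.2 ⟨b, hbc.symm⟩
  have hcc : dg G c ≤ ed G := dg_le_ed c
  -- no edge and no list pair at `z` forces many edges at `c`
  have hpos : ed (del G {b, c}) = 0 → dL (flip L) z = 0 → 2 ≤ dg G c := by
    intro h0 hz0
    have hall : ∀ x, 1 ≤ dg G x := by
      intro x; by_contra hx
      have : L x z := hiso x (by omega)
      have := dL_pos (L := flip L) (x := z) |>.2 ⟨x, this⟩
      omega
    have := card_mul_le_sum_dg hall
    omega
  by_cases h5 : 5 ≤ Fintype.card α
  · by_cases ht : 1 ≤ ed (del G {b, c}) + ed (del H {z, w})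
    · exact Pk.of_card_le (by omega) (by omega) ht (by omega)
    · refine Pk.of_card_lt (by omega) (by omega) ?_
      by_cases hz0 : dL (flip L) z = 0
      · have := hpos (by omega) hz0; omega
      · omega
  · by_cases ht : ed (del G {b, c}) + ed (del H {z, w}) + eL L' + 1 ≤ 2
    · exact Pk.of_card_lt (by omega) (by omega) (by omega)
    -- Two vertices joined in both graphs cannot be packed; tracing the counts back gives `2K₂` and
    -- `K₁ ∪ K₃`.
    by_cases h11 : ed (del G {b, c}) = 1 ∧ ed (del H {z, w}) = 1
    · exfalso
      apply C.nbe
      have hn4 : Fintype.card α = 4 := by omega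
      have hz0 : dL (flip L) z = 0 := by omega
      have hall : ∀ x, 1 ≤ dg G x := by
        intro x; by_contra hx
        have : L x z := hiso x (by omega)
        have := dL_pos (L := flip L) (x := z) |>.2 ⟨x, this⟩
        omega
      have hone : ∀ x, dg G x = 1 := by
        have hs : ∑ x, dg G x = ∑ _x : α, 1 := by
          rw [sum_dg]; simp [hn4]; omega
        intro x
        exact ((sum_eq_sum_iff_of_le (fun x _ => hall x)).1 hs.symm x (mem_univ x)).symm
      have p1 := prof_of_dg_eq_one hone
      rw [hn4] at p1
      have hs : ∑ y ∈ univ.erase w, dg H y = ∑ _y ∈ univ.erase w, 2 := by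
        have h := add_sum_erase univ (dg H) (mem_univ w)
        rw [sum_dg, hw0] at h
        rw [sum_const, card_erase_of_mem (mem_univ w), card_univ, ← hc, hn4]
        simp; omega
      have htwo : ∀ y ∈ univ.erase w, dg H y = 2 := by
        refine (sum_eq_sum_iff_of_le (fun y _ => ?_)).1 hs
        have := C.symm.toAdm.dg_add_two y
        omega
      have hS : (univ.erase w).card = 3 := by
        rw [card_erase_of_mem (mem_univ w), card_univ, ← hc, hn4]
      have h0 : ∀ y ∉ univ.erase w, dg H y = 0 := by
        intro y hy; simp at hy; rw [hy, hw0]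
      obtain ⟨k1, k2, k3⟩ := cnt_of_clique h0 htwo (by norm_num)
      refine Or.inl (Or.inl ⟨p1, cluster_of_clique h0 fun y hy => by rw [htwo y hy, hS],
        by omega, k3 1 (by norm_num) (by norm_num), by omega, k3 3 (by norm_num) (by norm_num),
        by omega⟩)
    · refine Pk.of_count (by omega) ?_
      have hm : Fintype.card {x // x ∉ ({b, c} : Finset α)} = 2 := by omega
      rw [hm]
      have hprod : ed (del G {b, c}) * ed (del H {z, w}) = 0 := by
        rw [mul_eq_zero]
        have : ed (del G {b, c}) + ed (del H {z, w}) ≤ 2 := by omega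
        by_contra! hne
        omega
      rw [hprod]
      by_cases hl : eL L' = 2
      · by_cases hz0 : dL (flip L) z = 0
        · have := hpos (by omega) hz0; omega
        · omega
      · omega

/-- A vertex with only one non-neighbour, which is a leaf. -/
lemma Adm.pack_full_one (C : Adm G H L) (hn : 4 ≤ Fintype.card α)
    {z w : β} (hz : dg H z + 2 = Fintype.card α) (hwz : w ≠ z) (hw : ¬ H.Adj z w)
    (hw1 : dg H w = 1) {b c : α} (hb : dg G b = 1) (hbc : G.Adj b c) (hbz : ¬ L b z)
    (hcw : ¬ L c w) : Pk G H L := by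
  have he := C.he
  have hc := C.hc
  refine Pk.of_pair C.hc hbc.ne hwz.symm hbz hcw (fun _ => hw) fun L' hL' => ?_
  have e1 := ed_del_pair_adj hbc
  have e2 := ed_del_pair_nadj hwz.symm hw
  have e3 := eLout_le (L := L) {b, c} {z, w}
  have c1 := card_compl_subtype {b, c}
  have c2 := card_compl_subtype {z, w}
  rw [card_pair hbc.ne] at c1
  rw [card_pair hwz.symm] at c2
  have n1 := nbs_sdiff_pair_adj hbc
  have n2 : (nbs H w \ {z, w}).card = 1 := by
    rw [pair_comm, nbs_sdiff_pair_nadj (fun h => hw h.symm), hw1]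
  have n3 : (nbs G b \ {b, c}).card = 0 := by omega
  have n4 : (nbs G c \ {b, c}).card + 1 = dg G c := by
    rw [pair_comm]; exact nbs_sdiff_pair_adj hbc.symm
  rw [n2, n3, zero_mul, mul_one, zero_add] at hL'
  exact Pk.of_card_lt (by omega) (by omega) (by omega)

/-- A vertex with only one non-neighbour, which has degree at least two. -/
lemma Crit.pack_full_two (C : Crit G H L)
    {z w : β} (hz : dg H z + 2 = Fintype.card α) (hwz : w ≠ z) (hw : ¬ H.Adj z w)
    (hw2 : 2 ≤ dg H w) {b c : α} (hb : dg G b = 1) (hbc : G.Adj b c) (hbz : ¬ L b z)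
    (hcw : ¬ L c w) (hd : dg G c * (dg H w + 1) ≤ Fintype.card α) : Pk G H L := by
  have he := C.he
  have hc := C.hc
  have e1 := ed_del_pair_adj hbc
  have e2 := ed_del_pair_nadj hwz.symm hw
  have n3 : (nbs G b \ {b, c}).card = 0 := by have := nbs_sdiff_pair_adj hbc; omega
  have n2 : (nbs H w \ {z, w}).card = dg H w := by
    rw [pair_comm, nbs_sdiff_pair_nadj (fun h => hw h.symm)]
  have n4 : (nbs G c \ {b, c}).card + 1 = dg G c := by
    rw [pair_comm]; exact nbs_sdiff_pair_adj hbc.symm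
  have dc : dg G c ≤ ed G := dg_le_ed c
  have hbx : ∀ x, x ≠ c → ¬ G.Adj x b := fun x hx h => hx (dg_eq_one_unique hb h.symm hbc)
  have cP : ({b, c} : Finset α).card = 2 := card_pair hbc.ne
  have cQ : ({z, w} : Finset β).card = 2 := card_pair hwz.symm
  -- Here `d` counts the neighbours of `c` other than `b`; the cost is d times the degree of `w`,
  -- and `hd` bounds it so that the net saving is at least four.
  obtain ⟨d, hd'⟩ : ∃ d, dg G c = d + 1 := ⟨dg G c - 1, by omega⟩
  have n5 : (nbs G c \ {b, c}).card = d := by omega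
  rw [hd'] at hd
  have hprod : (d + 1) * (dg H w + 1) = d * dg H w + d + dg H w + 1 := by ring
  refine C.step2 hbc.ne hwz.symm hbz hcw (fun _ => hw) ?_ ?_ ?_ ?_ ?_ ?_
  · intro x hxb hxc
    by_contra! hx
    have := le_ed_del_of_adj (G := G) (S := {b, c}) (x := x) (by simp [hxb, hxc])
      (fun y hy hyx => by simp at hy; exact hx y hy.1 hy.2 hyx)
    omega
  · intro x hxb hxc
    by_contra! hx
    have := le_ed_del_of_adj (G := H) (S := {z, w}) (x := x) (by simp [hxb, hxc])
      (fun y hy hyx => by simp at hy; exact hx y hy.1 hy.2 hyx)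
    omega
  · intro x hxb hxc
    have hx := dL_le_eL (L := L) x
    by_cases hxc' : G.Adj x c
    · have : 0 < (nbs G c \ {b, c}).card := card_pos.2 ⟨x, by simp [hxb, hxc, hxc'.symm]⟩
      obtain ⟨y, hy, hy'⟩ := exists_not_notMem (L := L) x ({z, w} ∪ nbs H w) (by
        have := card_union_le {z, w} (nbs H w)
        rw [cQ, ← dg] at this; omega)
      simp at hy
      exact ⟨y, hy.1, hy.2.1, hy', fun h => absurd h (hbx x hxc), fun _ h => hy.2.2 h.symm⟩
    · obtain ⟨y, hy, hy'⟩ := exists_not_notMem (L := L) x {z, w} (by omega)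
      simp at hy
      exact ⟨y, hy.1, hy.2, hy', fun h => absurd h (hbx x hxc), fun h => absurd h hxc'⟩
  · intro y hyz hyw
    have hx := dR_le_eL (L := L) y
    obtain ⟨x, hx1, hx2⟩ := exists_not_notMem (L := flip L) y ({b, c} ∪ (nbs G c \ {b, c})) (by
        have := card_union_le {b, c} (nbs G c \ {b, c})
        rw [cP, n5] at this; omega)
    simp at hx1
    exact ⟨x, hx1.1, hx1.2.1, hx2, fun h => absurd h (hbx x hx1.2.1), fun h => absurd (hx1.2.2 h.symm)
      (by simp)⟩
  · rw [n3, n2, n5, zero_mul, add_zero]; omega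
  · intro _ h1 h2 h3
    -- If d = 0 too few edges remain for an exceptional pair; if d > 0 a neighbour of `c` and a
    -- neighbour of `w` form a new forbidden pair.
    rcases Nat.eq_zero_or_pos d with rfl | hd0
    · omega
    · obtain ⟨x, hx⟩ : (nbs G c \ {b, c}).Nonempty := card_pos.1 (by omega)
      obtain ⟨y, hy⟩ := dg_pos.1 (by omega : 0 < dg H w)
      simp at hx
      have hyz : y ≠ z := by rintro rfl; exact hw hy.symm
      exact (h1 x hx.2.1 hx.2.2 y hyz hy.ne.symm).2 ⟨hx.1.symm, hy.symm⟩

/-- At least n - 2 + deg w edges lie in `H`, so `G` and `L` are sparse enough for the discharging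
lemma. -/
lemma Crit.pack_full (C : Crit G H L) (eg : 0 < ed G) (eh : 0 < ed H) {z : β}
    (hz : dg H z + 2 = Fintype.card α) : Pk G H L := by
  by_cases h3 : Fintype.card α = 3
  · exact C.toAdm.pack_of_card_three eg eh h3
  have hn : 4 ≤ Fintype.card α := by have := C.toAdm.three_le eg; omega
  by_cases hiso : ∃ v, dg G v = 0 ∧ ¬ L v z
  · obtain ⟨v, hv, hvz⟩ := hiso
    exact C.toAdm.pack_full_isolated eg hn hz hv hvz
  push Not at hiso
  obtain ⟨w, hwz, hw⟩ := C.hH z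
  have he := C.he
  have e2 := ed_del_pair_nadj hwz.symm hw
  have hzw : (row (flip L) z).card + (row (flip L) w).card ≤ eL L := by
    rw [← eL_flip]; exact dL_add_le_eL hwz.symm
  -- `Z` and `W` are the vertices forbidden on `z` and on `w`; q = deg w + 1 is the largest value
  -- that the edge bound guarantees.
  obtain ⟨b, c, hb, hbc, hbz, hcw, hd⟩ := exists_good_leaf (G := G) (row (flip L) z)
    (row (flip L) w) (fun x hx => by simpa [flip] using hiso x hx) (q := dg H w + 1) (by omega)
    (by omega)
  have hbz : ¬ L b z := by simpa [flip] using hbz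
  have hcw : ¬ L c w := by simpa [flip] using hcw
  rcases Nat.lt_or_ge (dg H w) 2 with h | h
  · interval_cases h' : dg H w
    · exact C.pack_full_zero hn hz hwz hw h' hiso hb hbc hbz hcw
    · exact C.toAdm.pack_full_one hn hz hwz hw h' hb hbc hbz hcw
  · exact C.pack_full_two hz hwz hw h hb hbc hbz hcw hd

end FullVertex

/-! ### Reductions: vertices with one allowed image, and perfect matchings -/

section Reduced
open Classical
variable {α : Type u} {β : Type v} [Fintype α] [Fintype β] {G : SimpleGraph α} {H : SimpleGraph β}
  {L : α → β → Prop}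

/-- A critical triple with edges on both sides and all degrees at most `n - 3`. -/
structure Red (G : SimpleGraph α) (H : SimpleGraph β) (L : α → β → Prop) : Prop
    extends Crit G H L where
  eg : 0 < ed G
  eh : 0 < ed H
  g3 : ∀ x, dg G x + 3 ≤ Fintype.card α
  h3 : ∀ y, dg H y + 3 ≤ Fintype.card β

lemma Red.symm (C : Red G H L) : Red H G (flip L) := ⟨C.toCrit.symm, C.eh, C.eg, C.h3, C.g3⟩

lemma ed_eq_zero (h : ed G = 0) (x y : α) : ¬ G.Adj x y :=
  fun hxy => by have := ed_pos.2 ⟨x, y, hxy⟩; omega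

lemma Adm.pack_of_ed_eq_zero (C : Adm G H L) (h : ed G = 0) : Pk G H L := by
  obtain ⟨f, hf⟩ := exists_equiv_avoiding C.hc C.hL C.hR (by have := C.he; omega)
  exact ⟨f, fun u v huv => absurd huv (ed_eq_zero h u v), hf⟩

lemma Crit.pack_or_red (C : Crit G H L) : Pk G H L ∨ Red G H L := by
  by_contra! hn
  obtain ⟨h1, h2⟩ := hn
  have eg : 0 < ed G := Nat.pos_of_ne_zero fun h => h1 (C.toAdm.pack_of_ed_eq_zero h)
  have eh : 0 < ed H := Nat.pos_of_ne_zero fun h => h1 (C.symm.toAdm.pack_of_ed_eq_zero h).symm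
  refine h2 ⟨C, eg, eh, fun x => ?_, fun y => ?_⟩
  · by_contra hx
    have := C.toAdm.dg_add_two x
    exact h1 (C.symm.pack_full eh eg (z := x) (by have := C.hc; omega)).symm
  · by_contra hx
    have := C.symm.toAdm.dg_add_two y
    exact h1 (C.pack_full eg eh (z := y) (by have := C.hc; omega))

/-- A row and a column share at most one pair. -/
lemma dL_add_dR_le (x : α) (y : β) : dL L x + dL (flip L) y ≤ eL L + 1 := by
  have h : dL (flip L) y = ((row (flip L) y).image fun x => (x, y)).card :=
    (card_image_of_injective _ fun a b h => by simpa using h).symm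
  have h' : dL L x = ((row L x).image fun y => (x, y)).card :=
    (card_image_of_injective _ fun a b h => by simpa using h).symm
  rw [h, h', ← card_union_add_card_inter]
  refine Nat.add_le_add (card_le_card fun p hp => ?_) (card_le_one.2 ?_)
  · simp only [mem_union, mem_image, mem_prs, mem_row] at hp ⊢
    rcases hp with ⟨z, hz, rfl⟩ | ⟨z, hz, rfl⟩ <;> exact hz
  · intro p hp q hq
    simp only [mem_inter, mem_image, mem_row] at hp hq
    obtain ⟨⟨a, -, rfl⟩, b, -, h1⟩ := hp
    obtain ⟨⟨c, -, rfl⟩, d, -, h2⟩ := hq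
    simp only [Prod.mk.injEq] at h1 h2
    rw [← h1.2, ← h2.2]

lemma le_two_mul_ed_of_ne (x : α) (h : ∀ y, y ≠ x → 1 ≤ dg G y) :
    Fintype.card α ≤ 2 * ed G + 1 := by
  have h1 := add_sum_erase univ (dg G) (mem_univ x)
  rw [sum_dg] at h1
  have h2 : (univ.erase x).card ≤ ∑ y ∈ univ.erase x, dg G y := by
    rw [card_eq_sum_ones]; exact sum_le_sum fun y hy => h y (by simpa using hy)
  rw [card_erase_of_mem (mem_univ x), card_univ] at h2
  omega

lemma exists_adj_ne (h : 0 < ed G) (x : α) : ∃ y, y ≠ x ∧ 0 < dg G y := by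
  obtain ⟨a, b, hab⟩ := ed_pos.1 h
  by_cases hax : a = x
  · exact ⟨b, fun hbx => hab.ne (hax.trans hbx.symm), dg_pos.2 ⟨a, hab.symm⟩⟩
  · exact ⟨a, hax, dg_pos.2 ⟨b, hab⟩⟩

lemma Red.exists_nadj_ne (C : Red G H L) (v x : α) : ∃ y, y ≠ v ∧ y ≠ x ∧ ¬ G.Adj x y := by
  obtain ⟨y, hy, h⟩ := exists_nadj_notMem (G := G) x {v} (by have := C.g3 x; simp; omega)
  exact ⟨y, by simpa using hy, h⟩

/-- One of `v`, `w` is isolated, so nothing new is forbidden, and the pair `(x, w)` is lost with the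
column of `w`; together with `h1` this saves two. -/
lemma Red.pack_row_full_step (C : Red G H L) {x : α} (hx : dL L x + 1 = Fintype.card α) {y₀ : β}
    (hy₀ : ¬ L x y₀) {v : α} {w : β} (hv : v ≠ x) (hw : w ≠ y₀) (hvw : ¬ L v w)
    (h0 : dg G v = 0 ∨ dg H w = 0) (h1 : 1 ≤ dg G v + dg H w + dL L v) : Pk G H L := by
  have hc := C.hc
  have he := C.he
  have hn := C.toAdm.three_le C.eg
  have eg := C.eg
  have eh := C.eh
  have hLx : ∀ y, y ≠ y₀ → L x y := by
    intro y hy; by_contra hxy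
    have := card_le_univ (insert y (insert y₀ (row L x)))
    rw [card_insert_of_notMem (by simp [hy, hxy]), card_insert_of_notMem (by simp [hy₀]),
      ← dL] at this
    omega
  have hadj : ∀ {x' y}, ¬ (G.Adj x' v ∧ H.Adj y w) := by
    rintro x' y ⟨h, h'⟩
    rcases h0 with h0 | h0
    · exact dg_eq_zero.1 h0 _ h.symm
    · exact dg_eq_zero.1 h0 _ h'.symm
  have hw1 : 1 ≤ dL (flip L) w := dL_pos.2 ⟨x, hLx w hw⟩
  refine C.step1 hvw (fun x' _ => C.exists_nadj_ne v x') (fun y _ => C.symm.exists_nadj_ne w y)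
    ?_ ?_ ?_ ?_
  · intro x' hx'
    by_cases hxx : x' = x
    · exact ⟨y₀, hw.symm, hxx ▸ hy₀, fun h h' => hadj ⟨h, h'⟩⟩
    · have := dL_add_le_eL (L := L) hxx
      obtain ⟨y, hy, hy'⟩ := exists_not_notMem (L := L) x' {w} (by simp; omega)
      exact ⟨y, by simpa using hy, hy', fun h h' => hadj ⟨h, h'⟩⟩
  · intro y hy
    have := dL_add_dR_le (L := L) x y
    obtain ⟨x', h, h'⟩ := exists_not_notMem (L := flip L) y {v} (by simp; omega)
    exact ⟨x', by simpa using h, h', fun h h' => hadj ⟨h, h'⟩⟩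
  · have : dg G v * dg H w = 0 := by rcases h0 with h0 | h0 <;> simp [h0]
    omega
  · intro _ h _
    -- An exceptional remainder would have no forbidden pair, but `x` is still barred from a third
    -- vertex.
    obtain ⟨y, hy⟩ := exists_notMem_of_card_lt ({w, y₀} : Finset β) (by
      rw [card_pair hw]; omega)
    simp at hy
    exact (h x hv.symm y hy.1).1 (hLx y hy.2)

/-- A vertex that may be placed on only one vertex. -/
lemma Red.pack_row_full (C : Red G H L) {x : α} (hx : dL L x + 1 = Fintype.card α) : Pk G H L := by
  obtain ⟨y₀, hy₀⟩ := C.hL x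
  have hc := C.hc
  have he := C.he
  have eg := C.eg
  have eh := C.eh
  by_cases h : ∃ v, v ≠ x ∧ dg G v = 0
  · obtain ⟨v, hv, hv0⟩ := h
    by_cases hLv : dL L v = 0
    · obtain ⟨w, hw, hw0⟩ := exists_adj_ne C.eh y₀
      refine C.pack_row_full_step hx hy₀ hv hw (fun h => ?_) (Or.inl hv0) (by omega)
      have := dL_pos.2 ⟨w, h⟩; omega
    · have := dL_add_le_eL (L := L) hv
      obtain ⟨w, hw, hw'⟩ := exists_not_notMem (L := L) v {y₀} (by simp; omega)
      exact C.pack_row_full_step hx hy₀ hv (by simpa using hw) hw' (Or.inl hv0) (by omega)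
  · push Not at h
    have h1 := le_two_mul_ed_of_ne x fun y hy => Nat.pos_of_ne_zero (h y hy)
    have h2 := dL_le_eL (L := L) x
    -- Otherwise both graphs have at least (n - 1)/2 edges and `L` has n - 1 pairs, in total 2n - 2.
    obtain ⟨w, hw, hw0⟩ : ∃ w, w ≠ y₀ ∧ dg H w = 0 := by
      by_contra! h'
      have := le_two_mul_ed_of_ne y₀ fun y hy => Nat.pos_of_ne_zero (h' y hy)
      omega
    obtain ⟨v, hv⟩ := C.hR w
    have hLx : L x w := by
      by_contra hxy
      have := card_le_univ (insert w (insert y₀ (row L x)))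
      rw [card_insert_of_notMem (by simp [hw, hxy]), card_insert_of_notMem (by simp [hy₀]),
        ← dL] at this
      omega
    have hvx : v ≠ x := by rintro rfl; exact hv hLx
    have := Nat.pos_of_ne_zero (h v hvx)
    exact C.pack_row_full_step hx hy₀ hvx hw hv (Or.inr hw0) (by omega)

/-- A reduced triple in which every vertex may be placed on at least two vertices. -/
structure Red2 (G : SimpleGraph α) (H : SimpleGraph β) (L : α → β → Prop) : Prop
    extends Red G H L where
  l2 : ∀ x, dL L x + 2 ≤ Fintype.card α
  r2 : ∀ y, dL (flip L) y + 2 ≤ Fintype.card β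

lemma Red2.symm (C : Red2 G H L) : Red2 H G (flip L) := ⟨C.toRed.symm, C.r2, C.l2⟩

lemma Red.pack_or_red2 (C : Red G H L) : Pk G H L ∨ Red2 G H L := by
  by_contra! hn
  obtain ⟨h1, h2⟩ := hn
  refine h2 ⟨C, fun x => ?_, fun y => ?_⟩
  · by_contra hx
    have := (dL_lt_iff x).2 (C.hL x)
    exact h1 (C.pack_row_full (x := x) (by have := C.hc; omega))
  · by_contra hx
    have := (dL_lt_iff y).2 (C.symm.hL y)
    exact h1 (C.symm.pack_row_full (x := y) (by have := C.hc; omega)).symm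

/-- A perfect matching packs with a graph that has few edges. -/
lemma Red.pack_matching (C : Red G H L) (hG : ∀ x, dg G x = 1) (hL : eL L = 0) : Pk G H L := by
  have hc := C.hc
  have he := C.he
  have hL' : ∀ x y, ¬ L x y := fun x y h => by have := eL_pos.2 ⟨x, y, h⟩; omega
  have h1 : 2 * ed G = Fintype.card α := by rw [← sum_dg]; simp [hG]
  have hn := C.toAdm.three_le C.eg
  -- With n/2 edges in `G`, the expected number of conflicts is e(H)/(n - 1).
  by_cases hH : ed H + 2 ≤ Fintype.card α
  · refine Pk.of_count C.hc ?_
    rw [hL, mul_zero, add_zero, ← mul_assoc, h1]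
    exact Nat.mul_lt_mul_of_pos_left (by omega) (by omega)
  -- An edge of the matching will be placed on `w` and its non-neighbour `w'` of largest degree.
  -- Nothing new is forbidden, and degree sum three suffices.
  obtain ⟨w, -, hw⟩ := exists_max_image (univ : Finset β) (dg H)
    (univ_nonempty_iff.2 (Fintype.card_pos_iff.1 (by omega)))
  have hw : ∀ y, dg H y ≤ dg H w := fun y => hw y (mem_univ y)
  obtain ⟨t, ht⟩ := C.hH w
  obtain ⟨w', hw'1, hw'⟩ := exists_max_image (univ.filter fun y => y ≠ w ∧ ¬ H.Adj w y) (dg H)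
    ⟨t, by simpa using ht⟩
  obtain ⟨hne, hnadj⟩ : w' ≠ w ∧ ¬ H.Adj w w' := by simpa using hw'1
  have hw' : ∀ y, y ≠ w → ¬ H.Adj w y → dg H y ≤ dg H w' := fun y h h' =>
    hw' y (by simp [h, h'])
  -- the total degree of `H`
  have hsum : 2 * ed H ≤ (dg H w + 1) * dg H w +
      (Fintype.card α - (dg H w + 1)) * dg H w' := by
    have e1 := sum_add_sum_compl (insert w (nbs H w)) (dg H)
    have e2 : ∑ y ∈ insert w (nbs H w), dg H y ≤ (dg H w + 1) * dg H w := by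
      rw [← insert_nbs_card, ← smul_eq_mul, ← sum_const]
      exact sum_le_sum fun y _ => hw y
    have e3 : ∑ y ∈ (insert w (nbs H w))ᶜ, dg H y ≤
        (Fintype.card α - (dg H w + 1)) * dg H w' := by
      have : (insert w (nbs H w))ᶜ.card = Fintype.card α - (dg H w + 1) := by
        rw [card_compl, insert_nbs_card, hc]
      rw [← this, ← smul_eq_mul, ← sum_const]
      refine sum_le_sum fun y hy => ?_
      simp only [mem_compl, mem_insert, mem_nbs, not_or] at hy
      exact hw' y hy.1 hy.2
    rw [sum_dg] at e1
    omega
  have hd2 : 2 ≤ dg H w := by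
    by_contra! hlt
    have := sum_dg_le_card_mul (G := H) (k := 1) fun y => by have := hw y; omega
    omega
  have hw3 := C.h3 w
  have hd3 : 3 ≤ dg H w + dg H w' := by
    by_contra! hlt
    have k1 : dg H w = 2 := by omega
    have k2 : dg H w' = 0 := by omega
    rw [k1, k2] at hsum
    omega
  obtain ⟨v⟩ : Nonempty α := Fintype.card_pos_iff.1 (by omega)
  obtain ⟨u, hvu⟩ := dg_pos.1 (by rw [hG]; exact one_pos : 0 < dg G v)
  have e1 := ed_del_pair_adj hvu
  have e2 := ed_del_pair_nadj hne.symm hnadj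
  rw [hG, hG] at e1
  have n1 := nbs_sdiff_pair_adj hvu
  have n2 := nbs_sdiff_pair_adj hvu.symm
  rw [pair_comm, hG] at n2
  rw [hG] at n1
  have n1 : (nbs G v \ {v, u}).card = 0 := by omega
  have n2 : (nbs G u \ {v, u}).card = 0 := by omega
  have hav : ∀ x, x ≠ u → ¬ G.Adj x v := fun x hx h => hx (dg_eq_one_unique (hG v) h.symm hvu)
  have hau : ∀ x, x ≠ v → ¬ G.Adj x u := fun x hx h =>
    hx (dg_eq_one_unique (hG u) h.symm hvu.symm)
  have cQ : ({w, w'} : Finset β).card = 2 := card_pair hne.symm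
  have cP : ({v, u} : Finset α).card = 2 := card_pair hvu.ne
  refine C.step2 hvu.ne hne.symm (hL' _ _) (hL' _ _) (fun _ => hnadj) ?_ ?_ ?_ ?_ ?_ ?_
  · intro x hxv hxu
    obtain ⟨y, hy, h⟩ := exists_nadj_notMem (G := G) x {v, u} (by rw [hG]; omega)
    simp at hy
    exact ⟨y, hy.1, hy.2, h⟩
  · intro x hxb hxc
    by_contra! hx
    have k0 := le_dg_of_adj (G := H) (S := {w, w'}) (x := x)
      (fun y hy hyx => by simp at hy; exact hx y hy.1 hy.2 hyx)
    have k1 := le_ed_del_of_adj (G := H) (S := {w, w'}) (x := x) (by simp [hxb, hxc])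
      (fun y hy hyx => by simp at hy; exact hx y hy.1 hy.2 hyx)
    have k2 := hw x
    have k3 : ¬ H.Adj w x := by
      intro hwx
      have : nbs H x ⊇ insert w (univ \ {w, w', x}) := by
        intro y hy
        simp at hy
        rcases hy with rfl | hy
        · simpa using hwx.symm
        · simpa using hx y hy.1 hy.2.1 hy.2.2
      have := card_le_card this
      rw [card_insert_of_notMem (by simp), card_univ_sdiff, ← dg] at this
      have c3 := card_le_three (a := w) (b := w') (c := x)
      have := C.h3 x
      omega
    have k4 := hw' x hxb k3
    omega
  · intro x hxv hxu
    obtain ⟨y, hy⟩ := exists_notMem_of_card_lt ({w, w'} : Finset β) (by omega)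
    simp at hy
    exact ⟨y, hy.1, hy.2, hL' _ _, fun h => absurd h (hav x hxu), fun h => absurd h (hau x hxv)⟩
  · intro y hyw hyw'
    obtain ⟨x, hx⟩ := exists_notMem_of_card_lt ({v, u} : Finset α) (by omega)
    simp at hx
    exact ⟨x, hx.1, hx.2, hL' _ _, fun h => absurd h (hav x hx.2), fun h => absurd h (hau x hx.1)⟩
  · rw [n1, n2]; omega
  · intro _ _ h1 h6
    have hd : dg H w + dg H w' = 3 := by omega
    have hH' : 2 * ed H + 6 = 3 * Fintype.card α := by omega
    -- Exactness and `hsum` leave only n = 6 with `H` equal to `K₄` and two isolated vertices, which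
    -- is exceptional with `3K₂`.
    have hd' : dg H w = 2 ∧ dg H w' = 1 ∨ dg H w = 3 ∧ dg H w' = 0 := by omega
    rcases hd' with ⟨k1, k2⟩ | ⟨k1, k2⟩
    · rw [k1, k2] at hsum; omega
    rw [k1, k2] at hsum
    have hn6 : Fintype.card α = 6 := by omega
    apply C.nbe
    have p1 := prof_of_dg_eq_one hG
    rw [hn6] at p1
    have h0 : ∀ x ∉ insert w (nbs H w), dg H x = 0 := by
      intro x hx
      simp only [mem_insert, mem_nbs, not_or] at hx
      have := hw' x hx.1 hx.2
      omega
    have hS : (insert w (nbs H w)).card = 4 := by rw [insert_nbs_card, k1]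
    have hthree : ∀ y ∈ insert w (nbs H w), dg H y = 3 := by
      have hle : ∀ y ∈ insert w (nbs H w), dg H y ≤ 3 := fun y _ => by have := hw y; omega
      refine (sum_eq_sum_iff_of_le hle).1 ?_
      have e1 := sum_add_sum_compl (insert w (nbs H w)) (dg H)
      rw [sum_dg, sum_eq_zero (s := (insert w (nbs H w))ᶜ) (fun x hx => h0 x (by simpa using hx))]
        at e1
      rw [sum_const, hS, smul_eq_mul]; omega
    obtain ⟨k1, k2, k3⟩ := cnt_of_clique h0 hthree (by norm_num)
    exact Or.inl (Or.inr (Or.inr (Or.inl ⟨p1, cluster_of_clique h0 fun y hy => by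
        rw [hthree y hy, hS], by omega, k3 1 (by norm_num) (by norm_num),
        k3 2 (by norm_num) (by norm_num), by omega, by omega⟩)))

end Reduced

/-! ### Triples with an isolated vertex -/

section Isolated
open Classical
variable {α : Type u} {β : Type v} [Fintype α] [Fintype β] {G : SimpleGraph α} {H : SimpleGraph β}
  {L : α → β → Prop}

lemma exists_of_cnt {j k : ℕ} (hj : 2 ≤ j) (hk : 2 ≤ k) (hjk : j ≠ k) (h : 3 ≤ cnt G j + cnt G k)
    (S : Finset α) (hS : S.card ≤ 2) : ∃ y ∉ S, 2 ≤ dg G y := by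
  by_contra! hc
  have h1 : (univ.filter fun x => dg G x = j) ∪ (univ.filter fun x => dg G x = k) ⊆ S := by
    intro y hy
    by_contra hyS
    have := hc y hyS
    simp at hy
    omega
  have h2 := card_le_card h1
  rw [card_union_of_disjoint] at h2
  · simp only [cnt] at h; omega
  · rw [Finset.disjoint_left]; intro y h1 h2; simp at h1 h2; omega

lemma Prof.dg_eq_one {b : ℕ} (h : Prof G 0 b 0 0) (x : α) : dg G x = 1 := by
  have h1 := h.dg_lt x
  have h0 := mt (fun h' => cnt_pos.2 ⟨x, h'⟩) (by rw [h.c0]; simp)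
  have h2 := mt (fun h' => cnt_pos.2 ⟨x, h'⟩) (by rw [h.c2]; simp)
  have h3 := mt (fun h' => cnt_pos.2 ⟨x, h'⟩) (by rw [h.c3]; simp)
  omega

lemma card_subtype_notMem_le (T : Finset α) {S : Finset α} {k : ℕ} (h : S.card ≤ k) :
    (S.subtype (· ∉ T)).card ≤ k := by
  rw [card_subtype]; exact (card_filter_le _ _).trans h

/-- In an exceptional pair, a graph without three vertices of degree at least two is a matching. -/
lemma BE.degrees (h : BE G H) : (∀ S : Finset β, S.card ≤ 2 → ∃ y ∉ S, 2 ≤ dg H y) ∨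
    ((∀ y, dg H y = 1) ∧ (∃ x, dg G x = 0) ∧
      ∀ S : Finset α, S.card ≤ 2 → ∃ x ∉ S, 2 ≤ dg G x) := by
  by_cases h23 : 3 ≤ cnt H 2 + cnt H 3
  · exact Or.inl fun S hS => exists_of_cnt (by norm_num) (by norm_num) (by norm_num) h23 S hS
  · right
    have : ∃ b, Prof H 0 b 0 0 ∧ 0 < cnt G 0 ∧ 3 ≤ cnt G 2 + cnt G 3 := by
      rcases h with h | h <;>
      rcases h with ⟨h1, h2⟩ | ⟨h1, h2⟩ | ⟨h1, h2⟩ | ⟨h1, h2⟩ | ⟨h1, h2⟩ | ⟨h1, h2⟩ | ⟨h1, h2⟩ <;>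
      simp only [h1.c2, h1.c3, h2.c2, h2.c3] at h23 <;> first
        | omega
        | exact ⟨_, h1, by have := h2.c0; omega, by have := h2.c2; have := h2.c3; omega⟩
    obtain ⟨b, hb, h0, h3⟩ := this
    exact ⟨hb.dg_eq_one, cnt_pos.1 h0,
      fun S hS => exists_of_cnt (by norm_num) (by norm_num) (by norm_num) h3 S hS⟩

lemma dg_del_single (v : α) (x : {x // x ∉ ({v} : Finset α)}) :
    dg (del G {v}) x = if G.Adj x v then dg G x - 1 else dg G x := by
  have h := dg_del_add (G := G) {v} x
  split_ifs with hx
  · have : (nbs G x ∩ {v}).card = 1 := by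
      rw [inter_singleton_of_mem (by simpa using hx)]; simp
    omega
  · have : (nbs G x ∩ {v}).card = 0 := by
      rw [inter_singleton_of_notMem (by simpa using hx)]; simp
    omega

lemma sum_del_single {M : Type*} [AddCommMonoid M] (v : α) (f : α → M) :
    f v + ∑ x : {x // x ∉ ({v} : Finset α)}, f x = ∑ x, f x := by
  rw [← add_sum_erase univ f (mem_univ v)]
  congr 1
  exact (Finset.sum_subtype (univ.erase v) (by simp) f).symm

lemma cnt_eq_sum (j : ℕ) : cnt G j = ∑ x, if dg G x = j then 1 else 0 := by
  rw [cnt, card_filter]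

lemma Prof.of_del_isolated {v : α} (hv : dg G v = 0) {a b c d : ℕ}
    (h : Prof (del G {v}) a b c d) : Prof G (a + 1) b c d := by
  have hadj : ∀ x, ¬ G.Adj x v := fun x hx => dg_eq_zero.1 hv x hx.symm
  have hcnt : ∀ j, cnt G j = cnt (del G {v}) j + if j = 0 then 1 else 0 := by
    intro j
    rw [cnt_eq_sum, cnt_eq_sum, ← sum_del_single v, hv, add_comm]
    congr 1
    · refine sum_congr rfl fun x _ => ?_
      rw [dg_del_single, if_neg (hadj _)]
    · simp [eq_comm]
  have hc := card_compl_subtype {v}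
  rw [card_singleton, h.card] at hc
  refine ⟨?_, by rw [hcnt, h.c0]; rfl, by rw [hcnt, h.c1]; rfl, by rw [hcnt, h.c2]; rfl,
    by rw [hcnt, h.c3]; rfl, by omega⟩
  intro x y z hxy hyz hxz
  have hx : x ≠ v := by rintro rfl; exact hadj _ hxy.symm
  have hy : y ≠ v := by rintro rfl; exact hadj _ hxy
  have hz : z ≠ v := by rintro rfl; exact hadj _ hyz
  exact h.cluster ⟨x, by simpa⟩ ⟨y, by simpa⟩ ⟨z, by simpa⟩ hxy hyz (by simpa using hxz)

/-- Adding a vertex joined to both ends of an isolated edge gives a triangle. -/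
lemma Prof.of_del_triangle {w p q : α} (hw : ∀ y, G.Adj w y ↔ y = p ∨ y = q) (hpq : G.Adj p q)
    (hp : dg G p = 2) (hq : dg G q = 2) {a b c d : ℕ} (h : Prof (del G {w}) a (b + 2) c d) :
    Prof G a b (c + 3) d := by
  have hwp : G.Adj w p := (hw p).2 (Or.inl rfl)
  have hwq : G.Adj w q := (hw q).2 (Or.inr rfl)
  have hnp : ∀ y, G.Adj p y → y = w ∨ y = q := by
    intro y hy; by_contra! hc
    have h1 : ({y, w, q} : Finset α) ⊆ nbs G p := by
      intro z hz; simp at hz; rcases hz with rfl | rfl | rfl <;> simp [hy, hwp.symm, hpq]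
    have := card_le_card h1
    rw [card_eq_three.2 ⟨y, w, q, hc.1, hc.2, hwq.ne, rfl⟩, ← dg, hp] at this
    omega
  have hnq : ∀ y, G.Adj q y → y = w ∨ y = p := by
    intro y hy; by_contra! hc
    have h1 : ({y, w, p} : Finset α) ⊆ nbs G q := by
      intro z hz; simp at hz; rcases hz with rfl | rfl | rfl <;> simp [hy, hwq.symm, hpq.symm]
    have := card_le_card h1
    rw [card_eq_three.2 ⟨y, w, p, hc.1, hc.2, hwp.ne, rfl⟩, ← dg, hq] at this
    omega
  have hdw : dg G w = 2 := by
    rw [dg, show nbs G w = {p, q} by ext y; simp [hw], card_pair hpq.ne]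
  have hcnt : ∀ j, cnt G j + (if j = 1 then 2 else 0) =
      cnt (del G {w}) j + if j = 2 then 3 else 0 := by
    intro j
    have e1 : cnt G j = (if 2 = j then 1 else 0) + ∑ x ∈ univ.erase w, if dg G x = j then 1 else 0 := by
      rw [cnt_eq_sum, ← add_sum_erase univ _ (mem_univ w), hdw]
    have e2 : cnt (del G {w}) j =
        ∑ x ∈ univ.erase w, if (if G.Adj x w then dg G x - 1 else dg G x) = j then 1 else 0 := by
      rw [cnt_eq_sum]
      simp_rw [dg_del_single]
      exact (Finset.sum_subtype (univ.erase w) (by simp)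
        (fun x => if (if G.Adj x w then dg G x - 1 else dg G x) = j then 1 else 0)).symm
    have hp' : p ∈ univ.erase w := by simp [hwp.ne.symm]
    have hq' : q ∈ (univ.erase w).erase p := by simp [hwq.ne.symm, hpq.ne.symm]
    rw [e1, e2, ← add_sum_erase _ _ hp', ← add_sum_erase _ _ hp', ← add_sum_erase _ _ hq',
      ← add_sum_erase _ _ hq', if_pos hwp.symm, if_pos hwq.symm, hp, hq]
    have e3 : ∑ x ∈ ((univ.erase w).erase p).erase q, (if dg G x = j then 1 else 0) =
        ∑ x ∈ ((univ.erase w).erase p).erase q,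
          if (if G.Adj x w then dg G x - 1 else dg G x) = j then 1 else 0 := by
      refine sum_congr rfl fun x hx => ?_
      simp at hx
      rw [if_neg (c := G.Adj x w)]
      intro h'
      rcases (hw x).1 h'.symm with h' | h'
      · exact hx.2.1 h'
      · exact hx.1 h'
    rw [e3]
    by_cases j1 : j = 1
    · subst j1; simp; omega
    by_cases j2 : j = 2
    · subst j2; simp; omega
    · simp [j1, j2, Ne.symm j1, Ne.symm j2]
  have hc := card_compl_subtype {w}
  rw [card_singleton, h.card] at hc
  have h0 := hcnt 0
  have h1 := hcnt 1
  have h2 := hcnt 2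
  have h3 := hcnt 3
  rw [h.c0] at h0
  rw [h.c1] at h1
  rw [h.c2] at h2
  rw [h.c3] at h3
  simp at h0 h1 h2 h3
  refine ⟨?_, h0, h1, h2, h3, by omega⟩
  intro x y z hxy hyz hxz
  by_cases hyw : y = w
  · subst hyw
    rcases (hw x).1 hxy.symm with rfl | rfl <;> rcases (hw z).1 hyz with rfl | rfl <;>
      first | exact absurd rfl hxz | exact hpq | exact hpq.symm
  by_cases hyp : y = p
  · subst hyp
    rcases hnp x hxy.symm with rfl | rfl <;> rcases hnp z hyz with rfl | rfl <;>
      first | exact absurd rfl hxz | exact hwq | exact hwq.symm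
  by_cases hyq : y = q
  · subst hyq
    rcases hnq x hxy.symm with rfl | rfl <;> rcases hnq z hyz with rfl | rfl <;>
      first | exact absurd rfl hxz | exact hwp | exact hwp.symm
  · have hx : x ≠ w := by
      rintro rfl; rcases (hw y).1 hxy with h' | h'
      exacts [hyp h', hyq h']
    have hz : z ≠ w := by
      rintro rfl; rcases (hw y).1 hyz.symm with h' | h'
      exacts [hyp h', hyq h']
    exact h.cluster ⟨x, by simpa⟩ ⟨y, by simpa⟩ ⟨z, by simpa⟩ hxy hyz (by simpa using hxz)

/-- Adding a `K₁` on one side and enlarging a `K₂` to a `K₃` on the other moves along the list of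
exceptional pairs, in two chains: first to second to fourth, and third to fifth to sixth to seventh.
-/
lemma BE.of_del_triangle {v : α} (hv : dg G v = 0) {w p q : β}
    (hw : ∀ y, H.Adj w y ↔ y = p ∨ y = q) (hpq : H.Adj p q)
    (hp : dg H p = 2) (hq : dg H q = 2) (h : BE (del G {v}) (del H {w})) : BE G H := by
  have h2 : 2 ≤ cnt (del H {w}) 1 := by
    have hwp : H.Adj w p := (hw p).2 (Or.inl rfl)
    have hwq : H.Adj w q := (hw q).2 (Or.inr rfl)
    have hs : ({⟨p, by simpa using hwp.ne.symm⟩, ⟨q, by simpa using hwq.ne.symm⟩} :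
        Finset {x // x ∉ ({w} : Finset β)}) ⊆ univ.filter fun x => dg (del H {w}) x = 1 := by
      intro x hx
      simp only [mem_insert, mem_singleton] at hx
      rcases hx with rfl | rfl
      · simp [dg_del_single, hwp.symm, hp]
      · simp [dg_del_single, hwq.symm, hq]
    have := card_le_card hs
    rwa [card_pair (by simpa using hpq.ne)] at this
  rcases h with h | h <;>
  rcases h with ⟨h1, h3⟩ | ⟨h1, h3⟩ | ⟨h1, h3⟩ | ⟨h1, h3⟩ | ⟨h1, h3⟩ | ⟨h1, h3⟩ | ⟨h1, h3⟩
  all_goals first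
    | (exfalso; have := h3.c1; omega)
    | (exfalso; have := h1.c1; omega)
    | skip
  · exact Or.inr (Or.inr (Or.inl ⟨Prof.of_del_triangle hw hpq hp hq h1, h3.of_del_isolated hv⟩))
  · exact Or.inr (Or.inr (Or.inr (Or.inr (Or.inl
      ⟨Prof.of_del_triangle hw hpq hp hq h1, h3.of_del_isolated hv⟩))))
  · exact Or.inr (Or.inr (Or.inr (Or.inr (Or.inr (Or.inl
      ⟨Prof.of_del_triangle hw hpq hp hq h1, h3.of_del_isolated hv⟩)))))
  · exact Or.inr (Or.inr (Or.inr (Or.inr (Or.inr (Or.inr (Or.inl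
      ⟨Prof.of_del_triangle hw hpq hp hq h1, h3.of_del_isolated hv⟩))))))
  · exact Or.inr (Or.inr (Or.inr (Or.inr (Or.inr (Or.inr (Or.inr
      ⟨Prof.of_del_triangle hw hpq hp hq h1, h3.of_del_isolated hv⟩))))))

/-- Place an isolated vertex. -/
lemma Red2.isolated_step (C : Red2 G H L) {v : α} (hv : dg G v = 0) {w : β} (hvw : ¬ L v w)
    (hk : 2 ≤ dg H w + dL L v + dL (flip L) w) (hn : ¬ Pk G H L) :
    BE (del G {v}) (del H {w}) ∧ (∀ x, x ≠ v → ∀ y, y ≠ w → ¬ L x y) ∧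
      dg H w + dL L v + dL (flip L) w = 2 := by
  by_contra hcon
  have hadj : ∀ {x}, ¬ G.Adj x v := fun h => dg_eq_zero.1 hv _ h.symm
  have hc := C.hc
  have he := C.he
  refine hn (C.step1 hvw (fun x _ => C.exists_nadj_ne v x) (fun y _ => C.symm.exists_nadj_ne w y)
    ?_ ?_ ?_ ?_)
  · intro x _
    obtain ⟨y, hy, hy'⟩ := exists_not_notMem (L := L) x {w} (by have := C.l2 x; simp; omega)
    exact ⟨y, by simpa using hy, hy', fun h => absurd h hadj⟩
  · intro y _
    obtain ⟨x, h, h'⟩ := exists_not_notMem (L := flip L) y {v} (by have := C.r2 y; simp; omega)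
    exact ⟨x, by simpa using h, h', fun h => absurd h hadj⟩
  · rw [hv, zero_mul]; omega
  · intro h1 h2 h3
    refine hcon ⟨h1, fun x hx y hy => (h2 x hx y hy).1, ?_⟩
    have := eLout_single hvw
    omega

/-- An isolated vertex that can be placed profitably. -/
lemma Red2.pack_isolated_of_two_le (C : Red2 G H L) {v : α} (hv : dg G v = 0) {w : β}
    (hvw : ¬ L v w) (hk : 2 ≤ dg H w + dL L v + dL (flip L) w) : Pk G H L := by
  by_contra hn
  have hc := C.hc
  -- If nothing packs, every placement of an isolated vertex that saves two must save exactly two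
  -- and leave an exceptional pair with no forbidden pairs.
  have f1 : ∀ v w, dg G v = 0 → ¬ L v w → 2 ≤ dg H w + dL L v + dL (flip L) w →
      BE (del G {v}) (del H {w}) ∧ (∀ x, x ≠ v → ∀ y, y ≠ w → ¬ L x y) ∧
      dg H w + dL L v + dL (flip L) w = 2 := fun v w hv hvw hk => C.isolated_step hv hvw hk hn
  have f1' : ∀ v w, dg H w = 0 → ¬ L v w → dg G v + dL (flip L) w + dL L v ≤ 2 := by
    intro v w hw hvw
    by_contra! hlt
    have := (C.symm.isolated_step hw (w := v) hvw (by
      change 2 ≤ dg G v + dL (flip L) w + dL L v; omega) fun h => hn h.symm).2.2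
    change dg G v + dL (flip L) w + dL L v = 2 at this
    omega
  have f2 : ∀ y, ¬ L v y → dg H y + dL L v + dL (flip L) y ≤ 2 := by
    intro y hy; by_contra! hlt
    have := (f1 v y hv hy (by omega)).2.2; omega
  obtain ⟨hbe, hout, hk2⟩ := f1 v w hv hvw hk
  -- degrees in the deleted graphs
  have dB : ∀ y (hy : y ≠ w), dg (del H {w}) ⟨y, by simpa using hy⟩ ≤ dg H y := by
    intro y hy; rw [dg_del_single]; split_ifs <;> simp
  have dA : ∀ x (hx : x ≠ v), dg (del G {v}) ⟨x, by simpa using hx⟩ = dg G x := by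
    intro x hx; rw [dg_del_single, if_neg]; exact fun h => dg_eq_zero.1 hv x h.symm
  have hdeg : (∀ S : Finset β, S.card ≤ 2 → ∃ y ∉ S, y ≠ w ∧ 2 ≤ dg H y) ∨
      ((∀ y, y ≠ w → dg H y = if H.Adj y w then 2 else 1) ∧ (∃ x, x ≠ v ∧ dg G x = 0) ∧
      ∀ S : Finset α, S.card ≤ 2 → ∃ x ∉ S, 2 ≤ dg G x) := by
    rcases hbe.degrees with h | ⟨h1, ⟨x, h2⟩, h3⟩
    · refine Or.inl fun S hS => ?_
      obtain ⟨⟨y, hyw⟩, hy, hd⟩ := h (S.subtype (· ∉ ({w} : Finset β))) (card_subtype_notMem_le _ hS)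
      have hyw : y ≠ w := by simpa using hyw
      exact ⟨y, by simpa using hy, hyw, hd.trans (dB y hyw)⟩
    · refine Or.inr ⟨fun y hy => ?_, ⟨x.1, by simpa using x.2, ?_⟩, fun S hS => ?_⟩
      · have := h1 ⟨y, by simpa using hy⟩
        rw [dg_del_single] at this
        dsimp only at this
        split_ifs at this ⊢ <;> omega
      · rw [← h2]; exact (dA x.1 (by simpa using x.2)).symm
      · obtain ⟨⟨y, hyw⟩, hy, hd⟩ := h3 (S.subtype (· ∉ ({v} : Finset α))) (card_subtype_notMem_le _ hS)
        have hyw : y ≠ v := by simpa using hyw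
        exact ⟨y, by simpa using hy, hd.trans (dA y hyw).le⟩
  have hLv : dL L v ≤ 2 := by omega
  interval_cases hLv' : dL L v
  · -- no list pair at `v`
    have hvL : ∀ y, ¬ L v y := fun y h => by have := dL_pos.2 ⟨y, h⟩; omega
    by_cases hR : dL (flip L) w = 0
    · have hw2 : dg H w = 2 := by omega
      obtain ⟨p, q, hpq, hN⟩ := card_eq_two.1 (show (nbs H w).card = 2 from hw2)
      have hw : ∀ y, H.Adj w y ↔ y = p ∨ y = q := by
        intro y; rw [← mem_nbs, hN]; simp
      have hwp : H.Adj w p := (hw p).2 (Or.inl rfl)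
      have hwq : H.Adj w q := (hw q).2 (Or.inr rfl)
      have hd : ∀ y, dg H y ≤ 2 := fun y => by have := f2 y (hvL y); omega
      -- Any vertex of degree two could host `v`, so deleting it must leave a union of cliques.
      have hcl : ∀ r, dg H r = 2 → Cluster (del H {r}) := fun r hr =>
        (f1 v r hv (hvL r) (by omega)).1.symm.cluster
      by_cases hadj : H.Adj p q
      · refine C.nbe (BE.of_del_triangle hv hw hadj ?_ ?_ hbe)
        · have h1 := card_le_card (show {w, q} ⊆ nbs H p from fun z hz => by
            simp at hz; rcases hz with rfl | rfl <;> simp [hwp.symm, hadj])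
          rw [card_pair hwq.ne, ← dg] at h1
          have := hd p; omega
        · have h1 := card_le_card (show {w, p} ⊆ nbs H q from fun z hz => by
            simp at hz; rcases hz with rfl | rfl <;> simp [hwq.symm, hadj.symm])
          rw [card_pair hwp.ne, ← dg] at h1
          have := hd q; omega
      · have dp := dg_del_single (G := H) w ⟨p, by simpa using hwp.ne.symm⟩
        have dq := dg_del_single (G := H) w ⟨q, by simpa using hwq.ne.symm⟩
        rw [if_pos hwp.symm] at dp
        rw [if_pos hwq.symm] at dq
        dsimp only at dp dq
        have hp1 : 0 < dg H p := dg_pos.2 ⟨w, hwp.symm⟩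
        have hq1 : 0 < dg H q := dg_pos.2 ⟨w, hwq.symm⟩
        have hp2 := hd p
        have hq2 := hd q
        by_cases h1 : dg H p = 2 ∧ dg H q = 2
        -- Deleting `p` leaves the path `w`, `q`, `q'`, whose ends are not adjacent.
        · obtain ⟨q', hq'w, hq'⟩ : ∃ q', q' ≠ w ∧ H.Adj q q' := by
            by_contra! hcon
            have : nbs H q ⊆ {w} := fun z hz => by
              by_contra hzw; simp at hz hzw; exact hcon z hzw hz
            have := card_le_card this
            rw [← dg, card_singleton] at this; omega
          have hq'p : q' ≠ p := by rintro rfl; exact hadj hq'.symm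
          have := hcl p h1.1 ⟨w, by simpa using hwp.ne⟩ ⟨q, by simpa using hpq.symm⟩
            ⟨q', by simpa using hq'p⟩ hwq hq' (by simpa using hq'w.symm)
          rcases (hw q').1 this with h | h
          · exact hq'p h
          · exact hq'.ne h.symm
        -- If just one of them had degree one, deleting `w` would leave vertices of degrees zero and
        -- one.
        · have h2 : dg H p = 1 ∧ dg H q = 1 := by
            rcases (by omega : dg H p = 1 ∨ dg H q = 1) with h | h
            · refine ⟨h, ?_⟩
              by_contra hne
              exact hbe.symm.no_mix (x := ⟨p, by simpa using hwp.ne.symm⟩)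
                (y := ⟨q, by simpa using hwq.ne.symm⟩) (by omega) (by omega)
            · refine ⟨?_, h⟩
              by_contra hne
              exact hbe.symm.no_mix (x := ⟨q, by simpa using hwq.ne.symm⟩)
                (y := ⟨p, by simpa using hwp.ne.symm⟩) (by omega) (by omega)
          -- Now `p`, `w`, `q` is a path component; deleting another vertex of degree two leaves
          -- this path intact.
          rcases hdeg with h | ⟨h, -, -⟩
          · obtain ⟨r, hr, hrw, hrd⟩ := h {p, q} card_le_two
            simp at hr
            have hr2 := hd r
            have := hcl r (by omega) ⟨p, by simpa using Ne.symm hr.1⟩ ⟨w, by simpa using hrw.symm⟩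
              ⟨q, by simpa using Ne.symm hr.2⟩ hwp.symm hwq (by simpa using hpq)
            exact hadj this
          · have := h p hwp.ne.symm
            rw [if_pos hwp.symm] at this; omega
    · obtain ⟨x, hx⟩ := dL_pos.1 (Nat.pos_of_ne_zero hR)
      have hx : L x w := hx
      have hxv : x ≠ v := by rintro rfl; exact hvL w hx
      -- A vertex `y` of degree two could host `v` instead, but the pair `(x, w)` would then
      -- survive.
      have hle : ∀ y, y ≠ w → dg H y ≤ 1 := by
        intro y hy; by_contra! hlt
        exact (f1 v y hv (hvL y) (by omega)).2.1 x hxv w hy.symm hx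
      rcases hdeg with h | ⟨h1, -, h3⟩
      · obtain ⟨y, -, hyw, hy⟩ := h ∅ (by simp)
        have := hle y hyw; omega
      · have hw0 : dg H w = 0 := by
          by_contra h0
          obtain ⟨r, hr⟩ := dg_pos.1 (Nat.pos_of_ne_zero h0)
          have e1 := h1 r hr.ne.symm
          rw [if_pos hr.symm] at e1
          have := hle r hr.ne.symm; omega
        obtain ⟨a, ha, hd⟩ := h3 (row (flip L) w) (by rw [← dL]; omega)
        have := f1' a w hw0 (by simpa [flip] using ha)
        omega
  · -- one list pair at `v`
    obtain ⟨y, hy⟩ := card_eq_one.1 (show (row L v).card = 1 from hLv')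
    have hvL : ∀ z, L v z ↔ z = y := by intro z; rw [← mem_row (L := L) (x := v), hy]; simp
    have hLvy : L v y := (hvL y).2 rfl
    have hyw : y ≠ w := by rintro rfl; exact hvw hLvy
    have hle : ∀ z, z ≠ y → dg H z + dL (flip L) z ≤ 1 := fun z hz => by
      have := f2 z (fun h => hz ((hvL z).1 h)); omega
    rcases hdeg with h | ⟨h1, ⟨x, hxv, hx⟩, -⟩
    · obtain ⟨z, hz, -, hd⟩ := h {y} (by simp)
      have := hle z (by simpa using hz); omega
    · have hxy : ¬ L x y := hout x hxv y hyw
      have hRy : 0 < dL (flip L) y := dL_pos.2 ⟨v, hLvy⟩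
      have hdy : 0 < dg H y := by rw [h1 y hyw]; split_ifs <;> simp
      -- Another isolated vertex `x` may go on `y`. Exactness then empties the column of `w`, so `w`
      -- has a neighbour, of degree two in this case, for which there is no room.
      obtain ⟨-, h4, h5⟩ := f1 x y hx hxy (by omega)
      have hRw : dL (flip L) w = 0 := by
        by_contra h0
        obtain ⟨x', hx'⟩ := dL_pos.1 (Nat.pos_of_ne_zero h0)
        have hx' : L x' w := hx'
        by_cases hxx : x' = x
        · have := dL_pos (L := L) (x := x) |>.2 ⟨w, hxx ▸ hx'⟩
          omega
        · exact h4 x' hxx w hyw.symm hx'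
      obtain ⟨r, hr⟩ := dg_pos.1 (by omega : 0 < dg H w)
      have e1 := h1 r hr.ne.symm
      rw [if_pos hr.symm] at e1
      by_cases hry : r = y
      · rw [hry] at e1; omega
      · have := hle r hry; omega
  · -- two list pairs at `v`
    have h0 : ∀ y, ¬ L v y → dg H y = 0 := fun y hy => by have := f2 y hy; omega
    rcases hdeg with h | ⟨h1, -, -⟩
    · obtain ⟨y, hy, -, hd⟩ := h (row L v) (by rw [← dL]; omega)
      have := h0 y (by simpa using hy); omega
    · have h3 : insert w (row L v) = univ := by
        ext y; simp only [mem_insert, mem_row, mem_univ, iff_true]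
        by_contra! hcon
        have e1 := h1 y hcon.1
        have := h0 y hcon.2
        split_ifs at e1 <;> omega
      have h4 := card_insert_le w (row L v)
      rw [h3, card_univ, ← dL] at h4
      have := hbe.card_ge
      have := card_compl_subtype ({v} : Finset α)
      rw [card_singleton] at this
      omega

/-- A triple with an isolated vertex packs. -/
lemma Red2.pack_isolated (C : Red2 G H L) {v : α} (hv : dg G v = 0) : Pk G H L := by
  by_contra hn
  have hc := C.hc
  have f1 : ∀ v w, dg G v = 0 → ¬ L v w → dg H w + dL L v + dL (flip L) w ≤ 1 := by
    intro v w hv hvw; by_contra! hlt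
    exact hn (C.pack_isolated_of_two_le hv hvw (by omega))
  have f2 : ∀ v w, dg H w = 0 → ¬ L v w → dg G v + dL (flip L) w + dL L v ≤ 1 := by
    intro v w hw hvw; by_contra! hlt
    exact hn (C.symm.pack_isolated_of_two_le hw (w := v) hvw (by
      change 2 ≤ dg G v + dL (flip L) w + dL L v; omega)).symm
  have hLv : dL L v = 0 := by
    by_contra h0
    obtain ⟨w, hw⟩ := C.hL v
    have h1 := f1 v w hv hw
    obtain ⟨y, hy⟩ := card_eq_one.1 (show (row L v).card = 1 by rw [← dL]; omega)
    obtain ⟨z, hz, hz'⟩ := exists_adj_ne C.eh y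
    have := f1 v z hv (fun h => hz (by
      have hm : z ∈ row L v := mem_row.2 h
      simpa [hy] using hm))
    omega
  have hvL : ∀ y, ¬ L v y := fun y h => by have := dL_pos.2 ⟨y, h⟩; omega
  have hk : ∀ y, dg H y + dL (flip L) y ≤ 1 := fun y => by have := f1 v y hv (hvL y); omega
  have hL0 : eL L = 0 := by
    by_contra h0
    obtain ⟨a, b, hab⟩ := eL_pos.1 (Nat.pos_of_ne_zero h0)
    have h1 : 0 < dL (flip L) b := dL_pos.2 ⟨a, hab⟩
    have h2 := hk b
    obtain ⟨s, hs, hs'⟩ := exists_adj_ne C.eg a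
    have := f2 s b (by omega) (fun h => by
      have := card_le_one.1 (show (row (flip L) b).card ≤ 1 by rw [← dL]; omega) s
        (by simpa [flip] using h) a (by simpa [flip] using hab)
      exact hs this)
    omega
  have hL : ∀ x y, ¬ L x y := fun x y h => by have := eL_pos.2 ⟨x, y, h⟩; omega
  by_cases hiso : ∃ b, dg H b = 0
  · obtain ⟨b, hb⟩ := hiso
    have hG1 : ∀ x, dg G x ≤ 1 := fun x => by have := f2 x b hb (hL x b); omega
    have hH1 : ∀ y, dg H y ≤ 1 := fun y => by have := hk y; omega
    have e1 := sum_dg_le_card_mul hG1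
    have e2 := sum_dg_le_card_mul hH1
    have hn3 := C.toAdm.three_le C.eg
    refine hn (Pk.of_count C.hc ?_)
    rw [hL0, mul_zero, add_zero, ← mul_assoc]
    have e3 := C.he
    rw [← hc, mul_one] at e2
    rw [mul_one] at e1
    calc 2 * ed G * ed H ≤ Fintype.card α * ed H := Nat.mul_le_mul_right _ e1
      _ < _ := Nat.mul_lt_mul_of_pos_left (by omega) (by omega)
  · push Not at hiso
    refine hn (C.symm.pack_matching (fun y => ?_) (by rw [eL_flip, hL0])).symm
    have := hk y
    have := hiso y
    omega

end Isolated

/-! ### No isolated vertices: placing leaves -/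

section NoIsolated
open Classical
variable {α : Type u} {β : Type v} [Fintype α] [Fintype β] {G : SimpleGraph α} {H : SimpleGraph β}
  {L : α → β → Prop}

/-- Place a leaf. -/
lemma Red.leaf_step (C : Red G H L) (hL3 : eL L + 3 ≤ Fintype.card α) {v u : α}
    (hv : dg G v = 1) (hvu : G.Adj v u) {w : β} (hw : 0 < dg H w) (hvw : ¬ L v w)
    (hk : ed G + ed H + eL L + 4 ≤ 2 * Fintype.card α + dL L v + dL (flip L) w)
    (hu : ∃ y, y ≠ w ∧ ¬ L u y ∧ ¬ H.Adj y w) : Pk G H L := by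
  have hc := C.hc
  have hxv : ∀ x, x ≠ u → ¬ G.Adj x v := fun x hx h => hx (dg_eq_one_unique hv h.symm hvu)
  -- The new pairs at `u` cancel against the edges at `w`, so the saving is one plus the row of `v`
  -- and the column of `w`; `hk` supplies what is missing.
  refine C.step1 hvw (fun x _ => C.exists_nadj_ne v x) (fun y _ => C.symm.exists_nadj_ne w y)
    ?_ ?_ (by rw [hv]; omega) ?_
  · intro x _
    by_cases hxu : x = u
    · obtain ⟨y, h1, h2, h3⟩ := hu
      exact ⟨y, h1, hxu ▸ h2, fun _ => h3⟩
    · have := dL_le_eL (L := L) x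
      obtain ⟨y, hy, hy'⟩ := exists_not_notMem (L := L) x {w} (by simp; omega)
      exact ⟨y, by simpa using hy, hy', fun h => absurd h (hxv x hxu)⟩
  · intro y _
    have := dR_le_eL (L := L) y
    obtain ⟨x, h, h'⟩ := exists_not_notMem (L := flip L) y {v, u} (by
      rw [card_pair hvu.ne]; omega)
    simp at h
    exact ⟨x, h.1, h', fun h1 => absurd h1 (hxv x h.2)⟩
  -- The pair of `u` and a neighbour of `w` is newly forbidden, so the remainder is not exceptional.
  · intro _ h _
    obtain ⟨y, hy⟩ := dg_pos.1 hw
    exact (h u hvu.ne.symm y hy.ne.symm).2 ⟨hvu.symm, hy.symm⟩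

/-- If a leaf cannot be placed on `w`, then `w` has large degree. -/
lemma Red.le_of_leaf (C : Red G H L) (hn : ¬ Pk G H L) (hL3 : eL L + 3 ≤ Fintype.card α) {v u : α}
    (hv : dg G v = 1) (hvu : G.Adj v u) {w : β} (hw : 0 < dg H w) (hvw : ¬ L v w)
    (hk : ed G + ed H + eL L + 4 ≤ 2 * Fintype.card α + dL L v + dL (flip L) w) :
    Fintype.card α ≤ dL L u + dg H w + 1 := by
  by_contra! hlt
  refine hn (C.leaf_step hL3 hv hvu hw hvw hk ?_)
  obtain ⟨y, hy, hy'⟩ := exists_not_notMem (L := L) u (insert w (nbs H w)) (by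
    rw [insert_nbs_card]; have := C.hc; omega)
  simp only [mem_insert, mem_nbs, not_or] at hy
  exact ⟨y, hy.1, hy', fun h => hy.2 h.symm⟩

/-- `A` and `B` are the row sizes of a leaf and of its neighbour; `h` is the doubled edge bound when
every allowed image of the leaf has degree at least n - 1 - B. -/
lemma leaf_arith {n A B e : ℕ} (hA : 1 ≤ A) (hAB : A + B + 3 ≤ n)
    (h : n + ((n - A) * (n - 1 - B) + A) + 2 * (A + B) + 6 ≤ 4 * n + e) (he : e = 0) : False := by
  subst he
  obtain ⟨k, rfl⟩ : ∃ k, n = A + B + 3 + k := ⟨n - (A + B + 3), by omega⟩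
  rw [show A + B + 3 + k - A = B + 3 + k by omega,
    show A + B + 3 + k - 1 - B = A + 2 + k by omega] at h
  nlinarith [Nat.zero_le (A * B), Nat.zero_le (B * k), Nat.zero_le (A * k), Nat.zero_le (k * k)]

/-- A leaf with a nonempty list of forbidden vertices. -/
lemma Red.pack_leaf_list (C : Red G H L) (hG : ∀ x, 1 ≤ dg G x) (hH : ∀ y, 1 ≤ dg H y) {v : α}
    (hv : dg G v = 1) (hLv : 0 < dL L v) : Pk G H L := by
  by_contra hn
  have hc := C.hc
  have he := C.he
  have h1 := card_mul_le_sum_dg hG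
  have h2 := card_mul_le_sum_dg hH
  rw [mul_one] at h1 h2
  obtain ⟨u, hvu⟩ := dg_pos.1 (by omega : 0 < dg G v)
  have hAB := dL_add_le_eL (L := L) hvu.ne
  have h3 : ∀ w, ¬ L v w → Fintype.card α - 1 - dL L u ≤ dg H w := fun w hw => by
    have := C.le_of_leaf hn (by omega) hv hvu (hH w) hw (by omega)
    omega
  have h4 : (Fintype.card α - dL L v) * (Fintype.card α - 1 - dL L u) + dL L v ≤ 2 * ed H := by
    rw [← sum_dg, ← sum_add_sum_compl (row L v), add_comm]
    refine Nat.add_le_add ?_ ?_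
    · rw [dL, card_eq_sum_ones]; exact sum_le_sum fun y _ => hH y
    · have : (row L v)ᶜ.card = Fintype.card α - dL L v := by rw [card_compl, hc]; rfl
      rw [← this, ← smul_eq_mul, ← sum_const]
      exact sum_le_sum fun w hw => h3 w (by simpa using hw)
  exact leaf_arith (n := Fintype.card α) (A := dL L v) (B := dL L u) (e := 0) hLv (by omega)
    (by omega) rfl

/-- A sparse graph has many leaves. -/
lemma le_cnt_one (hG : ∀ x, 1 ≤ dg G x) (S : Finset α) :
    2 * Fintype.card α + ∑ s ∈ S, dg G s ≤ cnt G 1 + 2 * ed G + 2 * S.card := by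
  have e1 := sum_add_sum_compl S (dg G)
  rw [sum_dg] at e1
  have e2 : 2 * Sᶜ.card ≤ ∑ x ∈ Sᶜ, dg G x + cnt G 1 := by
    have : ∑ x ∈ Sᶜ, (if dg G x = 1 then 1 else 0) ≤ cnt G 1 := by
      rw [cnt_eq_sum]; exact sum_le_sum_of_subset (subset_univ _)
    refine le_trans ?_ (Nat.add_le_add_left this _)
    rw [← sum_add_distrib, mul_comm, ← smul_eq_mul, ← sum_const]
    refine sum_le_sum fun x _ => ?_
    have := hG x
    split_ifs <;> omega
  have e3 : S.card + Sᶜ.card = Fintype.card α := card_add_card_compl S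
  omega

lemma exists_leaf_notMem (S : Finset α) (h : S.card < cnt G 1) : ∃ b ∉ S, dg G b = 1 := by
  by_contra! hc
  have : univ.filter (fun x => dg G x = 1) ⊆ S := fun x hx => by
    by_contra hxS; exact hc x hxS (by simpa using hx)
  have := card_le_card this
  rw [cnt] at h; omega

/-- A triple without isolated vertices and with some forbidden pair or few edges. -/
lemma Red.pack_of_list (C : Red G H L) (hG : ∀ x, 1 ≤ dg G x) (hH : ∀ y, 1 ≤ dg H y)
    (hs : ed G + 2 ≤ Fintype.card α)
    (h : 0 < eL L ∨ ed G + ed H + eL L + 4 ≤ 2 * Fintype.card α) : Pk G H L := by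
  by_contra hn
  have hc := C.hc
  have he := C.he
  have h1 := card_mul_le_sum_dg hG
  have h2 := card_mul_le_sum_dg hH
  rw [mul_one] at h1 h2
  have hvL : ∀ v, dg G v = 1 → ∀ y, ¬ L v y := fun v hv y hy =>
    hn (C.pack_leaf_list hG hH hv (dL_pos.2 ⟨y, hy⟩))
  have hl := le_cnt_one hG ∅
  simp at hl
  obtain ⟨v₁, -, hv₁⟩ := exists_leaf_notMem (G := G) ∅ (by simp; omega)
  obtain ⟨u₁, hu₁⟩ := dg_pos.1 (by omega : 0 < dg G v₁)
  by_cases hL : eL L = 0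
  · obtain ⟨w⟩ : Nonempty β := Fintype.card_pos_iff.1 (by have := C.toAdm.three_le C.eg; omega)
    have := C.le_of_leaf hn (by omega) hv₁ hu₁ (hH w) (hvL v₁ hv₁ w) (by omega)
    have := dL_le_eL (L := L) u₁
    have := C.h3 w
    omega
  obtain ⟨x, y, hxy⟩ := eL_pos.1 (Nat.pos_of_ne_zero hL)
  have hl1 := le_cnt_one hG {u₁}
  simp at hl1
  -- Two leaves with different neighbours, blocked on `y` and on a non-neighbour `y'` of `y`, make
  -- the rows of `u₁`, `u₂` and the degrees of `y`, `y'` total at least 2n - 2.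
  obtain ⟨v₂, hv₂', hv₂⟩ := exists_leaf_notMem (G := G) (nbs G u₁) (by rw [← dg]; omega)
  obtain ⟨u₂, hu₂⟩ := dg_pos.1 (by omega : 0 < dg G v₂)
  have hne : u₁ ≠ u₂ := by rintro rfl; exact hv₂' (by simpa using hu₂.symm)
  have hRy : 0 < dL (flip L) y := dL_pos.2 ⟨x, hxy⟩
  have k1 := C.le_of_leaf hn (by omega) hv₁ hu₁ (hH y) (hvL v₁ hv₁ y) (by omega)
  have hy3 := C.h3 y
  obtain ⟨y', hy', hyy'⟩ := C.hH y
  have hLy' : L u₁ y' := by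
    by_contra hcon
    refine hn (C.leaf_step (by omega) hv₁ hu₁ (hH y) (hvL v₁ hv₁ y) (by omega)
      ⟨y', hy', hcon, fun h => hyy' h.symm⟩)
  have hRy' : 0 < dL (flip L) y' := dL_pos.2 ⟨u₁, hLy'⟩
  have k2 := C.le_of_leaf hn (by omega) hv₂ hu₂ (hH y') (hvL v₂ hv₂ y') (by omega)
  have k3 := dL_add_le_eL (L := L) hne
  have k4 := ed_del_pair_nadj hy'.symm hyy'
  omega

/-- In a sparse graph some leaf and its neighbour can be deleted without leaving a vertex
adjacent to all others. -/
lemma exists_leaf_edge (hG : ∀ x, 1 ≤ dg G x) (hs : ed G + 2 ≤ Fintype.card α)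
    (hn : 5 ≤ Fintype.card α) : ∃ b c, dg G b = 1 ∧ G.Adj b c ∧
      ∀ x, x ≠ b → x ≠ c → ∃ y, y ≠ b ∧ y ≠ c ∧ y ≠ x ∧ ¬ G.Adj x y := by
  have hl := le_cnt_one hG ∅
  simp at hl
  obtain ⟨b, -, hb⟩ := exists_leaf_notMem (G := G) ∅ (by simp; omega)
  obtain ⟨c, hbc⟩ := dg_pos.1 (by omega : 0 < dg G b)
  by_cases hz : ∀ x, x ≠ b → x ≠ c → ∃ y, y ≠ b ∧ y ≠ c ∧ y ≠ x ∧ ¬ G.Adj x y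
  · exact ⟨b, c, hb, hbc, hz⟩
  push Not at hz
  obtain ⟨z, hzb, hzc, hz⟩ := hz
  have hzd := le_dg_of_adj (G := G) (S := {b, c}) (x := z)
    (fun y hy hyx => by simp at hy; exact hz y hy.1 hy.2 hyx)
  rw [card_pair hbc.ne] at hzd
  -- `z` has degree at least n - 3 and the total degree is at most 2n - 4, so all other vertices are
  -- leaves; a leaf at `z` will do.
  have hone : ∀ x ∈ univ.erase z, 1 = dg G x := by
    have e1 := add_sum_erase univ (dg G) (mem_univ z)
    rw [sum_dg] at e1
    have e2 : (univ.erase z).card = Fintype.card α - 1 := by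
      rw [card_erase_of_mem (mem_univ z), card_univ]
    have e3 : ∑ x ∈ univ.erase z, 1 ≤ ∑ x ∈ univ.erase z, dg G x := sum_le_sum fun x _ => hG x
    refine (sum_eq_sum_iff_of_le fun x _ => hG x).1 (le_antisymm e3 ?_)
    rw [← card_eq_sum_ones]; omega
  obtain ⟨b', hb'⟩ := dg_pos.1 (hG z)
  refine ⟨b', z, (hone b' (by simp [hb'.ne.symm])).symm, hb'.symm, fun x _ hxz => ?_⟩
  have hx := hone x (by simp [hxz])
  obtain ⟨y, hy, h⟩ := exists_nadj_notMem (G := G) x {b', z} (by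
    rw [card_pair hb'.ne.symm]; omega)
  simp at hy
  exact ⟨y, hy.1, hy.2, h⟩

/-- A leaf `w` of `H` whose deletion with its neighbour `p` leaves a vertex `z` adjacent to all
others. -/
lemma Red.pack_full_of_leaf (C : Red G H L) (hL : eL L = 0) (hG : ∀ x, 1 ≤ dg G x)
    (hs : ed G + 2 ≤ Fintype.card α) (hn : 5 ≤ Fintype.card α) {w p z : β} (hw : dg H w = 1)
    (hwp : H.Adj w p) (hzw : z ≠ w) (hzp : z ≠ p)
    (hz : ∀ y, y ≠ w → y ≠ p → y ≠ z → H.Adj z y) : Pk G H L := by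
  have hc := C.hc
  have he := C.he
  have hL' : ∀ x y, ¬ L x y := fun x y h => by have := eL_pos.2 ⟨x, y, h⟩; omega
  obtain ⟨b, c, hb, hbc, hG'⟩ := exists_leaf_edge hG hs hn
  have hnzw : ¬ H.Adj z w := fun h => hzp (dg_eq_one_unique hw h.symm hwp)
  have hwy : ∀ y, H.Adj y w → y = p := fun y h => dg_eq_one_unique hw h.symm hwp
  have hbx : ∀ x, x ≠ c → ¬ G.Adj x b := fun x hx h => hx (dg_eq_one_unique hb h.symm hbc)
  have cP : ({b, c} : Finset α).card = 2 := card_pair hbc.ne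
  have cQ : ({w, p} : Finset β).card = 2 := card_pair hwp.ne
  have cQ' : ({z, w} : Finset β).card = 2 := card_pair hzw
  have hzd := le_dg_of_adj (G := H) (S := {w, p}) (x := z)
    (fun y hy hyx => by simp at hy; exact hz y hy.1 hy.2 hyx)
  have hz3 := C.h3 z
  have e1 := ed_del_pair_adj hbc
  have e2 := ed_del_pair_nadj hzw hnzw
  have n1 := nbs_sdiff_pair_adj hbc
  have n1 : (nbs G b \ {b, c}).card = 0 := by omega
  have n2 : (nbs G c \ {b, c}).card + 1 = dg G c := by
    rw [pair_comm]; exact nbs_sdiff_pair_adj hbc.symm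
  have n3 : (nbs H w \ {z, w}).card = 1 := by
    rw [pair_comm, nbs_sdiff_pair_nadj (fun h => hnzw h.symm), hw]
  -- With `b` on `z` and `c` on `w` the cost is deg c - 1, while deg c edges of `G` and at least n -
  -- 2 edges of `H` disappear.
  refine C.step2 hbc.ne hzw (hL' _ _) (hL' _ _) (fun _ => hnzw) hG' ?_ ?_ ?_ ?_ ?_
  · intro x hxz hxw
    by_contra! hx
    by_cases hxp : x = p
    · have : nbs H x ⊇ insert w (univ \ {z, w, x}) := by
        intro y hy
        simp at hy
        rcases hy with rfl | hy
        · simpa [hxp] using hwp.symm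
        · simpa using hx y hy.1 hy.2.1 hy.2.2
      have := card_le_card this
      rw [card_insert_of_notMem (by simp), card_univ_sdiff, ← dg] at this
      have c3 := card_le_three (a := z) (b := w) (c := x)
      have := C.h3 x
      omega
    · have : nbs H x ⊇ insert z (univ \ {z, w, x}) := by
        intro y hy
        simp at hy
        rcases hy with rfl | hy
        · simpa using (hz x hxw hxp hxz).symm
        · simpa using hx y hy.1 hy.2.1 hy.2.2
      have := card_le_card this
      rw [card_insert_of_notMem (by simp), card_univ_sdiff, ← dg] at this
      have c3 := card_le_three (a := z) (b := w) (c := x)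
      have := C.h3 x
      omega
  · intro x hxb hxc
    obtain ⟨y, hy⟩ := exists_notMem_of_card_lt ({z, w, p} : Finset β) (by
      have := card_le_three (a := z) (b := w) (c := p); omega)
    simp at hy
    exact ⟨y, hy.1, hy.2.1, hL' _ _, fun h => absurd h (hbx x hxc),
      fun _ h => hy.2.2 (hwy y h)⟩
  · intro y hyz hyw
    obtain ⟨x, hx, hxc, h⟩ := exists_nadj_notMem (G := G) c {b} (by
      have := C.g3 c; simp; omega)
    simp at hx
    exact ⟨x, hx, hxc, hL' _ _, fun h' => absurd h' (hbx x hxc), fun h' => absurd h'.symm h⟩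
  · rw [n1, n3]; omega
  · intro _ _ h1 h2
    omega

/-- Place a vertex `u` of maximum degree on a leaf `w` and a leaf `b` on the neighbour of `w`. -/
lemma Red.pack_max_on_leaf (C : Red G H L) (hL : eL L = 0)
    (hG : ∀ x, 1 ≤ dg G x) (hs : ed G + 2 ≤ Fintype.card α) {u b : α} (hu : ∀ x, dg G x ≤ dg G u)
    (hu2 : 2 ≤ dg G u) (hb : dg G b = 1) (hub : ¬ G.Adj u b) {w p : β} (hw : dg H w = 1)
    (hwp : H.Adj w p)
    (hbe : BE (del G {u, b}) (del H {w, p}) → dg G u = 2 → dg H p = 1 → False) : Pk G H L := by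
  by_contra hnp
  apply hnp
  have hc := C.hc
  have he := C.he
  have hn : 5 ≤ Fintype.card α := by have := C.g3 u; omega
  have hL' : ∀ x y, ¬ L x y := fun x y h => by have := eL_pos.2 ⟨x, y, h⟩; omega
  obtain ⟨c, hbc⟩ := dg_pos.1 (by omega : 0 < dg G b)
  have hne : u ≠ b := by rintro rfl; omega
  have hwy : ∀ y, H.Adj y w → y = p := fun y h => dg_eq_one_unique hw h.symm hwp
  have hbx : ∀ x, G.Adj x b → x = c := fun x h => dg_eq_one_unique hb h.symm hbc
  have cP : ({u, b} : Finset α).card = 2 := card_pair hne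
  have cQ : ({w, p} : Finset β).card = 2 := card_pair hwp.ne
  have e1 := ed_del_pair_nadj hne hub
  have e2 := ed_del_pair_adj hwp
  have n1 := nbs_sdiff_pair_adj hwp
  have n1 : (nbs H w \ {w, p}).card = 0 := by omega
  have n2 : (nbs H p \ {w, p}).card + 1 = dg H p := by
    rw [pair_comm]; exact nbs_sdiff_pair_adj hwp.symm
  have n3 : (nbs G b \ {u, b}).card = 1 := by
    rw [pair_comm, nbs_sdiff_pair_nadj (fun h => hub h.symm), hb]
  -- The net saving is deg u + 2, since the cost deg p - 1 is covered by the edges at `p`.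
  refine C.step2 hne hwp.ne (hL' _ _) (hL' _ _) (fun h => absurd h hub) ?_ ?_ ?_ ?_ ?_ ?_
  · intro x hxu hxb
    by_contra! hx
    have k1 := le_ed_del_of_adj (G := G) (S := {u, b}) (x := x) (by simp [hxu, hxb])
      (fun y hy hyx => by simp at hy; exact hx y hy.1 hy.2 hyx)
    have k2 := le_dg_of_adj (G := G) (S := {u, b}) (x := x)
      (fun y hy hyx => by simp at hy; exact hx y hy.1 hy.2 hyx)
    have := hu x
    omega
  · intro z hzw hzp
    by_contra! hz
    exact hnp (C.pack_full_of_leaf hL hG hs hn hw hwp hzw hzp hz)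
  · intro x _ _
    obtain ⟨y, hy, hyp, h⟩ := exists_nadj_notMem (G := H) p {w} (by
      have := C.h3 p; simp; omega)
    exact ⟨y, by simpa using hy, hyp, hL' _ _, fun _ h' => hyp (hwy y h'),
      fun _ h' => h h'.symm⟩
  · intro y _ hyp
    obtain ⟨x, hx⟩ := exists_notMem_of_card_lt ({u, b, c} : Finset α) (by
      have := card_le_three (a := u) (b := b) (c := c); omega)
    simp at hx
    exact ⟨x, hx.1, hx.2.1, hL' _ _, fun _ h => hyp (hwy y h),
      fun h => absurd (hbx x h) hx.2.2⟩
  · rw [n1, n3]; omega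
  · intro h1 _ h2 _
    exact hbe h1 (by omega) (by omega)

/-- Place a leaf `b` with a neighbour of degree two on a vertex `U` of degree at least two, and this
neighbour on an end of an isolated edge. -/
lemma Red.pack_leaf_on_max (C : Red G H L) (hL : eL L = 0)
    (hs : ed G + 2 ≤ Fintype.card α) {b c : α} (hb : dg G b = 1) (hbc : G.Adj b c)
    (hcd : dg G c = 2) {U w p : β} (hU : 2 ≤ dg H U) (hw : dg H w = 1) (hwp : H.Adj w p)
    (hp : dg H p = 1) : Pk G H L := by
  have hc := C.hc
  have he := C.he
  have hn : 5 ≤ Fintype.card α := by have := C.g3 c; omega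
  have hL' : ∀ x y, ¬ L x y := fun x y h => by have := eL_pos.2 ⟨x, y, h⟩; omega
  have hUp : U ≠ p := by rintro rfl; omega
  have hUw : U ≠ w := by rintro rfl; omega
  have hpy : ∀ y, H.Adj y p → y = w := fun y h => dg_eq_one_unique hp h.symm hwp.symm
  have hwy : ∀ y, H.Adj y w → y = p := fun y h => dg_eq_one_unique hw h.symm hwp
  have hUnp : ¬ H.Adj U p := fun h => hUw (hpy U h)
  have hbx : ∀ x, x ≠ c → ¬ G.Adj x b := fun x hx h => hx (dg_eq_one_unique hb h.symm hbc)
  have cP : ({b, c} : Finset α).card = 2 := card_pair hbc.ne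
  have e1 := ed_del_pair_adj hbc
  have e2 := ed_del_pair_nadj hUp hUnp
  have n1 := nbs_sdiff_pair_adj hbc
  have n1 : (nbs G b \ {b, c}).card = 0 := by omega
  have n2 : (nbs G c \ {b, c}).card + 1 = dg G c := by
    rw [pair_comm]; exact nbs_sdiff_pair_adj hbc.symm
  have n2 : (nbs G c \ {b, c}).card = 1 := by omega
  have n3 : (nbs H p \ {U, p}).card = 1 := by
    rw [pair_comm, nbs_sdiff_pair_nadj (fun h => hUnp h.symm), hp]
  refine C.step2 hbc.ne hUp (hL' _ _) (hL' _ _) (fun _ => hUnp) ?_ ?_ ?_ ?_ ?_ ?_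
  · intro x hxb hxc
    by_contra! hx
    have k1 := le_ed_del_of_adj (G := G) (S := {b, c}) (x := x) (by simp [hxb, hxc])
      (fun y hy hyx => by simp at hy; exact hx y hy.1 hy.2 hyx)
    omega
  · intro z hzU hzp
    by_contra! hz
    by_cases hzw : z = w
    · obtain ⟨y, hy⟩ := exists_notMem_of_card_lt ({U, p, w} : Finset β) (by
        have := card_le_three (a := U) (b := p) (c := w); omega)
      simp at hy
      exact hy.2.1 (hwy y (hzw ▸ (hz y hy.1 hy.2.1 (hzw ▸ hy.2.2)).symm))
    · exact hzp (hwy z (hz w hUw.symm hwp.ne (Ne.symm hzw)))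
  · intro x _ hxc
    obtain ⟨y, hy⟩ := exists_notMem_of_card_lt ({U, p, w} : Finset β) (by
      have := card_le_three (a := U) (b := p) (c := w); omega)
    simp at hy
    exact ⟨y, hy.1, hy.2.1, hL' _ _, fun h => absurd h (hbx x hxc),
      fun _ h => hy.2.2 (hpy y h)⟩
  · intro y _ _
    obtain ⟨x, hx, hxc, h⟩ := exists_nadj_notMem (G := G) c {b} (by simp; omega)
    exact ⟨x, by simpa using hx, hxc, hL' _ _, fun h' => absurd h' (hbx x hxc),
      fun h' => absurd h'.symm h⟩
  · rw [n1, n2, n3]; omega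
  · intro _ h _ _
    obtain ⟨x, hx⟩ : (nbs G c \ {b, c}).Nonempty := card_pos.1 (by omega)
    simp at hx
    exact (h x hx.2.1 hx.2.2 w hUw.symm hwp.ne).2 ⟨hx.1.symm, hwp⟩

/-- Placing `u` on the leaf `w` can only leave an exceptional pair if deg u = 2 and `wp` is an
isolated edge. Then either some leaf of `G` hangs on a vertex of degree two and goes on a large
vertex, or the deletion leaves degrees zero and one together. -/
lemma Red.pack_of_leaf (C : Red G H L) (hL : eL L = 0)
    (hG : ∀ x, 1 ≤ dg G x) (hs : ed G + 2 ≤ Fintype.card α)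
    (ht : ed G + ed H + 3 = 2 * Fintype.card α) {u : α} (hu : ∀ x, dg G x ≤ dg G u)
    (hu2 : 2 ≤ dg G u) {w p : β} (hw : dg H w = 1) (hwp : H.Adj w p) : Pk G H L := by
  have hc := C.hc
  have hn : 5 ≤ Fintype.card α := by have := C.g3 u; omega
  have hl := le_cnt_one hG {u}
  simp at hl
  obtain ⟨b, hb', hb⟩ := exists_leaf_notMem (G := G) (nbs G u) (by rw [← dg]; omega)
  have hub : ¬ G.Adj u b := by simpa using hb'
  by_cases h1 : dg G u = 2 ∧ dg H p = 1
  · obtain ⟨hu2', hp⟩ := h1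
    by_cases h2 : ∃ b c, dg G b = 1 ∧ G.Adj b c ∧ dg G c = 2
    · obtain ⟨b, c, hb, hbc, hcd⟩ := h2
      obtain ⟨U, hU⟩ : ∃ U, 2 ≤ dg H U := by
        by_contra! hcon
        have := sum_dg_le_card_mul (G := H) (k := 1) fun y => by have := hcon y; omega
        omega
      exact C.pack_leaf_on_max hL hs hb hbc hcd hU hw hwp hp
    · push Not at h2
      refine C.pack_max_on_leaf hL hG hs hu hu2 hb hub hw hwp fun hbe _ _ => ?_
      obtain ⟨c, hbc⟩ := dg_pos.1 (by omega : 0 < dg G b)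
      have hc1 : dg G c = 1 := by
        have := h2 b c hb hbc; have := hu c; have := hG c; omega
      obtain ⟨x, hux⟩ := dg_pos.1 (by omega : 0 < dg G u)
      have hx2 : dg G x = 2 := by
        have := hu x
        have := hG x
        by_contra hne
        exact h2 x u (by omega) hux.symm hu2'
      have hne : u ≠ b := by rintro rfl; omega
      have hcu : c ≠ u := by rintro rfl; omega
      have hxb : x ≠ b := by rintro rfl; exact hub hux
      have hxc : x ≠ c := by rintro rfl; omega
      have hxnb : ¬ G.Adj x b := fun h => hxc (dg_eq_one_unique hb h.symm hbc)
      have hcnu : ¬ G.Adj c u := fun h => hne (dg_eq_one_unique hc1 h hbc.symm)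
      have d1 := dg_del_add (G := G) {u, b} ⟨c, by simp [hcu, hbc.ne.symm]⟩
      have d2 := dg_del_add (G := G) {u, b} ⟨x, by simp [hux.ne.symm, hxb]⟩
      have i1 : nbs G c ∩ {u, b} = {b} := by
        ext y; simp; constructor
        · rintro ⟨h, rfl | rfl⟩
          exacts [absurd h hcnu, rfl]
        · rintro rfl; exact ⟨hbc.symm, Or.inr rfl⟩
      have i2 : nbs G x ∩ {u, b} = {u} := by
        ext y; simp; constructor
        · rintro ⟨h, rfl | rfl⟩
          exacts [rfl, absurd h hxnb]
        · rintro rfl; exact ⟨hux.symm, Or.inl rfl⟩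
      dsimp only at d1 d2
      rw [i1, card_singleton] at d1
      rw [i2, card_singleton] at d2
      exact hbe.no_mix (x := ⟨c, by simp [hcu, hbc.ne.symm]⟩)
        (y := ⟨x, by simp [hux.ne.symm, hxb]⟩) (by omega) (by omega)
  · exact C.pack_max_on_leaf hL hG hs hu hu2 hb hub hw hwp fun _ h2 h3 => h1 ⟨h2, h3⟩

end NoIsolated

/-! ### Minimum degree two on one side, and the end of the induction -/

section NoLeaf
open Classical
variable {α : Type u} {β : Type v} [Fintype α] [Fintype β] {G : SimpleGraph α} {H : SimpleGraph β}
  {L : α → β → Prop}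

lemma ed_del_triple_nadj {a b c : α} (hab : a ≠ b) (hac : a ≠ c) (hbc : b ≠ c)
    (h1 : ¬ G.Adj a b) (h2 : ¬ G.Adj a c) (h3 : ¬ G.Adj b c) :
    ed (del G {a, b, c}) + dg G a + dg G b + dg G c = ed G := by
  have h := ed_del (G := G) {a, b, c}
  have e : ∀ f : α → ℕ, ∑ s ∈ ({a, b, c} : Finset α), f s = f a + f b + f c := by
    intro f
    rw [sum_insert (by simp [hab, hac]), sum_pair hbc, add_assoc]
  rw [e, e] at h
  have hi : ∀ {x : α}, ¬ G.Adj x a → ¬ G.Adj x b → ¬ G.Adj x c → nbs G x ∩ {a, b, c} = ∅ := by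
    intro x ha hb hc
    refine eq_empty_of_forall_notMem fun y hy => ?_
    simp only [mem_inter, mem_nbs, mem_insert, mem_singleton] at hy
    obtain ⟨hy, rfl | rfl | rfl⟩ := hy
    exacts [ha hy, hb hy, hc hy]
  rw [hi G.irrefl h1 h2, hi (fun h => h1 h.symm) G.irrefl h3,
    hi (fun h => h2 h.symm) (fun h => h3 h.symm) G.irrefl, card_empty] at h
  omega

/-- Place a vertex `u` on a vertex `w` of degree two, and leaves `b₁`, `b₂` on the neighbours of
`w`. -/
lemma Red.pack_three (C : Red G H L) (hL : eL L = 0)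
    (ht : ed G + ed H + 3 = 2 * Fintype.card α) (hs : ed G + 3 ≤ Fintype.card α)
    (hn : 7 ≤ Fintype.card α) (hH : ∀ y, 2 ≤ dg H y) (hH' : ∀ y, dg H y + 5 ≤ Fintype.card α)
    {u b₁ b₂ c₁ c₂ : α} (hu2 : 2 ≤ dg G u) (hb₁ : dg G b₁ = 1) (hb₂ : dg G b₂ = 1)
    (hbc₁ : G.Adj b₁ c₁) (hbc₂ : G.Adj b₂ c₂) (hub₁ : ¬ G.Adj u b₁) (hub₂ : ¬ G.Adj u b₂)
    (hcc : c₁ ≠ c₂) (hbc : b₁ ≠ b₂) (hbb : ¬ G.Adj b₁ b₂) {w : β} (hw : dg H w = 2) :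
    Pk G H L := by
  have hc := C.hc
  have hL' : ∀ x y, ¬ L x y := fun x y h => by have := eL_pos.2 ⟨x, y, h⟩; omega
  obtain ⟨w₁, w₂, hw12, hN⟩ := card_eq_two.1 (show (nbs H w).card = 2 from hw)
  have hwy : ∀ y, H.Adj w y ↔ y = w₁ ∨ y = w₂ := by
    intro y; rw [← mem_nbs, hN]; simp
  have hw1 : H.Adj w w₁ := (hwy _).2 (Or.inl rfl)
  have hw2 : H.Adj w w₂ := (hwy _).2 (Or.inr rfl)
  have hu1 : u ≠ b₁ := by rintro rfl; omega
  have hu2' : u ≠ b₂ := by rintro rfl; omega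
  have hbx₁ : ∀ x, G.Adj x b₁ → x = c₁ := fun x h => dg_eq_one_unique hb₁ h.symm hbc₁
  have hbx₂ : ∀ x, G.Adj x b₂ → x = c₂ := fun x h => dg_eq_one_unique hb₂ h.symm hbc₂
  have cP : ({u, b₁, b₂} : Finset α).card = 3 := card_eq_three.2 ⟨_, _, _, hu1, hu2', hbc, rfl⟩
  have cQ : ({w, w₁, w₂} : Finset β).card = 3 :=
    card_eq_three.2 ⟨_, _, _, hw1.ne, hw2.ne, hw12, rfl⟩
  have e1 := ed_del_triple_nadj hu1 hu2' hbc hub₁ hub₂ hbb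
  -- the neighbourhoods of `w`, `w₁`, `w₂`
  obtain ⟨ε, hε⟩ : ∃ ε, ε = if H.Adj w₁ w₂ then 1 else 0 := ⟨_, rfl⟩
  have i0 : (nbs H w ∩ {w, w₁, w₂}).card = 2 := by
    rw [hN, inter_eq_left.2 (by simp), card_pair hw12]
  have i1 : (nbs H w₁ ∩ {w, w₁, w₂}).card = 1 + ε := by
    split_ifs at hε with h
    · rw [show nbs H w₁ ∩ {w, w₁, w₂} = {w, w₂} by
        ext y; simp; constructor
        · rintro ⟨h, rfl | rfl | rfl⟩
          exacts [Or.inl rfl, absurd h H.irrefl, Or.inr rfl]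
        · rintro (rfl | rfl)
          exacts [⟨hw1.symm, Or.inl rfl⟩, ⟨h, Or.inr (Or.inr rfl)⟩], card_pair hw2.ne, hε]
    · rw [show nbs H w₁ ∩ {w, w₁, w₂} = {w} by
        ext y; simp; constructor
        · rintro ⟨h', rfl | rfl | rfl⟩
          exacts [rfl, absurd h' H.irrefl, absurd h' h]
        · rintro rfl
          exact ⟨hw1.symm, Or.inl rfl⟩, card_singleton, hε]
  have i2 : (nbs H w₂ ∩ {w, w₁, w₂}).card = 1 + ε := by
    split_ifs at hε with h
    · rw [show nbs H w₂ ∩ {w, w₁, w₂} = {w, w₁} by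
        ext y; simp; constructor
        · rintro ⟨h, rfl | rfl | rfl⟩
          exacts [Or.inl rfl, Or.inr rfl, absurd h H.irrefl]
        · rintro (rfl | rfl)
          exacts [⟨hw2.symm, Or.inl rfl⟩, ⟨h.symm, Or.inr (Or.inl rfl)⟩], card_pair hw1.ne, hε]
    · rw [show nbs H w₂ ∩ {w, w₁, w₂} = {w} by
        ext y; simp; constructor
        · rintro ⟨h', rfl | rfl | rfl⟩
          exacts [rfl, absurd h'.symm h, absurd h' H.irrefl]
        · rintro rfl
          exact ⟨hw2.symm, Or.inl rfl⟩, card_singleton, hε]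
  have hsum : ∀ f : β → ℕ, ∑ s ∈ ({w, w₁, w₂} : Finset β), f s = f w + f w₁ + f w₂ := by
    intro f
    rw [sum_insert (by simp [hw1.ne, hw2.ne]), sum_pair hw12, add_assoc]
  have hsum' : ∀ f : α → ℕ, ∑ s ∈ ({u, b₁, b₂} : Finset α), f s = f u + f b₁ + f b₂ := by
    intro f
    rw [sum_insert (by simp [hu1, hu2']), sum_pair hbc, add_assoc]
  have e2 := ed_del (G := H) {w, w₁, w₂}
  rw [hsum, hsum, i0, i1, i2, hw] at e2
  have j0 := card_sdiff_add_card_inter (nbs H w) {w, w₁, w₂}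
  have j1 := card_sdiff_add_card_inter (nbs H w₁) {w, w₁, w₂}
  have j2 := card_sdiff_add_card_inter (nbs H w₂) {w, w₁, w₂}
  rw [← dg, i0, hw] at j0
  rw [← dg, i1] at j1
  rw [← dg, i2] at j2
  have j0 : (nbs H w \ {w, w₁, w₂}).card = 0 := by omega
  have k1 : (nbs G b₁ \ {u, b₁, b₂}).card ≤ 1 := (card_le_card sdiff_subset).trans hb₁.le
  have k2 : (nbs G b₂ \ {u, b₁, b₂}).card ≤ 1 := (card_le_card sdiff_subset).trans hb₂.le
  set π : α → β := fun x => if x = u then w else if x = b₁ then w₁ else w₂ with hπ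
  have pu : π u = w := by simp [hπ]
  have p1 : π b₁ = w₁ := by simp [hπ, hu1.symm]
  have p2 : π b₂ = w₂ := by simp [hπ, hu2'.symm, hbc.symm]
  have e3 := eL_rest_le (G := G) (H := H) (L := L) {u, b₁, b₂} {w, w₁, w₂} π
  have e4 := eLout_le (L := L) {u, b₁, b₂} {w, w₁, w₂}
  rw [hsum', pu, p1, p2, j0, mul_zero] at e3
  have m1 := Nat.mul_le_mul_right (nbs H w₁ \ {w, w₁, w₂}).card k1
  have m2 := Nat.mul_le_mul_right (nbs H w₂ \ {w, w₁, w₂}).card k2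
  have hε1 : ε ≤ 1 := by rw [hε]; split_ifs <;> simp
  have hd1 := hH w₁
  have hd2 := hH w₂
  have hind : ∀ s ∈ ({u, b₁, b₂} : Finset α), ∀ t ∈ ({u, b₁, b₂} : Finset α), ¬ G.Adj s t := by
    intro s hs t ht
    simp only [mem_insert, mem_singleton] at hs ht
    rcases hs with rfl | rfl | rfl <;> rcases ht with rfl | rfl | rfl <;>
      first | exact G.irrefl | assumption | (intro h; exact absurd h.symm (by assumption))
  refine C.step (P := {u, b₁, b₂}) (Q := {w, w₁, w₂}) (π := π) (by omega) ?_ ?_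
    (fun s hs t ht h => absurd h (hind s hs t ht)) (fun _ _ => hL' _ _) ?_ ?_ ?_ ?_ (by omega) ?_
  · refine injOn_of_card_image_eq ?_
    rw [image_insert, image_insert, image_singleton, pu, p1, p2, cP, cQ]
  · rw [image_insert, image_insert, image_singleton, pu, p1, p2]
  · intro x hx
    by_contra! hx'
    have := le_ed_del_of_adj (G := G) hx hx'
    omega
  · intro y hy
    by_contra! hy'
    have := le_dg_of_adj (G := H) hy'
    have := hH' y
    omega
  · intro x hx
    by_cases hxc : x = c₁
    · obtain ⟨y, hy, -, h⟩ := exists_nadj_notMem (G := H) w₁ {w, w₁, w₂} (by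
        have := hH' w₁; omega)
      refine ⟨y, hy, hL' _ _, fun s hs hxs => ?_⟩
      simp only [mem_insert, mem_singleton, not_or] at hs hy
      rcases hs with rfl | rfl | rfl
      · rw [pu]; intro h'
        rcases (hwy y).1 h'.symm with h' | h'
        exacts [hy.2.1 h', hy.2.2 h']
      · rw [p1]; exact fun h' => h h'.symm
      · exact absurd (hxc.symm.trans (hbx₂ x hxs)) hcc
    · obtain ⟨y, hy, -, h⟩ := exists_nadj_notMem (G := H) w₂ {w, w₁, w₂} (by
        have := hH' w₂; omega)
      refine ⟨y, hy, hL' _ _, fun s hs hxs => ?_⟩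
      simp only [mem_insert, mem_singleton, not_or] at hs hy
      rcases hs with rfl | rfl | rfl
      · rw [pu]; intro h'
        rcases (hwy y).1 h'.symm with h' | h'
        exacts [hy.2.1 h', hy.2.2 h']
      · exact absurd (hbx₁ x hxs) hxc
      · rw [p2]; exact fun h' => h h'.symm
  · intro y hy
    obtain ⟨x, hx⟩ := exists_notMem_of_card_lt ({u, b₁, b₂} ∪ {c₁, c₂} : Finset α) (by
      have := card_union_le ({u, b₁, b₂} : Finset α) {c₁, c₂}
      rw [cP, card_pair hcc] at this; omega)
    rw [mem_union, not_or] at hx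
    refine ⟨x, hx.1, hL' _ _, fun s hs hxs => ?_⟩
    simp only [mem_insert, mem_singleton, not_or] at hs hy hx
    rcases hs with rfl | rfl | rfl
    · rw [pu]; intro h'
      rcases (hwy y).1 h'.symm with h' | h'
      exacts [hy.2.1 h', hy.2.2 h']
    · exact absurd (hbx₁ x hxs) hx.2.1
    · exact absurd (hbx₂ x hxs) hx.2.2
  · intro hbe
    have c1 := card_compl_subtype ({u, b₁, b₂} : Finset α)
    have c2 := card_compl_subtype ({w, w₁, w₂} : Finset β)
    have := hbe.ed_add (by omega)
    omega

lemma Red.pack_of_no_leaf (C : Red G H L) (hL : eL L = 0) (hG : ∀ x, 1 ≤ dg G x)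
    (ht : ed G + ed H + 3 = 2 * Fintype.card α) (hH : ∀ y, 2 ≤ dg H y) {u : α}
    (hu2 : 2 ≤ dg G u) : Pk G H L := by
  have hc := C.hc
  have h1 := card_mul_le_sum_dg hG
  have h2 := card_mul_le_sum_dg hH
  have hs : ed G + 3 ≤ Fintype.card α := by omega
  -- The remaining degrees are at least 2(n - 1) in `H` and n + 1 in `G`, out of a total of 4n - 6.
  have hH' : ∀ y, dg H y + 5 ≤ Fintype.card α := by
    intro y
    have e1 := add_sum_erase univ (dg H) (mem_univ y)
    have e2 : (univ.erase y).card * 2 ≤ ∑ z ∈ univ.erase y, dg H z := by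
      rw [← smul_eq_mul, ← sum_const]; exact sum_le_sum fun z _ => hH z
    have e3 := add_sum_erase univ (dg G) (mem_univ u)
    have e4 : (univ.erase u).card * 1 ≤ ∑ z ∈ univ.erase u, dg G z := by
      rw [← smul_eq_mul, ← sum_const]; exact sum_le_sum fun z _ => hG z
    rw [sum_dg] at e1 e3
    rw [card_erase_of_mem (mem_univ _), card_univ] at e2 e4
    omega
  have hl := le_cnt_one hG {u}
  simp at hl
  obtain ⟨b₁, hb₁', hb₁⟩ := exists_leaf_notMem (G := G) (nbs G u) (by rw [← dg]; omega)
  have hub₁ : ¬ G.Adj u b₁ := by simpa using hb₁'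
  obtain ⟨c₁, hbc₁⟩ := dg_pos.1 (by omega : 0 < dg G b₁)
  have huc : u ≠ c₁ := by rintro rfl; exact hub₁ hbc₁.symm
  have hl2 := le_cnt_one hG {u, c₁}
  rw [sum_pair huc, card_pair huc] at hl2
  obtain ⟨b₂, hb₂', hb₂⟩ := exists_leaf_notMem (G := G) (nbs G u ∪ insert c₁ (nbs G c₁)) (by
    have := card_union_le (nbs G u) (insert c₁ (nbs G c₁))
    rw [insert_nbs_card, ← dg] at this; omega)
  simp only [mem_union, mem_insert, mem_nbs, not_or] at hb₂'
  obtain ⟨c₂, hbc₂⟩ := dg_pos.1 (by omega : 0 < dg G b₂)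
  have hn : 7 ≤ Fintype.card α := by
    have h3 : cnt G 1 ≤ (univ.erase u).card := card_le_card fun x hx => by
      have hx' : dg G x = 1 := by simpa using hx
      simp only [mem_erase, mem_univ, and_true]; rintro rfl; omega
    rw [card_erase_of_mem (mem_univ _), card_univ] at h3
    omega
  obtain ⟨w, hw⟩ : ∃ w, dg H w = 2 := by
    by_contra! hcon
    have := card_mul_le_sum_dg (G := H) (k := 3) fun y => by
      have := hH y; have := hcon y; omega
    omega
  refine C.pack_three hL ht hs hn hH hH' hu2 hb₁ hb₂ hbc₁ hbc₂ hub₁ hb₂'.1 ?_ ?_ ?_ hw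
  · rintro rfl; exact hb₂'.2.2 hbc₂.symm
  · rintro rfl; exact hb₂'.2.2 hbc₁.symm
  · intro h; exact hb₂'.2.1 (dg_eq_one_unique hb₁ h hbc₁)

lemma Red.pack_no_isolated_of_le (C : Red G H L) (hG : ∀ x, 1 ≤ dg G x) (hH : ∀ y, 1 ≤ dg H y)
    (hs : ed G + 2 ≤ Fintype.card α) : Pk G H L := by
  by_cases h : 0 < eL L ∨ ed G + ed H + eL L + 4 ≤ 2 * Fintype.card α
  · exact C.pack_of_list hG hH hs h
  have he := C.he
  have hL : eL L = 0 := by omega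
  have ht : ed G + ed H + 3 = 2 * Fintype.card α := by omega
  by_cases h1 : ∀ x, dg G x ≤ 1
  · exact C.pack_matching (fun x => le_antisymm (h1 x) (hG x)) hL
  push Not at h1
  obtain ⟨x, hx⟩ := h1
  obtain ⟨u, -, hu⟩ := exists_max_image (univ : Finset α) (dg G) ⟨x, mem_univ x⟩
  have hu : ∀ y, dg G y ≤ dg G u := fun y => hu y (mem_univ y)
  have hu2 : 2 ≤ dg G u := by have := hu x; omega
  by_cases hleaf : ∃ w, dg H w = 1
  · obtain ⟨w, hw⟩ := hleaf
    obtain ⟨p, hwp⟩ := dg_pos.1 (by omega : 0 < dg H w)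
    exact C.pack_of_leaf hL hG hs ht hu hu2 hw hwp
  · push Not at hleaf
    exact C.pack_of_no_leaf hL hG ht (fun y => by have := hH y; have := hleaf y; omega) hu2

/-- The edge bound makes one of the two graphs have at most n - 2 edges, and the situation is
symmetric. -/
lemma Red.pack_no_isolated (C : Red G H L) (hG : ∀ x, 1 ≤ dg G x) (hH : ∀ y, 1 ≤ dg H y) :
    Pk G H L := by
  have he := C.he
  have hc := C.hc
  by_cases hs : ed G + 2 ≤ Fintype.card α
  · exact C.pack_no_isolated_of_le hG hH hs
  · exact (C.symm.pack_no_isolated_of_le hH hG (by omega)).symm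

lemma Crit.pack (C : Crit G H L) : Pk G H L := by
  rcases C.pack_or_red with h | C
  · exact h
  rcases C.pack_or_red2 with h | C
  · exact h
  by_cases hG : ∃ v, dg G v = 0
  · obtain ⟨v, hv⟩ := hG
    exact C.pack_isolated hv
  by_cases hH : ∃ v, dg H v = 0
  · obtain ⟨v, hv⟩ := hH
    exact (C.symm.pack_isolated hv).symm
  push Not at hG hH
  exact C.pack_no_isolated (fun x => Nat.pos_of_ne_zero (hG x)) fun y => Nat.pos_of_ne_zero (hH y)

/-- Every admissible nonexceptional triple packs. -/
lemma packBelow (n : ℕ) : PackBelow.{u, v} n := by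
  induction n with
  | zero => intro α β _ _ G H L h; omega
  | succ n ih =>
    intro α β _ _ G H L hn ha hb
    exact Crit.pack ⟨ha, fun α' β' _ _ G' H' L' h => ih α' β' G' H' L' (by omega), hb⟩

lemma Adm.pack (h : Adm G H L) (hb : ¬ BE G H) : Pk G H L :=
  packBelow (Fintype.card α + 1) α β G H L (Nat.lt_succ_self _) h hb

end NoLeaf

/-! ### From degree counts to isomorphism -/

section Iso
open Classical
variable {α : Type u} {β : Type v} [Fintype α] [Fintype β] {G : SimpleGraph α} {H : SimpleGraph β}

lemma Cluster.adj_iff (h : Cluster G) {x u v : α} (hu : u ∈ insert x (nbs G x)) :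
    G.Adj u v ↔ v ∈ insert x (nbs G x) ∧ u ≠ v := by
  simp only [mem_insert, mem_nbs] at hu ⊢
  rcases hu with rfl | hu
  · exact ⟨fun h => ⟨Or.inr h, h.ne⟩, fun h => h.1.resolve_left h.2.symm⟩
  · constructor
    · intro huv
      refine ⟨?_, huv.ne⟩
      by_cases hv : v = x
      · exact Or.inl hv
      · exact Or.inr (h _ _ _ hu huv (Ne.symm hv))
    · rintro ⟨rfl | hv, hne⟩
      · exact hu.symm
      · exact h _ _ _ hu.symm hv hne

lemma Cluster.dg_eq (h : Cluster G) {x u : α} (hu : u ∈ insert x (nbs G x)) :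
    dg G u = dg G x := by
  have : insert u (nbs G u) = insert x (nbs G x) := by
    ext v
    rw [mem_insert, mem_nbs, h.adj_iff hu]
    exact ⟨fun h => h.elim (fun h => h ▸ hu) And.left,
      fun hv => (eq_or_ne v u).imp_right fun hne => ⟨hv, hne.symm⟩⟩
  have e := congrArg card this
  rw [insert_nbs_card, insert_nbs_card] at e
  omega

/-- The closed neighbourhood of `x` is a whole component, all of whose vertices have the degree of
`x`, and no other degree changes. -/
lemma Cluster.cnt_del (h : Cluster G) (x : α) (j : ℕ) :
    cnt (del G (insert x (nbs G x))) j + (if j = dg G x then dg G x + 1 else 0) = cnt G j := by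
  set P := insert x (nbs G x) with hP
  have hd : ∀ v : {v // v ∉ P}, dg (del G P) v = dg G v := by
    intro v
    rw [dg_del, sdiff_eq_self_of_disjoint, dg]
    rw [Finset.disjoint_left]
    intro u hu hu'
    exact v.2 ((h.adj_iff hu').1 (mem_nbs.1 hu).symm).1
  have e1 : cnt (del G P) j = (univ.filter (fun v => dg G v = j) \ P).card := by
    refine card_bij (fun v _ => v.1) ?_ (fun a _ b _ h => Subtype.ext h) ?_
    · intro v hv
      have hv := (mem_filter.1 hv).2
      rw [hd] at hv
      simp [hv, v.2]
    · intro v hv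
      simp only [mem_sdiff, mem_filter, mem_univ, true_and] at hv
      exact ⟨⟨v, hv.2⟩, by simp [hd, hv.1], rfl⟩
  have e2 : (univ.filter (fun v => dg G v = j) ∩ P).card = if j = dg G x then dg G x + 1 else 0 := by
    split_ifs with hj
    · rw [inter_eq_right.2, hP, insert_nbs_card]
      intro v hv
      simpa [hj] using h.dg_eq hv
    · rw [card_eq_zero]
      refine eq_empty_of_forall_notMem fun v hv => ?_
      simp only [mem_inter, mem_filter, mem_univ, true_and] at hv
      exact hj (hv.1.symm.trans (h.dg_eq hv.2))
  rw [e1, ← e2, card_sdiff_add_card_inter, cnt]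

lemma Cluster.del (h : Cluster G) (P : Finset α) : Cluster (del G P) :=
  fun _ _ _ h1 h2 h3 => h _ _ _ h1 h2 fun e => h3 (Subtype.ext e)

/-- Disjoint unions of complete graphs with the same numbers of vertices of each degree are
isomorphic. -/
theorem Cluster.nonempty_iso (hG : Cluster G) (hH : Cluster H)
    (hc : Fintype.card α = Fintype.card β) (h : ∀ j, cnt G j = cnt H j) : Nonempty (G ≃g H) := by
  induction hn : Fintype.card α using Nat.strong_induction_on generalizing α β with
  | _ n ih =>
  rcases isEmpty_or_nonempty α with hα | ⟨⟨x⟩⟩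
  · have : IsEmpty β := Fintype.card_eq_zero_iff.1 (by rw [← hc, Fintype.card_eq_zero])
    exact ⟨⟨Equiv.equivOfIsEmpty α β, fun {a} => isEmptyElim a⟩⟩
  · obtain ⟨y, hy⟩ := cnt_pos.1 (h (dg G x) ▸ cnt_pos.2 ⟨x, rfl⟩)
    set P := insert x (nbs G x) with hP
    set Q := insert y (nbs H y) with hQ
    have cP : P.card = dg G x + 1 := insert_nbs_card x
    have cQ : Q.card = dg H y + 1 := insert_nbs_card y
    have c1 := card_compl_subtype P
    have c2 := card_compl_subtype Q
    obtain ⟨e⟩ := ih _ (by omega) (hG.del P) (hH.del Q) (by omega) (fun j => by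
      have h1 := hG.cnt_del x j
      have h2 := hH.cnt_del y j
      have h3 := h j
      rw [hy] at h2
      rw [← hP] at h1
      rw [← hQ] at h2
      omega) rfl
    have e0 : {x // x ∈ P} ≃ {y // y ∈ Q} := Finset.equivOfCardEq (by omega)
    -- Components are complete, so any bijection of two of equal size can be glued to the
    -- isomorphism of the rest.
    let f : α ≃ β := (Equiv.sumCompl (· ∈ P)).symm.trans
      ((Equiv.sumCongr e0 e.toEquiv).trans (Equiv.sumCompl (· ∈ Q)))
    have f1 : ∀ u (hu : u ∈ P), f u = e0 ⟨u, hu⟩ := fun u hu => by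
      simp [f, Equiv.sumCompl_symm_apply_of_pos hu]
    have f2 : ∀ u (hu : u ∉ P), f u = e ⟨u, hu⟩ := fun u hu => by
      simp [f, Equiv.sumCompl_symm_apply_of_neg hu]
    have fm : ∀ u, f u ∈ Q ↔ u ∈ P := fun u => by
      by_cases hu : u ∈ P
      · simp only [f1 u hu, hu, iff_true]; exact (e0 ⟨u, hu⟩).2
      · simp only [f2 u hu, hu, iff_false]; exact (e ⟨u, hu⟩).2
    refine ⟨⟨f, fun {u v} => ?_⟩⟩
    by_cases hu : u ∈ P
    · rw [hG.adj_iff hu, hH.adj_iff ((fm u).2 hu), ← hP, ← hQ, fm v, f.injective.ne_iff]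
    by_cases hv : v ∈ P
    · rw [G.adj_comm, H.adj_comm, hG.adj_iff hv, hH.adj_iff ((fm v).2 hv), ← hP, ← hQ, fm u,
        f.injective.ne_iff]
    · rw [f2 u hu, f2 v hv]
      exact e.map_adj_iff (v := ⟨u, hu⟩) (w := ⟨v, hv⟩)

lemma Prof.nonempty_iso {a b c d : ℕ} (hG : Prof G a b c d) (hH : Prof H a b c d) :
    Nonempty (G ≃g H) := by
  refine hG.cluster.nonempty_iso hH.cluster (hG.card.trans hH.card.symm) fun j => ?_
  obtain rfl | rfl | rfl | rfl | hj : j = 0 ∨ j = 1 ∨ j = 2 ∨ j = 3 ∨ 4 ≤ j := by omega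
  · rw [hG.c0, hH.c0]
  · rw [hG.c1, hH.c1]
  · rw [hG.c2, hH.c2]
  · rw [hG.c3, hH.c3]
  · have h1 : ¬ 0 < cnt G j := fun h => by
      obtain ⟨x, hx⟩ := cnt_pos.1 h
      have := hG.dg_lt x
      omega
    have h2 : ¬ 0 < cnt H j := fun h => by
      obtain ⟨x, hx⟩ := cnt_pos.1 h
      have := hH.dg_lt x
      omega
    omega

lemma cnt_sum (j : ℕ) : cnt (G ⊕g H) j = cnt G j + cnt H j := by
  have hl : ∀ x, dg (G ⊕g H) (Sum.inl x) = dg G x := fun x => by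
    rw [dg, show nbs (G ⊕g H) (Sum.inl x) = (nbs G x).map Function.Embedding.inl by
      ext (y | y) <;> simp, card_map, dg]
  have hr : ∀ x, dg (G ⊕g H) (Sum.inr x) = dg H x := fun x => by
    rw [dg, show nbs (G ⊕g H) (Sum.inr x) = (nbs H x).map Function.Embedding.inr by
      ext (y | y) <;> simp, card_map, dg]
  rw [cnt, show univ.filter (fun x => dg (G ⊕g H) x = j) =
    (univ.filter fun x => dg G x = j).disjSum (univ.filter fun x => dg H x = j) by
      ext (y | y) <;> simp [hl, hr], card_disjSum, cnt, cnt]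

lemma Cluster.sum (hG : Cluster G) (hH : Cluster H) : Cluster (G ⊕g H) := by
  rintro (x | x) (y | y) (z | z) h1 h2 h3 <;> simp at h1 h2 h3 ⊢
  · exact hG _ _ _ h1 h2 h3
  · exact hH _ _ _ h1 h2 h3

lemma Prof.sum {a b c d a' b' c' d' : ℕ} (hG : Prof G a b c d) (hH : Prof H a' b' c' d') :
    Prof (G ⊕g H) (a + a') (b + b') (c + c') (d + d') where
  cluster := hG.cluster.sum hH.cluster
  c0 := by rw [cnt_sum, hG.c0, hH.c0]
  c1 := by rw [cnt_sum, hG.c1, hH.c1]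
  c2 := by rw [cnt_sum, hG.c2, hH.c2]
  c3 := by rw [cnt_sum, hG.c3, hH.c3]
  card := by rw [Fintype.card_sum, hG.card, hH.card]; omega

lemma cnt_coclique (k j : ℕ) : cnt (coclique k) j = if j = 0 then k else 0 := by
  have : ∀ x, dg (coclique k) x = 0 := fun x => dg_eq_zero.2 (by simp)
  simp only [cnt, this]
  split_ifs with h
  · simp [h]
  · simp [Ne.symm h]

lemma prof_coclique (k : ℕ) : Prof (coclique k) k 0 0 0 := by
  refine ⟨fun _ _ _ h => h.elim, ?_, ?_, ?_, ?_, ?_⟩ <;> simp [cnt_coclique]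

lemma cnt_clique (k j : ℕ) : cnt (clique (k + 1)) j = if j = k then k + 1 else 0 := by
  have : ∀ x, dg (clique (k + 1)) x = k := fun x => by
    rw [dg_eq_degree, complete_graph_degree, Fintype.card_fin, Nat.add_sub_cancel]
  simp only [cnt, this]
  split_ifs with h
  · simp [h]
  · simp [Ne.symm h]

lemma cluster_clique (k : ℕ) : Cluster (clique k) := fun _ _ _ _ _ h => h

lemma prof_clique_two : Prof (clique 2) 0 2 0 0 := by
  refine ⟨cluster_clique 2, ?_, ?_, ?_, ?_, ?_⟩ <;> simp [cnt_clique]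

lemma prof_clique_three : Prof (clique 3) 0 0 3 0 := by
  refine ⟨cluster_clique 3, ?_, ?_, ?_, ?_, ?_⟩ <;> simp [cnt_clique]

lemma prof_clique_four : Prof (clique 4) 0 0 0 4 := by
  refine ⟨cluster_clique 4, ?_, ?_, ?_, ?_, ?_⟩ <;> simp [cnt_clique]

lemma SamePair.symm {γ δ : Type*} {A : SimpleGraph γ} {B : SimpleGraph δ}
    (h : SamePair G H A B) : SamePair H G A B :=
  h.elim (fun h => Or.inr ⟨h.2, h.1⟩) fun h => Or.inl ⟨h.2, h.1⟩

lemma IsBollobasEldridgePair.symm (h : IsBollobasEldridgePair G H) :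
    IsBollobasEldridgePair H G := by
  rcases h with h | h | h | h | h | h | h
  · exact Or.inl h.symm
  · exact Or.inr (Or.inl h.symm)
  · exact Or.inr (Or.inr (Or.inl h.symm))
  · exact Or.inr (Or.inr (Or.inr (Or.inl h.symm)))
  · exact Or.inr (Or.inr (Or.inr (Or.inr (Or.inl h.symm))))
  · exact Or.inr (Or.inr (Or.inr (Or.inr (Or.inr (Or.inl h.symm)))))
  · exact Or.inr (Or.inr (Or.inr (Or.inr (Or.inr (Or.inr h.symm)))))

lemma BE0.isBollobasEldridgePair (h : BE0 G H) : IsBollobasEldridgePair G H := by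
  have p2 := prof_clique_two
  have p3 := prof_clique_three
  have p4 := prof_clique_four
  rcases h with ⟨h1, h2⟩ | ⟨h1, h2⟩ | ⟨h1, h2⟩ | ⟨h1, h2⟩ | ⟨h1, h2⟩ | ⟨h1, h2⟩ | ⟨h1, h2⟩
  · exact Or.inl (Or.inl ⟨h1.nonempty_iso (p2.sum p2), h2.nonempty_iso ((prof_coclique 1).sum p3)⟩)
  · exact Or.inr (Or.inl (Or.inr
      ⟨h1.nonempty_iso (p2.sum p3), h2.nonempty_iso ((prof_coclique 2).sum p3)⟩))
  · exact Or.inr (Or.inr (Or.inl (Or.inl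
      ⟨h1.nonempty_iso ((p2.sum p2).sum p2), h2.nonempty_iso ((prof_coclique 2).sum p4)⟩)))
  · exact Or.inr (Or.inr (Or.inr (Or.inl (Or.inr
      ⟨h1.nonempty_iso (p3.sum p3), h2.nonempty_iso ((prof_coclique 3).sum p3)⟩))))
  · exact Or.inr (Or.inr (Or.inr (Or.inr (Or.inl (Or.inl
      ⟨h1.nonempty_iso ((p2.sum p2).sum p3), h2.nonempty_iso ((prof_coclique 3).sum p4)⟩)))))
  · exact Or.inr (Or.inr (Or.inr (Or.inr (Or.inr (Or.inl (Or.inr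
      ⟨h1.nonempty_iso ((p2.sum p3).sum p3), h2.nonempty_iso ((prof_coclique 4).sum p4)⟩))))))
  · exact Or.inr (Or.inr (Or.inr (Or.inr (Or.inr (Or.inr (Or.inr
      ⟨h1.nonempty_iso ((p3.sum p3).sum p3), h2.nonempty_iso ((prof_coclique 5).sum p4)⟩))))))

lemma BE.isBollobasEldridgePair (h : BE G H) : IsBollobasEldridgePair G H :=
  h.elim BE0.isBollobasEldridgePair fun h => h.isBollobasEldridgePair.symm

end Iso

/-! ### Forbidden pairs as edges of the third graph -/

section Bipartite
open Classical
variable {α : Type u} {β : Type v} [Fintype α] [Fintype β] (F : SimpleGraph (α ⊕ β))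

lemma dL_inl_le (x : α) : dL (fun v w => F.Adj (Sum.inl v) (Sum.inr w)) x ≤ dg F (Sum.inl x) :=
  card_le_card_of_injOn Sum.inr (fun y hy => by simpa using hy) Sum.inr_injective.injOn

lemma dL_inr_le (y : β) :
    dL (flip fun v w => F.Adj (Sum.inl v) (Sum.inr w)) y ≤ dg F (Sum.inr y) :=
  card_le_card_of_injOn Sum.inl (fun x hx => by simpa [flip, F.adj_comm] using hx)
    Sum.inl_injective.injOn

lemma eL_le_ed : eL (fun v w => F.Adj (Sum.inl v) (Sum.inr w)) ≤ ed F := by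
  refine card_le_card_of_injOn (fun p => s(Sum.inl p.1, Sum.inr p.2)) (fun p hp => by
    simpa using hp) ?_
  rintro ⟨x, y⟩ _ ⟨x', y'⟩ _ h
  simpa using h

end Bipartite

/-! ### The theorem -/

section Main

lemma exists_nonadj_of_maxDegree_le {α : Type*} [Fintype α] {G : SimpleGraph α}
    [DecidableRel G.Adj] (h : (G.maxDegree : ℤ) ≤ Fintype.card α - 2) (x : α) :
    ∃ y, y ≠ x ∧ ¬ G.Adj x y := by
  rw [← dg_le_iff, dg_eq_degree]
  have := G.degree_le_maxDegree x
  omega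

lemma ed_eq_card {α : Type*} [Fintype α] (G : SimpleGraph α) [DecidableRel G.Adj] :
    ed G = G.edgeFinset.card := by
  unfold ed; congr!

end Main

theorem theorem2 {V₁ V₂ : Type*} [Fintype V₁] [Fintype V₂] (n : ℕ) (hn : 1 ≤ n)
    (hV₁ : Fintype.card V₁ = n) (hV₂ : Fintype.card V₂ = n)
    (G₁ : SimpleGraph V₁) (G₂ : SimpleGraph V₂) (G₃ : SimpleGraph (V₁ ⊕ V₂))
    [DecidableRel G₁.Adj] [DecidableRel G₂.Adj] [DecidableRel G₃.Adj]
    (hG₃ : G₃ ≤ completeBipartiteGraph V₁ V₂)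
    (hΔ₁ : (G₁.maxDegree : ℤ) ≤ n - 2) (hΔ₂ : (G₂.maxDegree : ℤ) ≤ n - 2)
    (hΔ₃ : (G₃.maxDegree : ℤ) ≤ n - 1)
    (he : (G₁.edgeFinset.card + G₂.edgeFinset.card + G₃.edgeFinset.card : ℤ) ≤ 2 * n - 3)
    (hBE : ¬ IsBollobasEldridgePair G₁ G₂) :
    ListPacks G₁ G₂ G₃ := by
  have h3 : ∀ x, (dg G₃ x : ℤ) ≤ n - 1 := fun x => by
    have := G₃.degree_le_maxDegree x
    rw [dg_eq_degree]
    omega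
  have h4 := eL_le_ed G₃
  rw [← ed_eq_card, ← ed_eq_card, ← ed_eq_card] at he
  refine Adm.pack (L := fun v w => G₃.Adj (Sum.inl v) (Sum.inr w)) ⟨hV₁.trans hV₂.symm,
    exists_nonadj_of_maxDegree_le (hV₁ ▸ hΔ₁), exists_nonadj_of_maxDegree_le (hV₂ ▸ hΔ₂),
    fun x => (dL_lt_iff (L := fun v w => G₃.Adj (Sum.inl v) (Sum.inr w)) x).1 ?_,
    fun y => (dL_lt_iff (L := flip fun v w => G₃.Adj (Sum.inl v) (Sum.inr w)) y).1 ?_, ?_⟩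
    fun h => hBE h.isBollobasEldridgePair
  · have := h3 (Sum.inl x)
    have := dL_inl_le G₃ x
    omega
  · have := h3 (Sum.inr y)
    have := dL_inr_le G₃ y
    omega
  · omega
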